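/- Let $\mathcal A=\{1,\dots,m\}$ and let $\zeta:\mathcal A\to\mathcal A^+$ be a substitution, extended to words by concatenation, with substitution matrix $\mathsf S(i,j)=$ number of symbols $i$ in $\zeta(j)$. Let $X_\zeta\subset\mathcal A^{\mathbb Z}$ be the set of two-sided sequences $x$ such that every block $x[-n,n]$ occurs as a subword of some $\zeta^k(a)$, $k\in\mathbb N$, $a\in\mathcal A$, and let $T$ be the left shift on $X_\zeta$. Assume that * $\zeta$ is primitive (some power of $\mathsf S$ has only positive entries) and aperiodic ($X_\zeta$ contains no $T$-periodic point); * the characteristic polynomial of $\mathsf S$ is irreducible over $\mathbb Q$; * $|\theta_2|>1$, where $\theta_1>|\theta_2|\ge\cdots$ are the eigenvalues of $\mathsf S$ ordered by modulus. Let $\mu$ be the (unique) $T$-invariant Borel probability measure on $X_\zeta$. For $\vec s$ in the simplex $\Delta^{m-1}=\{\vec s\in\mathbb R^m: s_j>0 \text{ for all } j,\ \sum_j s_j=1\}$ let $(\mathfrak X_\zeta^{\vec s},\widetilde\mu,h_t)$ be the suspension flow over $(X_\zeta,\mu,T)$ with roof function equal to $s_j$ on $\{x: x_0=j\}$; here $\mathfrak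 X_\zeta^{\vec s}=\{(x,t): x\in X_\zeta,\ 0\le t\le s_{x_0}\}$ with $(x,s_{x_0})$ and $(Tx,0)$ identified, and $\widetilde\mu$ is the normalized restriction of $\mu\times\mathrm{Leb}$. A Lip-cylindrical function is a function $f(x,t)=\psi_{x_0}(t)$, $0\le t<s_{x_0}$, with Lipschitz functions $\psi_a:[0,s_a]\to\mathbb C$, $a\in\mathcal A$; put $\|f\|_L=\max_a\|\psi_a\|_L$, where $\|\psi_a\|_L$ is the sum of the supremum norm and the best Lipschitz constant of $\psi_a$ on $[0,s_a]$. The spectral measure $\sigma_f$ is the finite positive Borel measure on $\mathbb R$ with $\int e^{2\pi i\omega t}\,d\sigma_f(\omega)=\int (f\circ h_t)\,\overline f\,d\widetilde\mu$ for all $t\in\mathbb R$. Then there is a constant $\gamma>0$, depending only on $\zeta$, such that for Lebesgue-almost every $\vec s\in\Delta^{m-1}$ there is $r_0=r_0(\vec s)>0$ such that for every Lip-cylindrical function $f$ with $\int f\,d\widetilde\mu=0$, $$\sigma_f([\omega-r,\omega+r])\le C\,r^{\gamma}\qquad\text{for all }\omega\in\mathbb R\text{ and }0<r\le r_0,$$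 where $C=C(\|f\|_L)>0$ depends only on $\|f\|_L$. -/

import Mathlib

open MeasureTheory Set
open scoped NNReal

/-- A substitution on the alphabet `Fin m`: every letter is mapped to a nonempty word. -/
structure Substitution (m : ℕ) where
  word : Fin m → List (Fin m)
  word_ne_nil : ∀ a, word a ≠ []

namespace Substitution

variable {m : ℕ}

/-- Extension of the substitution to finite words, by concatenation. -/
def onWords (ζ : Substitution m) (w : List (Fin m)) : List (Fin m) :=
  w.flatMap ζ.word

/-- The word `ζ^k(a)`. -/
def iter (ζ : Substitution m) (k : ℕ) (a : Fin m) : List (Fin m) :=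
  ζ.onWords^[k] [a]

/-- The substitution matrix: the entry `(i, j)` is the number of symbols `i` in `ζ(j)`. -/
def matrix (ζ : Substitution m) : Matrix (Fin m) (Fin m) ℕ :=
  Matrix.of fun i j => (ζ.word j).count i

/-- Some power of the substitution matrix has only positive entries. -/
def IsPrimitive (ζ : Substitution m) : Prop :=
  ∃ n : ℕ, 0 < n ∧ ∀ i j, 0 < (ζ.matrix ^ n) i j

/-- The block `x[-n, n]` of a two-sided sequence. -/
def centralBlock (x : ℤ → Fin m) (n : ℕ) : List (Fin m) :=
  List.ofFn fun j : Fin (2 * n + 1) => x ((j : ℤ) - (n : ℤ))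

/-- The substitution space `X_ζ`: all two-sided sequences each of whose blocks `x[-n, n]`
occurs as a subword (of consecutive letters) in some `ζ^k(a)`. -/
def space (ζ : Substitution m) : Set (ℤ → Fin m) :=
  {x | ∀ n : ℕ, ∃ (k : ℕ) (a : Fin m), centralBlock x n <:+: ζ.iter k a}

/-- The `n`-th power of the left shift on two-sided sequences. -/
def shift (n : ℤ) (x : ℤ → Fin m) : ℤ → Fin m :=
  fun k => x (k + n)

/-- The substitution dynamical system has no periodic points. -/
def IsAperiodic (ζ : Substitution m) : Prop :=
  ∀ x ∈ ζ.space, ∀ n : ℕ, 0 < n → shift (n : ℤ) x ≠ x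

/-- The characteristic polynomial of the substitution matrix is irreducible (over `ℚ`). -/
def HasIrreducibleCharpoly (ζ : Substitution m) : Prop :=
  Irreducible (ζ.matrix.map (fun k : ℕ => (k : ℚ))).charpoly

/-- The moduli of the complex eigenvalues of the substitution matrix, with multiplicity,
listed in decreasing order. -/
noncomputable def eigenvalueModuli (ζ : Substitution m) : List ℝ :=
  ((ζ.matrix.map (fun k : ℕ => (k : ℂ))).charpoly.roots.map fun z => ‖z‖).sort (· ≥ ·)

/-- `|θ₂|`, the modulus of the second eigenvalue (`0` if there are fewer than two). -/
noncomputable def secondEigenvalueModulus (ζ : Substitution m) : ℝ :=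
  ζ.eigenvalueModuli.getD 1 0

/-- `μ` is a Borel probability measure on `X_ζ` (regarded as a measure on all two-sided
sequences that is carried by `X_ζ`) which is invariant under the left shift. -/
structure IsInvariantMeasure (ζ : Substitution m) (μ : Measure (ℤ → Fin m)) : Prop where
  isProbabilityMeasure : IsProbabilityMeasure μ
  carried : μ ζ.spaceᶜ = 0
  invariant : MeasurePreserving (shift 1) μ μ

/-- The suspension space over `X_ζ` with roof function equal to `s_j` on the cylinder set `[j]`;
the points `(x, s_{x_0})` and `(T x, 0)` are identified, and represented by the latter. -/
def suspensionSpace (ζ : Substitution m) (s : Fin m → ℝ) : Set ((ℤ → Fin m) × ℝ) :=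
  {p | p.1 ∈ ζ.space ∧ 0 ≤ p.2 ∧ p.2 < s (p.1 0)}

/-- The invariant probability measure of the suspension flow: the restriction of the product of
`μ` and Lebesgue measure to the suspension space, normalized. -/
noncomputable def suspensionMeasure (ζ : Substitution m) (s : Fin m → ℝ)
    (μ : Measure (ℤ → Fin m)) : Measure ((ℤ → Fin m) × ℝ) :=
  ((μ.prod volume) (ζ.suspensionSpace s))⁻¹ • (μ.prod volume).restrict (ζ.suspensionSpace s)

end Substitution

section Suspension

variable {m : ℕ}

/-- The Birkhoff sum of the roof function over the orbit of `x`: it is `s_{x_0} + ⋯ + s_{x_{n-1}}`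
for `n ≥ 0`, and `-(s_{x_n} + ⋯ + s_{x_{-1}})` for `n < 0`. -/
noncomputable def roofSum (s : Fin m → ℝ) (x : ℤ → Fin m) (n : ℤ) : ℝ :=
  ∑ j ∈ Finset.Ico 0 n, s (x j) - ∑ j ∈ Finset.Ico n 0, s (x j)

/-- For positive `s`, the unique `n` with `roofSum s x n ≤ τ < roofSum s x (n + 1)`. -/
noncomputable def roofIndex (s : Fin m → ℝ) (x : ℤ → Fin m) (τ : ℝ) : ℤ :=
  sSup {n : ℤ | roofSum s x n ≤ τ}

/-- The suspension flow `h_t`: move upwards with unit speed, and pass from `(x, s_{x_0})` to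
`(T x, 0)`. -/
noncomputable def suspensionFlow (s : Fin m → ℝ) (t : ℝ) (p : (ℤ → Fin m) × ℝ) :
    (ℤ → Fin m) × ℝ :=
  (Substitution.shift (roofIndex s p.1 (p.2 + t)) p.1,
    p.2 + t - roofSum s p.1 (roofIndex s p.1 (p.2 + t)))

/-- The cylindrical function `f(x, t) = ψ_{x_0}(t)`. -/
def cylindrical (ψ : Fin m → ℝ → ℂ) (p : (ℤ → Fin m) × ℝ) : ℂ :=
  ψ (p.1 0) p.2

/-- `ψ_a` is Lipschitz on `[0, s_a]` for every letter `a`. -/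
def IsLipCylindrical (s : Fin m → ℝ) (ψ : Fin m → ℝ → ℂ) : Prop :=
  ∀ a, ∃ K : ℝ≥0, LipschitzOnWith K (ψ a) (Icc 0 (s a))

/-- The Lipschitz norm of a function on `[0, ℓ]`: supremum norm plus best Lipschitz constant. -/
noncomputable def lipNorm (ℓ : ℝ) (φ : ℝ → ℂ) : ℝ :=
  (⨆ t : Icc (0 : ℝ) ℓ, ‖φ t‖) + (sInf {K : ℝ≥0 | LipschitzOnWith K φ (Icc 0 ℓ)} : ℝ≥0)

/-- `‖f‖_L = max_a ‖ψ_a‖_L`. -/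
noncomputable def cylLipNorm (s : Fin m → ℝ) (ψ : Fin m → ℝ → ℂ) : ℝ :=
  ⨆ a, lipNorm (s a) (ψ a)

/-- The strictly positive vectors with sum of coordinates one. -/
def positiveSimplex (m : ℕ) : Set (Fin m → ℝ) :=
  {s | (∀ i, 0 < s i) ∧ ∑ i, s i = 1}

/-- Lebesgue measure on the simplex, as the `(m - 1)`-dimensional Hausdorff measure. (The distance
on `Fin m → ℝ` is the maximum distance; on the hyperplane that contains the simplex the resulting
Hausdorff measure is a positive finite multiple of Lebesgue measure, so the null sets are the
same.) -/
noncomputable def simplexMeasure (m : ℕ) : Measure (Fin m → ℝ) :=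
  (Measure.hausdorffMeasure ((m : ℝ) - 1)).restrict (positiveSimplex m)

end Suspension

/-- `σ` is the spectral measure of `f` for the measure-preserving flow `h` on `(Ω, ν)`: the finite
positive Borel measure on `ℝ` with `∫ e^{2πiωt} dσ(ω) = ⟨f ∘ h_t, f⟩` for all `t`. (Finite measures
on `ℝ` are determined by their Fourier transforms.) -/
structure IsSpectralMeasure {Ω : Type*} [MeasurableSpace Ω] (ν : Measure Ω) (h : ℝ → Ω → Ω)
    (f : Ω → ℂ) (σ : Measure ℝ) : Prop where
  isFiniteMeasure : IsFiniteMeasure σ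
  fourier : ∀ t : ℝ, ∫ ω : ℝ, Complex.exp (2 * Real.pi * Complex.I * ω * t) ∂σ =
    ∫ y, f (h t y) * (starRingEnd ℂ) (f y) ∂ν

/-!
A Lip-cylindrical function is determined by the symbolic coding, so `σ_f([ω - r, ω + r])` is
controlled, via the Fejér kernel, by sums of phases along orbit segments of length `1 / r`, and
these split into twisted sums over the words `ζⁿ(b)`. Since `ζ` is primitive, some return word `w`
occurs in every `ζ^q(b)`, followed by its first letter: the two copies of a word `ζⁿ(a)` at distance
`x_n = ω |ζⁿ(w)|_s` interfere, and the twisted sums lose a fixed factor at level `n` whenever `x_n`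
is not close to an integer.

The sequence `x_n` satisfies the integer recurrence of the characteristic polynomial of `S`, and so
does the sequence of nearest integers as long as the distances are small. Counting the integer
sequences that violate the recurrence at few times, and using that two eigenvalues lie outside the
unit circle so that eliminating `ω` confines `s` to a thin slab, the Erdős–Kahane argument shows
that for almost every `s` a positive proportion of the `x_n` stay away from the integers, uniformly
for `κ^{-M} ≤ |ω| ≤ κ^M`. Near `ω = 0` the mean-zero condition and the exponential rate of unique
ergodicity take over, and for large `|ω|` the Lipschitz condition bounds the tail of `σ_f`.
-/

/-! ### Words and blocks -/

section Words

variable {α β : Type*}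

lemma length_flatMap_le (g : α → List β) {L : ℕ} (hL : ∀ a, (g a).length ≤ L) (w : List α) :
    (w.flatMap g).length ≤ w.length * L := by
  rw [List.length_flatMap]
  simpa using List.sum_le_card_nsmul (w.map fun a => (g a).length) L
    (by simpa using fun a _ => hL a)

lemma exists_eq_flatMap_append_of_prefix (g : α → List β) {L : ℕ} (hL : ∀ a, (g a).length ≤ L)
    (w : List α) (B : List β) (h : B <+: w.flatMap g) :
    ∃ (w' : List α) (v : List β), B = w'.flatMap g ++ v ∧ v.length ≤ L := by
  induction w generalizing B with
  | nil => exact ⟨[], [], by simpa using h, by simp⟩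
  | cons a w ih =>
    rw [List.flatMap_cons] at h
    obtain ⟨t, ht⟩ := h
    rcases List.append_eq_append_iff.1 ht with ⟨c, hc, -⟩ | ⟨c, hB, hc⟩
    · have hBL : B.length ≤ (g a).length := by simp [hc]
      exact ⟨[], B, by simp, hBL.trans (hL a)⟩
    · obtain ⟨w', v, rfl, hv⟩ := ih c ⟨t, hc.symm⟩
      exact ⟨a :: w', v, by simp [hB], hv⟩

lemma exists_eq_append_flatMap_append_of_infix (g : α → List β) {L : ℕ}
    (hL : ∀ a, (g a).length ≤ L) (w : List α) (B : List β) (h : B <:+: w.flatMap g) :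
    ∃ (u : List β) (w' : List α) (v : List β), B = u ++ w'.flatMap g ++ v ∧
      u.length ≤ L ∧ v.length ≤ L := by
  induction w with
  | nil => exact ⟨[], [], [], by simpa using h, by simp, by simp⟩
  | cons a w ih =>
    rw [List.flatMap_cons] at h
    rcases List.infix_append_iff.1 h with h | h | ⟨u, B', rfl, hu, hB'⟩
    · exact ⟨B, [], [], by simp, h.length_le.trans (hL a), by simp⟩
    · exact ih h
    · obtain ⟨w', v, rfl, hv⟩ := exists_eq_flatMap_append_of_prefix g hL w B' hB'
      exact ⟨u, w', v, by simp, hu.length_le.trans (hL a), hv⟩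

/-- The block `x[0, J)` of a two-sided sequence. -/
def initialBlock (x : ℤ → α) (J : ℕ) : List α :=
  (List.range J).map fun j : ℕ => x j

lemma initialBlock_succ (x : ℤ → α) (J : ℕ) :
    initialBlock x (J + 1) = initialBlock x J ++ [x J] := by
  simp [initialBlock, List.range_succ]

lemma length_initialBlock (x : ℤ → α) (J : ℕ) : (initialBlock x J).length = J := by
  simp [initialBlock]

end Words

namespace Substitution

variable {m : ℕ} (ζ : Substitution m)

lemma iter_zero (b : Fin m) : ζ.iter 0 b = [b] := rfl

lemma iterate_onWords (n : ℕ) (w : List (Fin m)) : ζ.onWords^[n] w = w.flatMap (ζ.iter n) := by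
  induction n generalizing w with
  | zero => simp [funext ζ.iter_zero]
  | succ n ih =>
    have hsucc (a : Fin m) : ζ.iter (n + 1) a = (ζ.word a).flatMap (ζ.iter n) := by
      rw [← ih]
      simp [iter, onWords]
    rw [Function.iterate_succ_apply, ih, onWords, List.flatMap_assoc, ← funext hsucc]

lemma iter_add (n k : ℕ) (b : Fin m) : ζ.iter (n + k) b = (ζ.iter k b).flatMap (ζ.iter n) := by
  rw [iter, Function.iterate_add_apply, iterate_onWords]
  rfl

lemma iter_one (b : Fin m) : ζ.iter 1 b = ζ.word b := by
  simp [iter, onWords]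

lemma count_onWords (w : List (Fin m)) (i : Fin m) :
    (ζ.onWords w).count i = (ζ.matrix.mulVec fun j => w.count j) i := by
  induction w with
  | nil => simp [onWords, Matrix.mulVec, dotProduct]
  | cons a w ih =>
    have hcons : ζ.onWords (a :: w) = ζ.word a ++ ζ.onWords w := by simp [onWords]
    rw [hcons, List.count_append, ih]
    simp only [Matrix.mulVec, dotProduct, List.count_cons, mul_add, Finset.sum_add_distrib]
    simp [matrix, add_comm]

lemma count_iterate_onWords (n : ℕ) (w : List (Fin m)) (i : Fin m) :
    (ζ.onWords^[n] w).count i = ((ζ.matrix ^ n).mulVec fun j => w.count j) i := by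
  induction n generalizing i with
  | zero => simp
  | succ n ih =>
    rw [Function.iterate_succ_apply', count_onWords, funext ih, pow_succ', Matrix.mulVec_mulVec]

lemma iter_ne_nil (n : ℕ) (a : Fin m) : ζ.iter n a ≠ [] := by
  induction n with
  | zero => simp [iter_zero]
  | succ n ih =>
    obtain ⟨x, hx⟩ := List.exists_mem_of_ne_nil _ ih
    rw [add_comm, iter_add, Ne, List.flatMap_eq_nil_iff]
    exact fun h => ζ.word_ne_nil x (ζ.iter_one x ▸ h x hx)

lemma length_iter_pos (n : ℕ) (a : Fin m) : 0 < (ζ.iter n a).length :=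
  List.length_pos_iff.2 (ζ.iter_ne_nil n a)

/-- A base `Λ ≥ 2` for the exponential bound `|ζ^n(a)| ≤ Λ^n` on the lengths of iterates. -/
def lengthBase : ℕ := 2 + ∑ a, (ζ.word a).length

lemma two_le_lengthBase : 2 ≤ ζ.lengthBase := Nat.le_add_right 2 _

lemma length_iter_le (n : ℕ) (a : Fin m) : (ζ.iter n a).length ≤ ζ.lengthBase ^ n := by
  induction n generalizing a with
  | zero => simp [iter_zero]
  | succ n ih =>
    have hword : (ζ.word a).length ≤ ζ.lengthBase :=
      (Finset.single_le_sum (f := fun a => (ζ.word a).length) (fun _ _ => Nat.zero_le _)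
        (Finset.mem_univ a)).trans (Nat.le_add_left _ 2)
    rw [iter_add, iter_one, pow_succ']
    exact (length_flatMap_le _ ih _).trans (Nat.mul_le_mul_right _ hword)

lemma initialBlock_infix_centralBlock (x : ℤ → Fin m) (J : ℕ) :
    initialBlock x J <:+: centralBlock x J := by
  have hprefix : initialBlock x J <+: (centralBlock x J).drop J := by
    rw [List.prefix_iff_getElem?]
    intro i hi
    rw [length_initialBlock] at hi
    rw [List.getElem?_drop, centralBlock, List.getElem?_ofFn, dif_pos (by omega)]
    simp [initialBlock]
  exact hprefix.isInfix.trans (List.drop_suffix J _).isInfix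

variable {ζ}

lemma exists_initialBlock_eq {x : ℤ → Fin m} (hx : x ∈ ζ.space) (n J : ℕ) :
    ∃ u w v : List (Fin m), initialBlock x J = u ++ w.flatMap (ζ.iter n) ++ v ∧
      u.length ≤ ζ.lengthBase ^ n ∧ v.length ≤ ζ.lengthBase ^ n := by
  obtain ⟨k, a, hk⟩ := hx J
  have hinfix := (initialBlock_infix_centralBlock x J).trans hk
  rcases le_total n k with hnk | hkn
  · obtain ⟨l, rfl⟩ := Nat.exists_eq_add_of_le hnk
    rw [iter_add] at hinfix
    exact exists_eq_append_flatMap_append_of_infix _ (ζ.length_iter_le n) _ _ hinfix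
  · have hpow : ζ.lengthBase ^ k ≤ ζ.lengthBase ^ n :=
      Nat.pow_le_pow_right (by linarith [ζ.two_le_lengthBase]) hkn
    exact ⟨initialBlock x J, [], [], by simp,
      hinfix.length_le.trans ((ζ.length_iter_le k a).trans hpow), by simp⟩

lemma length_iter_le_of_mem {n k : ℕ} {a b : Fin m} (h : a ∈ ζ.iter k b) :
    (ζ.iter n a).length ≤ (ζ.iter (n + k) b).length := by
  rw [iter_add]
  exact (List.infix_flatMap_of_mem h (ζ.iter n)).length_le

lemma IsPrimitive.exists_mem_iter (h : ζ.IsPrimitive) : ∃ p, ∀ a b, a ∈ ζ.iter p b := by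
  obtain ⟨p, -, hp⟩ := h
  refine ⟨p, fun a b => List.count_pos_iff.1 ?_⟩
  have hcol : (fun j => [b].count j) = Pi.single b 1 := by
    ext j
    rcases eq_or_ne j b with rfl | hj
    · simp
    · simp [hj, List.count_eq_zero]
  rw [iter, count_iterate_onWords, hcol, Matrix.mulVec_single_one]
  exact hp a b

lemma IsPrimitive.exists_length_iter_add_le_mul (h : ζ.IsPrimitive) (q : ℕ) :
    ∃ K : ℕ, 0 < K ∧ ∀ n b c, (ζ.iter (n + q) b).length ≤ K * (ζ.iter n c).length := by
  obtain ⟨p, hp⟩ := h.exists_mem_iter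
  have hΛ := ζ.two_le_lengthBase
  refine ⟨ζ.lengthBase ^ (p + q), by positivity, fun n b c => ?_⟩
  rcases lt_or_ge n p with hn | hn
  · calc (ζ.iter (n + q) b).length ≤ ζ.lengthBase ^ (n + q) := ζ.length_iter_le _ _
      _ ≤ ζ.lengthBase ^ (p + q) := Nat.pow_le_pow_right (by omega) (by omega)
      _ ≤ _ := Nat.le_mul_of_pos_right _ (ζ.length_iter_pos n c)
  · obtain ⟨k, rfl⟩ := Nat.exists_eq_add_of_le' hn
    rw [add_assoc, iter_add]
    exact (length_flatMap_le _ (fun a => length_iter_le_of_mem (hp a c)) _).trans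
      (Nat.mul_le_mul_right _ (ζ.length_iter_le _ _))

lemma IsPrimitive.exists_returnWord (h : ζ.IsPrimitive) (hm : 2 ≤ m) :
    ∃ (q : ℕ) (c : Fin m) (v : List (Fin m)), ∀ b, (c :: v) ++ [c] <:+: ζ.iter q b := by
  obtain ⟨p, hp⟩ := h.exists_mem_iter
  let c : Fin m := ⟨0, by omega⟩
  have hlen : 2 ≤ (ζ.iter p c).length := by
    refine hm.trans ?_
    simpa using (Finset.card_le_card fun a _ => List.mem_toFinset.2 (hp a c) :
      (Finset.univ : Finset (Fin m)).card ≤ _).trans (List.toFinset_card_le _)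
  obtain ⟨x, y, rest, hxy⟩ : ∃ x y rest, ζ.iter p c = x :: y :: rest := by
    match hw : ζ.iter p c with
    | [] | [_] => simp [hw] at hlen
    | x :: y :: rest => exact ⟨x, y, rest, rfl⟩
  -- `c` occurs in `ζ^p(x)` and in `ζ^p(y)`, hence twice in `ζ^{2p}(c)`.
  obtain ⟨A, B, hA⟩ := List.append_of_mem (hp c x)
  obtain ⟨C, D, hC⟩ := List.append_of_mem (hp c y)
  refine ⟨p + p + p, c, B ++ C, fun b => ?_⟩
  have hc : (c :: (B ++ C)) ++ [c] <:+: ζ.iter (p + p) c := by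
    rw [iter_add, hxy]
    exact ⟨A, D ++ rest.flatMap (ζ.iter p), by simp [hA, hC]⟩
  rw [iter_add]
  exact hc.trans (List.infix_flatMap_of_mem (hp c b) _)

end Substitution

/-! ### Twisted sums over words -/

lemma prod_range_succ_add_le_mul {R : ℕ → ℝ} (h0 : ∀ n, 0 ≤ R n) {κ : ℝ} {q n : ℕ} (hq : 0 < q)
    (hn : R (n + q) ≤ κ * R n) :
    ∏ j ∈ Finset.range q, R (n + 1 + j) ≤ κ * ∏ j ∈ Finset.range q, R (n + j) := by
  obtain ⟨k, rfl⟩ := Nat.exists_eq_add_of_le' hq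
  rw [Finset.prod_range_succ, Finset.prod_range_succ' (fun j => R (n + j))]
  simp only [add_zero, add_assoc, add_comm 1] at hn ⊢
  have hprod : 0 ≤ ∏ j ∈ Finset.range k, R (n + (j + 1)) := Finset.prod_nonneg fun _ _ => h0 _
  linarith [mul_le_mul_of_nonneg_left hn hprod]

lemma le_pow_card_inter_range_mul {P : ℕ → ℝ} (hP : Antitone P) {κ : ℝ} (hκ : 0 ≤ κ)
    {T : Finset ℕ} (hT : ∀ n ∈ T, P (n + 1) ≤ κ * P n) (N : ℕ) :
    P N ≤ κ ^ (Finset.range N ∩ T).card * P 0 := by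
  induction N with
  | zero => simp
  | succ N ih =>
    rw [Finset.range_add_one]
    by_cases hN : N ∈ T
    · rw [Finset.insert_inter_of_mem hN, Finset.card_insert_of_notMem (by simp), pow_succ',
        mul_assoc]
      exact (hT N hN).trans (mul_le_mul_of_nonneg_left ih hκ)
    · rw [Finset.insert_inter_of_notMem hN]
      exact (hP N.le_succ).trans ih

-- Apply the one-step estimate to `n ↦ R n * ⋯ * R (n + q - 1)`.
lemma pow_le_pow_mul_pow_card {R : ℕ → ℝ} (hR : Antitone R) (h0 : ∀ n, 0 ≤ R n) {κ : ℝ}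
    (hκ : 0 ≤ κ) {q : ℕ} (hq : 0 < q) {N : ℕ} {T : Finset ℕ}
    (hT : ∀ n ∈ T, R (n + q) ≤ κ * R n) (hTN : T ⊆ Finset.range N) :
    R (N + q) ^ q ≤ R 0 ^ q * κ ^ T.card := by
  have hanti : Antitone fun n => ∏ j ∈ Finset.range q, R (n + j) := fun _ _ h =>
    Finset.prod_le_prod (fun _ _ => h0 _) fun j _ => hR (Nat.add_le_add_right h j)
  have hdecay := le_pow_card_inter_range_mul hanti hκ
    (fun n hn => prod_range_succ_add_le_mul h0 hq (hT n hn)) N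
  rw [Finset.inter_eq_right.2 hTN] at hdecay
  calc R (N + q) ^ q = ∏ _j ∈ Finset.range q, R (N + q) := by simp
    _ ≤ ∏ j ∈ Finset.range q, R (N + j) := Finset.prod_le_prod (fun _ _ => h0 _) fun j hj =>
        hR (Nat.add_le_add_left (Finset.mem_range.1 hj).le N)
    _ ≤ κ ^ T.card * ∏ j ∈ Finset.range q, R (0 + j) := hdecay
    _ ≤ κ ^ T.card * ∏ _j ∈ Finset.range q, R 0 := by
        gcongr with j
        · exact fun _ _ => h0 _
        · exact hR (Nat.zero_le _)
    _ = R 0 ^ q * κ ^ T.card := by simp [mul_comm]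

/-- The phase factor `e^{-2πix}`. -/
noncomputable def phase (x : ℝ) : ℂ := Complex.exp (-(2 * Real.pi * x : ℝ) * Complex.I)

lemma phase_zero : phase 0 = 1 := by simp [phase]

lemma phase_add (x y : ℝ) : phase (x + y) = phase x * phase y := by
  rw [phase, phase, phase, ← Complex.exp_add]
  congr 1
  push_cast
  ring

lemma norm_phase (x : ℝ) : ‖phase x‖ = 1 := by
  rw [phase, ← Complex.ofReal_neg, Complex.norm_exp_ofReal_mul_I]

lemma phase_re (x : ℝ) : (phase x).re = Real.cos (2 * Real.pi * x) := by
  rw [phase, ← Complex.ofReal_neg, Complex.exp_ofReal_mul_I_re, Real.cos_neg]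

lemma continuous_phase : Continuous phase := by
  unfold phase
  fun_prop

lemma cos_two_pi_mul_le (x : ℝ) : Real.cos (2 * Real.pi * x) ≤ 1 - 8 * (x - round x) ^ 2 := by
  have hround : |x - round x| ≤ 1 / 2 := abs_sub_round x
  have hperiod : 2 * Real.pi * x = 2 * Real.pi * (x - round x) + round x * (2 * Real.pi) := by ring
  have hle : |2 * Real.pi * (x - round x)| ≤ Real.pi := by
    rw [abs_mul, abs_of_pos Real.two_pi_pos]
    nlinarith [Real.pi_pos]
  rw [hperiod, Real.cos_add_int_mul_two_pi]
  refine (Real.cos_le_one_sub_mul_cos_sq hle).trans (le_of_eq ?_)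
  field_simp
  ring

lemma norm_one_add_phase_le (x : ℝ) : ‖1 + phase x‖ ≤ 2 - 4 * (x - round x) ^ 2 := by
  have hround : (x - round x) ^ 2 ≤ 1 / 4 := by
    rw [← sq_abs]
    nlinarith [abs_sub_round x, abs_nonneg (x - round x)]
  have hsq : ‖1 + phase x‖ ^ 2 = 2 + 2 * Real.cos (2 * Real.pi * x) := by
    rw [Complex.sq_norm, Complex.normSq_add, map_one, ← Complex.sq_norm, norm_phase]
    simp only [one_pow, one_mul, Complex.conj_re, phase_re]
    ring
  refine le_of_sq_le_sq ?_ (by linarith)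
  rw [hsq]
  nlinarith [cos_two_pi_mul_le x, sq_nonneg ((x - round x) ^ 2)]

section WordSum

variable {α M : Type*}

/-- The sum of the values `F a` over the letters of a word; for a roof vector `s` it is the length
of the word when each letter `a` is a tile of length `s a`. -/
def wordSum [AddMonoid M] (F : α → M) (w : List α) : M := (w.map F).sum

lemma wordSum_cons [AddMonoid M] (F : α → M) (a : α) (w : List α) :
    wordSum F (a :: w) = F a + wordSum F w := by simp [wordSum]

lemma wordSum_append [AddMonoid M] (F : α → M) (u v : List α) :
    wordSum F (u ++ v) = wordSum F u + wordSum F v := by simp [wordSum]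

lemma wordSum_neg [AddCommGroup M] (F : α → M) (w : List α) : wordSum (-F) w = -wordSum F w := by
  induction w with
  | nil => simp [wordSum]
  | cons a w ih => rw [wordSum_cons, wordSum_cons, ih, Pi.neg_apply, neg_add]

lemma wordSum_eq_sum_count [Fintype α] [DecidableEq α] (s : α → ℝ) (w : List α) :
    wordSum s w = ∑ a, (w.count a : ℝ) * s a := by
  rw [wordSum, Finset.sum_list_map_count]
  simp only [nsmul_eq_mul]
  refine Finset.sum_subset (Finset.subset_univ _) fun a _ ha => ?_
  simp [List.count_eq_zero_of_not_mem (by simpa using ha)]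

lemma wordSum_initialBlock [AddCommMonoid M] (F : α → M) (x : ℤ → α) (J : ℕ) :
    wordSum F (initialBlock x J) = ∑ j ∈ Finset.range J, F (x j) := by
  simp [wordSum, initialBlock, Finset.sum, Function.comp_def, Finset.range, Multiset.range]

lemma abs_wordSum_le [Fintype α] (F : α → ℝ) (w : List α) : |wordSum F w| ≤ ‖F‖ * w.length := by
  induction w with
  | nil => simp [wordSum]
  | cons a w ih =>
    rw [wordSum_cons]
    push_cast [List.length_cons]
    linarith [abs_add_le (F a) (wordSum F w), norm_le_pi_norm F a, Real.norm_eq_abs (F a)]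

lemma wordSum_flatMap_le (F : α → ℝ) (g : α → List α) {U : ℝ}
    (hg : ∀ a, wordSum F (g a) ≤ U * (g a).length) (w : List α) :
    wordSum F (w.flatMap g) ≤ U * (w.flatMap g).length := by
  induction w with
  | nil => simp [wordSum]
  | cons a w ih =>
    rw [List.flatMap_cons, wordSum_append]
    push_cast [List.length_append]
    linarith [hg a]

end WordSum

section TwistedSum

variable {α : Type*}

/-- The twisted sum of `c` over a word: each letter is weighted by the phase, at frequency `ω`, of
the length of the word before it. -/
noncomputable def twistedSum (s : α → ℝ) (ω : ℝ) (c : α → ℂ) : List α → ℂ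
  | [] => 0
  | a :: w => c a + phase (ω * s a) * twistedSum s ω c w

variable (s : α → ℝ) (ω : ℝ) (c : α → ℂ)

lemma twistedSum_zero_eq_wordSum (w : List α) : twistedSum s 0 c w = wordSum c w := by
  induction w with
  | nil => rfl
  | cons a w ih => rw [twistedSum, zero_mul, phase_zero, one_mul, ih, wordSum_cons]

lemma twistedSum_append (u v : List α) :
    twistedSum s ω c (u ++ v) =
      twistedSum s ω c u + phase (ω * wordSum s u) * twistedSum s ω c v := by
  induction u with
  | nil => simp [twistedSum, wordSum, phase_zero]
  | cons a u ih =>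
    rw [List.cons_append, twistedSum, ih, twistedSum, wordSum_cons, mul_add ω, phase_add]
    ring

lemma norm_twistedSum_append_le (u v : List α) :
    ‖twistedSum s ω c (u ++ v)‖ ≤ ‖twistedSum s ω c u‖ + ‖twistedSum s ω c v‖ := by
  rw [twistedSum_append]
  refine (norm_add_le _ _).trans ?_
  rw [norm_mul, norm_phase, one_mul]

lemma norm_twistedSum_append_append_self_le (u v : List α) :
    ‖twistedSum s ω c (u ++ v ++ u)‖ ≤
      ‖1 + phase (ω * wordSum s (u ++ v))‖ * ‖twistedSum s ω c u‖ + ‖twistedSum s ω c v‖ := by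
  have hsplit : twistedSum s ω c (u ++ v ++ u) =
      (1 + phase (ω * wordSum s (u ++ v))) * twistedSum s ω c u +
        phase (ω * wordSum s u) * twistedSum s ω c v := by
    rw [twistedSum_append, twistedSum_append]
    ring
  rw [hsplit]
  refine (norm_add_le _ _).trans ?_
  rw [norm_mul, norm_mul, norm_phase, one_mul]

lemma norm_twistedSum_append_return_append_le {p u v t : List α} {ρ : ℝ}
    (hp : ‖twistedSum s ω c p‖ ≤ ρ * p.length) (hu : ‖twistedSum s ω c u‖ ≤ ρ * u.length)
    (hv : ‖twistedSum s ω c v‖ ≤ ρ * v.length) (ht : ‖twistedSum s ω c t‖ ≤ ρ * t.length) :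
    ‖twistedSum s ω c (p ++ (u ++ v ++ u) ++ t)‖ ≤ ρ * (p ++ (u ++ v ++ u) ++ t).length -
      (2 - ‖1 + phase (ω * wordSum s (u ++ v))‖) * (ρ * u.length) := by
  have hpair := mul_le_mul_of_nonneg_left hu
    (norm_nonneg (1 + phase (ω * wordSum s (u ++ v))))
  push_cast [List.length_append]
  linarith [norm_twistedSum_append_le s ω c (p ++ (u ++ v ++ u)) t,
    norm_twistedSum_append_le s ω c p (u ++ v ++ u),
    norm_twistedSum_append_append_self_le s ω c u v]

lemma norm_twistedSum_le [Fintype α] (w : List α) : ‖twistedSum s ω c w‖ ≤ ‖c‖ * w.length := by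
  induction w with
  | nil => simp [twistedSum]
  | cons a w ih =>
    rw [twistedSum]
    refine (norm_add_le _ _).trans ?_
    rw [norm_mul, norm_phase, one_mul]
    push_cast [List.length_cons]
    linarith [norm_le_pi_norm c a]

lemma norm_twistedSum_flatMap_le (g : α → List α) {ρ : ℝ}
    (hg : ∀ a, ‖twistedSum s ω c (g a)‖ ≤ ρ * (g a).length) (w : List α) :
    ‖twistedSum s ω c (w.flatMap g)‖ ≤ ρ * (w.flatMap g).length := by
  induction w with
  | nil => simp [twistedSum]
  | cons a w ih =>
    rw [List.flatMap_cons]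
    push_cast [List.length_append]
    linarith [norm_twistedSum_append_le s ω c (g a) (w.flatMap g), hg a]

end TwistedSum

namespace Substitution

variable {m : ℕ} (ζ : Substitution m) (s : Fin m → ℝ) (ω : ℝ) (c : Fin m → ℂ)

/-- The largest modulus of a twisted sum over a word `ζ^n(b)`, relative to the length of the
word. -/
noncomputable def twistedRate (n : ℕ) : ℝ :=
  ⨆ b, ‖twistedSum s ω c (ζ.iter n b)‖ / (ζ.iter n b).length

lemma norm_twistedSum_iter_le (n : ℕ) (b : Fin m) :
    ‖twistedSum s ω c (ζ.iter n b)‖ ≤ ζ.twistedRate s ω c n * (ζ.iter n b).length := by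
  rw [← div_le_iff₀ (by exact_mod_cast ζ.length_iter_pos n b)]
  exact le_ciSup (f := fun b => ‖twistedSum s ω c (ζ.iter n b)‖ / (ζ.iter n b).length)
    (Set.finite_range _).bddAbove b

lemma twistedRate_nonneg (n : ℕ) : 0 ≤ ζ.twistedRate s ω c n :=
  Real.iSup_nonneg fun _ => by positivity

variable {s ω c} in
lemma twistedRate_le {n : ℕ} {B : ℝ} (hB : 0 ≤ B)
    (h : ∀ b, ‖twistedSum s ω c (ζ.iter n b)‖ ≤ B * (ζ.iter n b).length) :
    ζ.twistedRate s ω c n ≤ B :=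
  Real.iSup_le (fun b => (div_le_iff₀ (by exact_mod_cast ζ.length_iter_pos n b)).2 (h b)) hB

lemma antitone_twistedRate : Antitone (ζ.twistedRate s ω c) := by
  refine antitone_nat_of_succ_le fun n => ?_
  refine ζ.twistedRate_le (ζ.twistedRate_nonneg s ω c n) fun b => ?_
  rw [iter_add]
  exact norm_twistedSum_flatMap_le s ω c _ (ζ.norm_twistedSum_iter_le s ω c n) _

lemma twistedRate_le_norm (n : ℕ) : ζ.twistedRate s ω c n ≤ ‖c‖ :=
  ζ.twistedRate_le (norm_nonneg c) fun _ => norm_twistedSum_le s ω c _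

lemma norm_twistedSum_initialBlock_le {x : ℤ → Fin m} (hx : x ∈ ζ.space) (n J : ℕ) :
    ‖twistedSum s ω c (initialBlock x J)‖ ≤
      2 * ‖c‖ * ζ.lengthBase ^ n + ζ.twistedRate s ω c n * J := by
  obtain ⟨u, w, v, hB, hu, hv⟩ := exists_initialBlock_eq hx n J
  have hJ : ((w.flatMap (ζ.iter n)).length : ℝ) ≤ J := by
    have hlen := length_initialBlock x J
    rw [hB, List.length_append, List.length_append] at hlen
    exact_mod_cast (by omega : (w.flatMap (ζ.iter n)).length ≤ J)
  have hshort {y : List (Fin m)} (hy : y.length ≤ ζ.lengthBase ^ n) :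
      ‖twistedSum s ω c y‖ ≤ ‖c‖ * ζ.lengthBase ^ n :=
    (norm_twistedSum_le s ω c y).trans (by gcongr; exact_mod_cast hy)
  have hw : ‖twistedSum s ω c (w.flatMap (ζ.iter n))‖ ≤ ζ.twistedRate s ω c n * J :=
    (norm_twistedSum_flatMap_le s ω c _ (ζ.norm_twistedSum_iter_le s ω c n) w).trans
      (mul_le_mul_of_nonneg_left hJ (ζ.twistedRate_nonneg s ω c n))
  rw [hB]
  linarith [norm_twistedSum_append_le s ω c (u ++ w.flatMap (ζ.iter n)) v,
    norm_twistedSum_append_le s ω c u (w.flatMap (ζ.iter n)), hshort hu, hshort hv]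

-- The two occurrences of `ζ^n(a)` contribute with phases that differ by `phase x`, so their joint
-- contribution is smaller than the trivial bound by the factor `‖1 + phase x‖ / 2`.
lemma twistedRate_add_le {q : ℕ} {a : Fin m} {v : List (Fin m)}
    (hv : ∀ b, (a :: v) ++ [a] <:+: ζ.iter q b) {n K : ℕ}
    (hK : ∀ b, (ζ.iter (n + q) b).length ≤ K * (ζ.iter n a).length) {x : ℝ}
    (hx : x = ω * wordSum s (ζ.onWords^[n] (a :: v))) :
    ζ.twistedRate s ω c (n + q) ≤
      (1 - 4 * (x - round x) ^ 2 / K) * ζ.twistedRate s ω c n := by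
  have hK1 : (1 : ℝ) ≤ K := by
    exact_mod_cast Nat.pos_of_mul_pos_right ((ζ.length_iter_pos (n + q) a).trans_le (hK a))
  have hgain_le : 4 * (x - round x) ^ 2 ≤ 1 := by
    rw [← sq_abs]
    nlinarith [abs_sub_round x, abs_nonneg (x - round x)]
  rw [iterate_onWords, List.flatMap_cons] at hx
  have hR := ζ.twistedRate_nonneg s ω c n
  have hrate := ζ.norm_twistedSum_iter_le s ω c n
  have hflat := norm_twistedSum_flatMap_le s ω c (ζ.iter n) hrate
  refine ζ.twistedRate_le (mul_nonneg ?_ hR) fun b => ?_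
  · rw [sub_nonneg, div_le_one (by positivity)]
    exact hgain_le.trans hK1
  obtain ⟨P, Q, hPQ⟩ := hv b
  have hiter : ζ.iter (n + q) b = P.flatMap (ζ.iter n) ++
      (ζ.iter n a ++ v.flatMap (ζ.iter n) ++ ζ.iter n a) ++ Q.flatMap (ζ.iter n) := by
    simp [iter_add, ← hPQ]
  have hreturn := norm_twistedSum_append_return_append_le s ω c (hflat P) (hrate a) (hflat v)
    (hflat Q)
  rw [← hiter, ← hx] at hreturn
  have hphase : 4 * (x - round x) ^ 2 ≤ 2 - ‖1 + phase x‖ := by linarith [norm_one_add_phase_le x]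
  have hlen : ((ζ.iter (n + q) b).length : ℝ) / K ≤ (ζ.iter n a).length := by
    rw [div_le_iff₀' (by positivity)]
    exact_mod_cast hK b
  calc ‖twistedSum s ω c (ζ.iter (n + q) b)‖
      ≤ ζ.twistedRate s ω c n * (ζ.iter (n + q) b).length -
        (2 - ‖1 + phase x‖) * (ζ.twistedRate s ω c n * (ζ.iter n a).length) := hreturn
    _ ≤ ζ.twistedRate s ω c n * (ζ.iter (n + q) b).length -
        4 * (x - round x) ^ 2 *
          (ζ.twistedRate s ω c n * ((ζ.iter (n + q) b).length / K)) := by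
      gcongr
      exact le_trans (by positivity) hphase
    _ = _ := by ring

end Substitution

/-! ### Averages over long words -/

namespace Substitution

section Average

variable {m : ℕ} (ζ : Substitution m) (F : Fin m → ℝ)

/-- The largest average of `F` over a word `ζ^n(b)`. -/
noncomputable def maxAverage (n : ℕ) : ℝ :=
  ⨆ b, wordSum F (ζ.iter n b) / (ζ.iter n b).length

lemma wordSum_iter_le (n : ℕ) (b : Fin m) :
    wordSum F (ζ.iter n b) ≤ ζ.maxAverage F n * (ζ.iter n b).length := by
  rw [← div_le_iff₀ (by exact_mod_cast ζ.length_iter_pos n b)]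
  exact le_ciSup (f := fun b => wordSum F (ζ.iter n b) / (ζ.iter n b).length)
    (Set.finite_range _).bddAbove b

/-- The difference between the largest and the smallest average of `F` over the words `ζ^n(b)`. -/
noncomputable def averageOsc (n : ℕ) : ℝ := ζ.maxAverage F n + ζ.maxAverage (-F) n

lemma averageOsc_mul_length_le (n : ℕ) (b : Fin m) :
    (-ζ.averageOsc F n + ζ.maxAverage F n) * (ζ.iter n b).length ≤ wordSum F (ζ.iter n b) := by
  have hle := ζ.wordSum_iter_le (-F) n b
  rw [wordSum_neg] at hle
  rw [averageOsc]
  linarith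

variable [Nonempty (Fin m)]

variable {F} in
lemma maxAverage_le {n : ℕ} {B : ℝ} (h : ∀ b, wordSum F (ζ.iter n b) ≤ B * (ζ.iter n b).length) :
    ζ.maxAverage F n ≤ B :=
  ciSup_le fun b => (div_le_iff₀ (by exact_mod_cast ζ.length_iter_pos n b)).2 (h b)

lemma exists_wordSum_iter_eq (n : ℕ) :
    ∃ b, wordSum F (ζ.iter n b) = ζ.maxAverage F n * (ζ.iter n b).length := by
  obtain ⟨b, hb⟩ := exists_eq_ciSup_of_finite
    (f := fun b => wordSum F (ζ.iter n b) / (ζ.iter n b).length)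
  refine ⟨b, ?_⟩
  have hpos : (0 : ℝ) < (ζ.iter n b).length := by exact_mod_cast ζ.length_iter_pos n b
  rw [maxAverage, ← hb, div_mul_cancel₀ _ hpos.ne']

lemma abs_maxAverage_le (n : ℕ) : |ζ.maxAverage F n| ≤ ‖F‖ := by
  obtain ⟨b, hb⟩ := ζ.exists_wordSum_iter_eq F n
  have hpos : (0 : ℝ) < (ζ.iter n b).length := by exact_mod_cast ζ.length_iter_pos n b
  have habs := abs_wordSum_le F (ζ.iter n b)
  rw [hb, abs_mul, abs_of_pos hpos] at habs
  exact le_of_mul_le_mul_right habs hpos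

lemma antitone_maxAverage : Antitone (ζ.maxAverage F) := by
  refine antitone_nat_of_succ_le fun n => ζ.maxAverage_le fun b => ?_
  rw [iter_add]
  exact wordSum_flatMap_le _ _ (ζ.wordSum_iter_le F n) _

lemma wordSum_initialBlock_le {x : ℤ → Fin m} (hx : x ∈ ζ.space) (n J : ℕ) :
    wordSum F (initialBlock x J) ≤
      ζ.maxAverage F n * J + 4 * ‖F‖ * ζ.lengthBase ^ n := by
  obtain ⟨u, w, v, hB, hu, hv⟩ := exists_initialBlock_eq hx n J
  have hJ := length_initialBlock x J
  rw [hB] at hJ ⊢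
  simp only [List.length_append] at hJ
  rw [wordSum_append, wordSum_append, ← hJ]
  have hsum_u := (abs_le.1 (abs_wordSum_le F u)).2
  have hsum_v := (abs_le.1 (abs_wordSum_le F v)).2
  have hsum_w := wordSum_flatMap_le F _ (ζ.wordSum_iter_le F n) w
  have hmax := (abs_le.1 (ζ.abs_maxAverage_le F n)).1
  have hu' : (u.length : ℝ) ≤ (ζ.lengthBase : ℝ) ^ n := by exact_mod_cast hu
  have hv' : (v.length : ℝ) ≤ (ζ.lengthBase : ℝ) ^ n := by exact_mod_cast hv
  have hF := norm_nonneg F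
  push_cast
  nlinarith

lemma averageOsc_nonneg (n : ℕ) : 0 ≤ ζ.averageOsc F n := by
  obtain ⟨b, hb⟩ := ζ.exists_wordSum_iter_eq F n
  have hpos : (0 : ℝ) < (ζ.iter n b).length := by exact_mod_cast ζ.length_iter_pos n b
  have hle := ζ.averageOsc_mul_length_le F n b
  rw [hb] at hle
  linarith [le_of_mul_le_mul_right hle hpos]

lemma averageOsc_le (n : ℕ) : ζ.averageOsc F n ≤ 2 * ‖F‖ := by
  have hpos := (abs_le.1 (ζ.abs_maxAverage_le F n)).2
  have hneg := (abs_le.1 (ζ.abs_maxAverage_le (-F) n)).2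
  rw [norm_neg] at hneg
  rw [averageOsc]
  linarith

lemma averageOsc_add_le {p n K : ℕ} (hp : ∀ a b, a ∈ ζ.iter p b) (hK : 0 < K)
    (hlen : ∀ b c, (ζ.iter (n + p) b).length ≤ K * (ζ.iter n c).length) :
    ζ.averageOsc F (n + p) ≤ (1 - (K : ℝ)⁻¹) * ζ.averageOsc F n := by
  have hK' : (0 : ℝ) < K := by exact_mod_cast hK
  have hosc := ζ.averageOsc_nonneg F n
  obtain ⟨a, ha⟩ := ζ.exists_wordSum_iter_eq (-F) n
  rw [wordSum_neg] at ha
  suffices hmax : ζ.maxAverage F (n + p) ≤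
      ζ.maxAverage F n - (K : ℝ)⁻¹ * ζ.averageOsc F n by
    have hneg := ζ.antitone_maxAverage (-F) (Nat.le_add_right n p)
    rw [averageOsc] at hmax ⊢
    rw [averageOsc]
    linarith
  -- The letter `a`, whose average is the smallest one, occurs in `ζ^p(b)`, and it occupies at
  -- least the fraction `1 / K` of `ζ^(n + p)(b)`.
  refine ζ.maxAverage_le fun b => ?_
  obtain ⟨P, Q, hPQ⟩ := List.append_of_mem (hp a b)
  have hiter : ζ.iter (n + p) b =
      P.flatMap (ζ.iter n) ++ (ζ.iter n a ++ Q.flatMap (ζ.iter n)) := by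
    rw [iter_add, hPQ, List.flatMap_append, List.flatMap_cons]
  have hP := wordSum_flatMap_le F _ (ζ.wordSum_iter_le F n) P
  have hQ := wordSum_flatMap_le F _ (ζ.wordSum_iter_le F n) Q
  have hfraction : (K : ℝ)⁻¹ * (ζ.iter (n + p) b).length ≤ (ζ.iter n a).length := by
    rw [inv_mul_le_iff₀ hK']
    exact_mod_cast hlen b a
  have hgain := mul_le_mul_of_nonneg_left hfraction hosc
  rw [hiter] at hgain ⊢
  rw [wordSum_append, wordSum_append]
  rw [averageOsc] at hgain ⊢
  push_cast [List.length_append] at hgain ⊢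
  linarith

end Average

end Substitution

section Letter

variable {α E : Type*} [Finite α] [MeasurableSpace α] [DiscreteMeasurableSpace α]

lemma stronglyMeasurable_comp_apply [TopologicalSpace E] (g : α → E) (k : ℤ) :
    StronglyMeasurable fun x : ℤ → α => g (x k) :=
  (StronglyMeasurable.of_discrete (f := g)).comp_measurable (measurable_pi_apply k)

lemma integrable_comp_apply [NormedAddCommGroup E] (μ : Measure (ℤ → α)) [IsFiniteMeasure μ]
    (g : α → E) (k : ℤ) : Integrable (fun x => g (x k)) μ := by
  obtain ⟨C, hC⟩ := (Set.finite_range fun a => ‖g a‖).bddAbove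
  exact .of_bound (stronglyMeasurable_comp_apply g k).aestronglyMeasurable C
    (.of_forall fun x => hC ⟨x k, rfl⟩)

end Letter

lemma le_of_forall_natCast_mul_le_mul_add {a b C : ℝ} (h : ∀ J : ℕ, J * a ≤ b * J + C) :
    a ≤ b := by
  by_contra! hlt
  obtain ⟨J, hJ⟩ := exists_nat_gt (C / (a - b))
  rw [div_lt_iff₀ (sub_pos.2 hlt)] at hJ
  linarith [h J]

namespace Substitution

variable {m : ℕ} {ζ : Substitution m} {μ : Measure (ℤ → Fin m)}

namespace IsInvariantMeasure

lemma ae_mem_space (hμ : ζ.IsInvariantMeasure μ) : ∀ᵐ x ∂μ, x ∈ ζ.space :=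
  ae_iff.2 hμ.carried

lemma integral_apply {E : Type*} [NormedAddCommGroup E] [NormedSpace ℝ E]
    (hμ : ζ.IsInvariantMeasure μ) (F : Fin m → E) (j : ℕ) :
    ∫ x, F (x j) ∂μ = ∫ x, F (x 0) ∂μ := by
  induction j with
  | zero => simp
  | succ j ih =>
    have hmap := integral_map hμ.invariant.measurable.aemeasurable
      (stronglyMeasurable_comp_apply F (j : ℤ)).aestronglyMeasurable (μ := μ)
    rw [hμ.invariant.map_eq] at hmap
    rw [← ih, hmap]
    simp [shift]

lemma integral_wordSum_initialBlock (hμ : ζ.IsInvariantMeasure μ) (F : Fin m → ℝ) (J : ℕ) :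
    ∫ x, wordSum F (initialBlock x J) ∂μ = J * ∫ x, F (x 0) ∂μ := by
  have := hμ.isProbabilityMeasure
  simp only [wordSum_initialBlock]
  rw [integral_finsetSum (Finset.range J) fun j _ => integrable_comp_apply μ F (j : ℤ)]
  simp only [hμ.integral_apply F, Finset.sum_const, Finset.card_range, nsmul_eq_mul]

lemma integral_le_maxAverage [Nonempty (Fin m)] (hμ : ζ.IsInvariantMeasure μ) (F : Fin m → ℝ)
    (n : ℕ) : ∫ x, F (x 0) ∂μ ≤ ζ.maxAverage F n := by
  have := hμ.isProbabilityMeasure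
  refine le_of_forall_natCast_mul_le_mul_add (C := 4 * ‖F‖ * ζ.lengthBase ^ n) fun J => ?_
  have hint : Integrable (fun x => wordSum F (initialBlock x J)) μ := by
    simp only [wordSum_initialBlock]
    exact integrable_finsetSum _ fun j _ => integrable_comp_apply μ F j
  calc J * ∫ x, F (x 0) ∂μ
      = ∫ x, wordSum F (initialBlock x J) ∂μ := (hμ.integral_wordSum_initialBlock F J).symm
    _ ≤ ∫ _, (ζ.maxAverage F n * J + 4 * ‖F‖ * ζ.lengthBase ^ n) ∂μ := by
      refine integral_mono_ae hint (integrable_const _) ?_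
      filter_upwards [hμ.ae_mem_space] with x hx
      exact ζ.wordSum_initialBlock_le F hx n J
    _ = ζ.maxAverage F n * J + 4 * ‖F‖ * ζ.lengthBase ^ n := by simp

lemma abs_wordSum_iter_le_averageOsc [Nonempty (Fin m)] (hμ : ζ.IsInvariantMeasure μ)
    {F : Fin m → ℝ} (hF : ∫ x, F (x 0) ∂μ = 0) (n : ℕ) (b : Fin m) :
    |wordSum F (ζ.iter n b)| ≤ ζ.averageOsc F n * (ζ.iter n b).length := by
  have hmax := hμ.integral_le_maxAverage F n
  have hmax_neg := hμ.integral_le_maxAverage (-F) n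
  simp only [Pi.neg_apply, integral_neg, hF, neg_zero] at hmax hmax_neg
  have hle := ζ.wordSum_iter_le F n b
  have hle_neg := ζ.wordSum_iter_le (-F) n b
  rw [wordSum_neg] at hle_neg
  rw [averageOsc, abs_le]
  constructor <;> nlinarith

end IsInvariantMeasure

namespace IsPrimitive

variable [Nonempty (Fin m)]

lemma exists_averageOsc_mul_le (h : ζ.IsPrimitive) : ∃ (p : ℕ) (κ : ℝ), 0 ≤ κ ∧ κ < 1 ∧
    ∀ F k, ζ.averageOsc F (p * k) ≤ 2 * ‖F‖ * κ ^ k := by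
  obtain ⟨p, hp⟩ := h.exists_mem_iter
  obtain ⟨K, hK, hlen⟩ := h.exists_length_iter_add_le_mul p
  have hκ : 0 ≤ 1 - (K : ℝ)⁻¹ := by
    simpa using inv_le_one_of_one_le₀ (Nat.one_le_cast.2 hK : (1 : ℝ) ≤ K)
  refine ⟨p, 1 - (K : ℝ)⁻¹, hκ, by simpa using hK, fun F k => ?_⟩
  induction k with
  | zero => simpa using ζ.averageOsc_le F 0
  | succ k ih =>
    calc ζ.averageOsc F (p * k + p)
        ≤ (1 - (K : ℝ)⁻¹) * ζ.averageOsc F (p * k) := ζ.averageOsc_add_le F hp hK (hlen (p * k))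
      _ ≤ (1 - (K : ℝ)⁻¹) * (2 * ‖F‖ * (1 - (K : ℝ)⁻¹) ^ k) := by gcongr
      _ = 2 * ‖F‖ * (1 - (K : ℝ)⁻¹) ^ (k + 1) := by ring

lemma exists_twistedRate_zero_le (h : ζ.IsPrimitive) : ∃ (p : ℕ) (κ : ℝ), 0 ≤ κ ∧ κ < 1 ∧
    ∀ (s : Fin m → ℝ) (c : Fin m → ℂ) (μ : Measure (ℤ → Fin m)), ζ.IsInvariantMeasure μ →
      ∫ x, c (x 0) ∂μ = 0 → ∀ k, ζ.twistedRate s 0 c (p * k) ≤ 4 * ‖c‖ * κ ^ k := by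
  obtain ⟨p, κ, hκ0, hκ1, hosc⟩ := h.exists_averageOsc_mul_le
  refine ⟨p, κ, hκ0, hκ1, fun s c μ hμ hc k => ζ.twistedRate_le (by positivity) fun b => ?_⟩
  have := hμ.isProbabilityMeasure
  have hpart : ∀ φ : ℂ →L[ℝ] ℝ, (∀ z, |φ z| ≤ ‖z‖) →
      |φ (wordSum c (ζ.iter (p * k) b))| ≤ 2 * ‖c‖ * κ ^ k * (ζ.iter (p * k) b).length := by
    intro φ hφ
    have hmean : ∫ x, φ (c (x 0)) ∂μ = 0 := by
      rw [φ.integral_comp_comm (integrable_comp_apply μ c 0), hc, map_zero]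
    have hnorm : ‖fun a => φ (c a)‖ ≤ ‖c‖ :=
      (pi_norm_le_iff_of_nonneg (norm_nonneg c)).2 fun a => (hφ _).trans (norm_le_pi_norm c a)
    calc |φ (wordSum c (ζ.iter (p * k) b))|
        = |wordSum (fun a => φ (c a)) (ζ.iter (p * k) b)| := by
          simp only [wordSum, map_list_sum, List.map_map, Function.comp_def]
      _ ≤ ζ.averageOsc (fun a => φ (c a)) (p * k) * (ζ.iter (p * k) b).length :=
          hμ.abs_wordSum_iter_le_averageOsc hmean _ b
      _ ≤ 2 * ‖fun a => φ (c a)‖ * κ ^ k * (ζ.iter (p * k) b).length := by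
          gcongr
          exact hosc _ k
      _ ≤ 2 * ‖c‖ * κ ^ k * (ζ.iter (p * k) b).length := by gcongr
  have hre := hpart Complex.reCLM Complex.abs_re_le_norm
  have him := hpart Complex.imCLM Complex.abs_im_le_norm
  rw [twistedSum_zero_eq_wordSum]
  refine (Complex.norm_le_abs_re_add_abs_im _).trans ?_
  rw [Complex.reCLM_apply] at hre
  rw [Complex.imCLM_apply] at him
  linarith

end IsPrimitive

end Substitution

/-! ### Slabs in the simplex -/

section Slab

variable {ι : Type*} [Fintype ι]

lemma det_updateRow_one [DecidableEq ι] (i : ι) (c : ι → ℝ) :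
    ((1 : Matrix ι ι ℝ).updateRow i c).det = c i := by
  rw [← Matrix.cramer_transpose_apply, Matrix.transpose_one, Matrix.cramer_one,
    Module.End.one_apply]

-- The transvection that replaces the `i`-th coordinate by `∑ j, c j * u j` has determinant `c i`
-- and maps the slab into a box.
lemma volume_Icc_inter_slab_le (c₀ : ℝ) {c : ι → ℝ} {i : ι} (hi : c i ≠ 0) (ε : ℝ) :
    volume (Icc (0 : ι → ℝ) 1 ∩ {u | |c₀ + ∑ j, c j * u j| ≤ ε}) ≤
      ENNReal.ofReal (2 * ε / |c i|) := by
  classical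
  set A : Matrix ι ι ℝ := (1 : Matrix ι ι ℝ).updateRow i c
  have hdet : LinearMap.det (Matrix.toLin' A) = c i := by
    rw [LinearMap.det_toLin', det_updateRow_one]
  let a : ι → ℝ := Function.update 0 i (-c₀ - ε)
  let b : ι → ℝ := Function.update 1 i (-c₀ + ε)
  have hsub : Icc (0 : ι → ℝ) 1 ∩ {u | |c₀ + ∑ j, c j * u j| ≤ ε} ⊆
      (Matrix.toLin' A) ⁻¹' Icc a b := by
    rintro u ⟨⟨hu0, hu1⟩, hu⟩
    have hu := abs_le.1 (mem_ofPred_eq ▸ hu)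
    rw [mem_preimage, Matrix.toLin'_apply, Matrix.updateRow_mulVec, Matrix.one_mulVec, mem_Icc,
      update_le_update_iff, update_le_update_iff, dotProduct]
    exact ⟨⟨by linarith, fun j _ => hu0 j⟩, ⟨by linarith, fun j _ => hu1 j⟩⟩
  have hbox : ∏ j, ENNReal.ofReal (b j - a j) = ENNReal.ofReal (2 * ε) := by
    rw [Finset.prod_eq_single i (fun j _ hj => by simp [a, b, hj]) (by simp)]
    simp only [a, b, Function.update_self]
    congr 1
    ring
  calc volume (Icc (0 : ι → ℝ) 1 ∩ {u | |c₀ + ∑ j, c j * u j| ≤ ε})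
      ≤ volume ((Matrix.toLin' A) ⁻¹' Icc a b) := measure_mono hsub
    _ = ENNReal.ofReal |(c i)⁻¹| * ENNReal.ofReal (2 * ε) := by
      rw [Measure.addHaar_preimage_linearMap _ (hdet ▸ hi), hdet, Real.volume_Icc_pi, hbox]
    _ = ENNReal.ofReal (2 * ε / |c i|) := by
      rw [← ENNReal.ofReal_mul (abs_nonneg _), abs_inv, inv_mul_eq_div]

lemma half_norm_le_abs_sum_mul {g s : ι → ℝ} (hs : ∀ i, 0 ≤ s i) (hsum : ∑ i, s i = 1) {i₀ : ι}
    (hg : ∀ i, |g i - g i₀| ≤ ‖g‖ / 4) : ‖g‖ / 2 ≤ |∑ i, g i * s i| := by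
  have hnorm : ‖g‖ ≤ |g i₀| + ‖g‖ / 4 :=
    (pi_norm_le_iff_of_nonneg (by positivity)).2 fun i => by
      rw [Real.norm_eq_abs]
      linarith [hg i, abs_sub_abs_le_abs_sub (g i) (g i₀)]
  have hdiff : |∑ i, g i * s i - g i₀| ≤ ‖g‖ / 4 :=
    calc |∑ i, g i * s i - g i₀|
        = |∑ i, (g i - g i₀) * s i| := by
          simp only [sub_mul, Finset.sum_sub_distrib, ← Finset.mul_sum, hsum, mul_one]
      _ ≤ ∑ i, ‖g‖ / 4 * s i := by
          refine (Finset.abs_sum_le_sum_abs _ _).trans (Finset.sum_le_sum fun i _ => ?_)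
          rw [abs_mul, abs_of_nonneg (hs i)]
          exact mul_le_mul_of_nonneg_right (hg i) (hs i)
      _ = ‖g‖ / 4 := by rw [← Finset.mul_sum, hsum, mul_one]
  linarith [abs_sub_abs_le_abs_sub (g i₀) (∑ i, g i * s i),
    abs_sub_comm (g i₀) (∑ i, g i * s i)]

lemma exists_norm_le_two_mul_norm_real (g : ι → ℂ) :
    ∃ h : ι → ℝ, ‖g‖ ≤ 2 * ‖h‖ ∧ ∀ s : ι → ℝ, |∑ i, h i * s i| ≤ ‖∑ i, g i * (s i : ℂ)‖ := by
  have hparts : ‖g‖ ≤ ‖fun i => (g i).re‖ + ‖fun i => (g i).im‖ :=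
    (pi_norm_le_iff_of_nonneg (by positivity)).2 fun i =>
      (Complex.norm_le_abs_re_add_abs_im (g i)).trans
        (add_le_add (norm_le_pi_norm (fun i => (g i).re) i) (norm_le_pi_norm (fun i => (g i).im) i))
  rcases le_total ‖fun i => (g i).re‖ ‖fun i => (g i).im‖ with hle | hle
  · refine ⟨fun i => (g i).im, by linarith, fun s => ?_⟩
    simpa using Complex.abs_im_le_norm (∑ i, g i * (s i : ℂ))
  · refine ⟨fun i => (g i).re, by linarith, fun s => ?_⟩
    simpa using Complex.abs_re_le_norm (∑ i, g i * (s i : ℂ))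

end Slab

section Simplex

/-- The parametrization of the hyperplane `∑ i, s i = 1` of `ℝ^(k + 1)` by the last `k`
coordinates, which transports Lebesgue measure on `ℝ^k` to the simplex. -/
def hyperplaneParam (k : ℕ) (u : Fin k → ℝ) : Fin (k + 1) → ℝ := Fin.cons (1 - ∑ i, u i) u

lemma lipschitzWith_hyperplaneParam (k : ℕ) :
    LipschitzWith (k + 1 : ℝ≥0) (hyperplaneParam k) := by
  refine LipschitzWith.of_dist_le_mul fun u v => ?_
  have hkd : 0 ≤ k * dist u v := by positivity
  push_cast
  refine (dist_pi_le_iff (by positivity)).2 (Fin.cases ?_ fun j => ?_)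
  · simp only [hyperplaneParam, Fin.cons_zero, Real.dist_eq]
    calc |1 - ∑ i, u i - (1 - ∑ i, v i)|
        = |∑ i, (v i - u i)| := by rw [Finset.sum_sub_distrib, sub_sub_sub_cancel_left]
      _ ≤ ∑ _i : Fin k, dist u v :=
        (Finset.abs_sum_le_sum_abs _ _).trans <| Finset.sum_le_sum fun i _ => by
          rw [dist_comm]
          exact dist_le_pi_dist v u i
      _ ≤ (k + 1) * dist u v := by simp [add_mul]
  · simp only [hyperplaneParam, Fin.cons_succ]
    linarith [dist_le_pi_dist u v j]

lemma sum_mul_hyperplaneParam {k : ℕ} (g : Fin (k + 1) → ℝ) (u : Fin k → ℝ) :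
    ∑ i, g i * hyperplaneParam k u i = g 0 + ∑ j : Fin k, (g j.succ - g 0) * u j := by
  simp only [Fin.sum_univ_succ, hyperplaneParam, Fin.cons_zero, Fin.cons_succ, sub_mul,
    Finset.sum_sub_distrib, ← Finset.mul_sum]
  ring

lemma preimage_hyperplaneParam_positiveSimplex_subset (k : ℕ) :
    hyperplaneParam k ⁻¹' positiveSimplex (k + 1) ⊆ Icc 0 1 := by
  rintro u ⟨hpos, hsum⟩
  refine ⟨fun i => (hpos i.succ).le, fun i => ?_⟩
  exact (Finset.single_le_sum (f := hyperplaneParam k u) (fun i _ => (hpos i).le)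
    (Finset.mem_univ i.succ)).trans_eq hsum

lemma positiveSimplex_subset_range_hyperplaneParam (k : ℕ) :
    positiveSimplex (k + 1) ⊆ range (hyperplaneParam k) := by
  rintro s ⟨-, hsum⟩
  rw [Fin.sum_univ_succ] at hsum
  refine ⟨Fin.tail s, ?_⟩
  rw [hyperplaneParam, show 1 - ∑ i, Fin.tail s i = s 0 from (eq_sub_of_add_eq hsum).symm,
    Fin.cons_self_tail]

lemma measurableSet_positiveSimplex (m : ℕ) : MeasurableSet (positiveSimplex m) := by
  simp only [positiveSimplex, measurableSet_setOfPred]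
  measurability

lemma ae_mem_positiveSimplex (m : ℕ) : ∀ᵐ s ∂(simplexMeasure m), s ∈ positiveSimplex m :=
  ae_restrict_mem (measurableSet_positiveSimplex m)

lemma exists_simplexMeasure_le (k : ℕ) : ∃ C : ℝ≥0, ∀ A, simplexMeasure (k + 1) A ≤
    C * volume (hyperplaneParam k ⁻¹' (A ∩ positiveSimplex (k + 1))) := by
  refine ⟨(k + 1 : ℝ≥0) ^ (k : ℝ), fun A => ?_⟩
  have himage : hyperplaneParam k '' (hyperplaneParam k ⁻¹' (A ∩ positiveSimplex (k + 1))) =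
      A ∩ positiveSimplex (k + 1) :=
    image_preimage_eq_of_subset
      (inter_subset_right.trans (positiveSimplex_subset_range_hyperplaneParam k))
  have hdim : ((k + 1 : ℕ) : ℝ) - 1 = (Fintype.card (Fin k) : ℕ) := by simp
  rw [simplexMeasure, Measure.restrict_apply' (measurableSet_positiveSimplex _), hdim]
  nth_rw 1 [← himage]
  refine ((lipschitzWith_hyperplaneParam k).hausdorffMeasure_image_le (by positivity) _).trans ?_
  rw [hausdorffMeasure_pi_real, Fintype.card_fin, ENNReal.coe_rpow_of_nonneg _ (by positivity)]

lemma volume_preimage_hyperplaneParam_slab_le {k : ℕ} {g : Fin (k + 1) → ℝ} (hg : g ≠ 0) {ε : ℝ}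
    (hε : 0 ≤ ε) :
    volume (hyperplaneParam k ⁻¹' ({s | |∑ i, g i * s i| ≤ ε * ‖g‖} ∩ positiveSimplex (k + 1))) ≤
      ENNReal.ofReal (8 * ε) := by
  have hgpos : 0 < ‖g‖ := norm_pos_iff.2 hg
  by_cases! hex : ∃ j : Fin k, ‖g‖ / 4 < |g j.succ - g 0|
  · obtain ⟨j, hj⟩ := hex
    have hj0 : 0 < |g j.succ - g 0| := by linarith
    refine (measure_mono fun u hu => ?_).trans ((volume_Icc_inter_slab_le (g 0)
      (c := fun j => g j.succ - g 0) (abs_pos.1 hj0) (ε * ‖g‖)).trans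
        (ENNReal.ofReal_le_ofReal ?_))
    · refine ⟨preimage_hyperplaneParam_positiveSimplex_subset k hu.2, ?_⟩
      rw [mem_ofPred_eq, ← sum_mul_hyperplaneParam]
      exact hu.1
    · refine (div_le_iff₀ hj0).2 ?_
      linarith [mul_le_mul_of_nonneg_left hj.le hε]
  · have hhalf : ∀ s ∈ positiveSimplex (k + 1), ‖g‖ / 2 ≤ |∑ i, g i * s i| := fun s hs =>
      half_norm_le_abs_sum_mul (fun i => (hs.1 i).le) hs.2
        (Fin.cases (by simp only [sub_self, abs_zero]; positivity) hex)
    rcases le_or_gt (1 / 2) ε with hε2 | hε2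
    · calc volume _
          ≤ volume (Icc (0 : Fin k → ℝ) 1) := measure_mono fun u hu =>
            preimage_hyperplaneParam_positiveSimplex_subset k hu.2
        _ = ENNReal.ofReal 1 := by simp [Real.volume_Icc_pi]
        _ ≤ ENNReal.ofReal (8 * ε) := ENNReal.ofReal_le_ofReal (by linarith)
    · refine (measure_mono_null (fun u hu => ?_) measure_empty).trans_le zero_le
      have hle : |∑ i, g i * hyperplaneParam k u i| ≤ ε * ‖g‖ := hu.1
      nlinarith [hhalf _ hu.2]

lemma exists_simplexMeasure_slab_le (k : ℕ) : ∃ C : ℝ≥0, ∀ (g : Fin (k + 1) → ℝ) (ε : ℝ),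
    g ≠ 0 → 0 ≤ ε →
      simplexMeasure (k + 1) {s | |∑ i, g i * s i| ≤ ε * ‖g‖} ≤ C * ENNReal.ofReal ε := by
  obtain ⟨C, hC⟩ := exists_simplexMeasure_le k
  refine ⟨C * 8, fun g ε hg hε => (hC _).trans ?_⟩
  calc _ ≤ (C : ENNReal) * ENNReal.ofReal (8 * ε) := by
        gcongr
        exact volume_preimage_hyperplaneParam_slab_le hg hε
    _ = (C * 8 : ℝ≥0) * ENNReal.ofReal ε := by
        rw [ENNReal.ofReal_mul (by norm_num), ENNReal.coe_mul, mul_assoc]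
        simp

lemma exists_simplexMeasure_complex_slab_le {m : ℕ} (hm : 0 < m) : ∃ C : ℝ≥0,
    ∀ (g : Fin m → ℂ) (ε : ℝ), g ≠ 0 → 0 ≤ ε →
      simplexMeasure m {s | ‖∑ i, g i * (s i : ℂ)‖ ≤ ε * ‖g‖} ≤ C * ENNReal.ofReal ε := by
  obtain ⟨k, rfl⟩ := Nat.exists_eq_add_of_le' hm
  obtain ⟨C, hC⟩ := exists_simplexMeasure_slab_le k
  refine ⟨C * 2, fun g ε hg hε => ?_⟩
  obtain ⟨h, hgh, hsum⟩ := exists_norm_le_two_mul_norm_real g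
  have hh : h ≠ 0 := by
    rintro rfl
    exact hg (norm_le_zero_iff.1 (by simpa using hgh))
  calc simplexMeasure (k + 1) {s | ‖∑ i, g i * (s i : ℂ)‖ ≤ ε * ‖g‖}
      ≤ simplexMeasure (k + 1) {s | |∑ i, h i * s i| ≤ 2 * ε * ‖h‖} := by
        refine measure_mono fun s hs => (hsum s).trans (le_trans hs ?_)
        nlinarith
    _ ≤ C * ENNReal.ofReal (2 * ε) := hC h (2 * ε) hh (by positivity)
    _ = (C * 2 : ℝ≥0) * ENNReal.ofReal ε := by
        rw [ENNReal.ofReal_mul (by norm_num), ENNReal.coe_mul, mul_assoc]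
        simp

end Simplex

/-! ### Eigenvectors from a cyclic vector -/

section CyclicVector

open Polynomial

lemma map_pow_mulVec {R S : Type*} [Semiring R] [Semiring S] {m : ℕ} (f : R →+* S)
    (A : Matrix (Fin m) (Fin m) R) (j : ℕ) (v : Fin m → R) :
    (A.map f ^ j).mulVec (f ∘ v) = f ∘ (A ^ j).mulVec v := by
  have hpow : A.map f ^ j = (A ^ j).map f := (map_pow f.mapMatrix A j).symm
  ext i
  rw [hpow, Function.comp_apply, RingHom.map_mulVec]

variable {R k K : Type*} [CommRing R] [Field k] [Field K] [Algebra k K] {m : ℕ}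

lemma aeval_mulVec_eq_sum (A : Matrix (Fin m) (Fin m) R) {q : R[X]} {N : ℕ}
    (hq : q.natDegree < N) (v : Fin m → R) :
    (aeval A q).mulVec v = ∑ j ∈ Finset.range N, q.coeff j • (A ^ j).mulVec v := by
  rw [aeval_eq_sum_range' hq, Matrix.sum_mulVec]
  simp only [Matrix.smul_mulVec]

lemma pow_mulVec_eq_smul {A : Matrix (Fin m) (Fin m) R} {w : Fin m → R} {θ : R}
    (h : A.mulVec w = θ • w) (n : ℕ) : (A ^ n).mulVec w = θ ^ n • w := by
  induction n with
  | zero => simp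
  | succ n ih =>
    rw [pow_succ, ← Matrix.mulVec_mulVec, h, Matrix.mulVec_smul, ih, smul_smul, pow_succ']

lemma eq_zero_of_aeval_mulVec_eq_zero {A : Matrix (Fin m) (Fin m) k} (hA : Irreducible A.charpoly)
    {q : k[X]} (hq : q ≠ 0) (hdeg : q.natDegree < m) {v : Fin m → k}
    (h : (aeval A q).mulVec v = 0) : v = 0 := by
  have hcop : IsCoprime A.charpoly q := by
    refine hA.coprime_iff_not_dvd.2 fun hdvd => hdeg.not_ge ?_
    simpa using natDegree_le_of_dvd hdvd hq
  obtain ⟨a, b, hab⟩ := hcop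
  have hone : aeval A b * aeval A q = 1 := by
    simpa [Matrix.aeval_self_charpoly] using congrArg (aeval A) hab
  rw [← Matrix.one_mulVec v, ← hone, ← Matrix.mulVec_mulVec, h, Matrix.mulVec_zero]

lemma linearIndependent_pow_mulVec {A : Matrix (Fin m) (Fin m) k} (hA : Irreducible A.charpoly)
    {v : Fin m → k} (hv : v ≠ 0) :
    LinearIndependent k fun j : Fin m => (A ^ (j : ℕ)).mulVec v := by
  classical
  have hm : 1 ≤ m := Nat.pos_of_ne_zero fun h0 => hv (by subst h0; exact Subsingleton.elim _ _)
  refine Fintype.linearIndependent_iff.2 fun x hx j => ?_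
  have hcoeff : ∀ i : Fin m, (ofFn m x).coeff i = x i := fun i =>
    ofFn_coeff_eq_val_of_lt x i.2
  have hdeg : (ofFn m x).natDegree < m := ofFn_natDegree_lt hm x
  by_contra hj
  refine hv (eq_zero_of_aeval_mulVec_eq_zero hA (q := ofFn m x) (fun h0 => hj ?_) hdeg ?_)
  · rw [← hcoeff, h0, coeff_zero]
  · rw [aeval_mulVec_eq_sum A hdeg, Finset.sum_range]
    simpa only [hcoeff] using hx

variable (K) in
lemma linearIndependent_map_pow_mulVec {A : Matrix (Fin m) (Fin m) k} (hA : Irreducible A.charpoly)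
    {v : Fin m → k} (hv : v ≠ 0) :
    LinearIndependent K fun j : Fin m =>
      (A.map (algebraMap k K) ^ (j : ℕ)).mulVec (algebraMap k K ∘ v) := by
  simp only [map_pow_mulVec]
  exact linearIndependent_algebraMap_comp_iff.2 (linearIndependent_pow_mulVec hA hv)

lemma exists_eigenvector_of_isRoot {A : Matrix (Fin m) (Fin m) k} (hA : Irreducible A.charpoly)
    {v : Fin m → k} (hv : v ≠ 0) {θ : K} (hθ : (A.map (algebraMap k K)).charpoly.IsRoot θ) :
    ∃ (w : Fin m → K) (q : K[X]), w ≠ 0 ∧ (A.map (algebraMap k K)).mulVec w = θ • w ∧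
      ∀ n, θ ^ n • w = ∑ j ∈ Finset.range m,
        q.coeff j • (A.map (algebraMap k K) ^ (n + j)).mulVec (algebraMap k K ∘ v) := by
  have hind := linearIndependent_map_pow_mulVec K hA hv
  set B := A.map (algebraMap k K)
  set u := algebraMap k K ∘ v
  obtain ⟨q, hq⟩ := dvd_iff_isRoot.2 hθ
  have hq0 : q ≠ 0 := by
    rintro rfl
    exact B.charpoly_monic.ne_zero (by rw [hq, mul_zero])
  have hdeg : q.natDegree < m := by
    have hm := B.charpoly_natDegree_eq_dim
    rw [hq, natDegree_mul (X_sub_C_ne_zero θ) hq0, natDegree_X_sub_C, Fintype.card_fin] at hm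
    lia
  have hw := aeval_mulVec_eq_sum B hdeg u
  have heig : B.mulVec ((aeval B q).mulVec u) = θ • (aeval B q).mulVec u := by
    have hzero : (B - θ • 1) * aeval B q = 0 := by
      simpa [hq, Algebra.algebraMap_eq_smul_one] using B.aeval_self_charpoly
    rw [← sub_eq_zero, ← Matrix.zero_mulVec u, ← hzero, ← Matrix.mulVec_mulVec, Matrix.sub_mulVec,
      Matrix.smul_mulVec, Matrix.one_mulVec]
  refine ⟨(aeval B q).mulVec u, q, fun h0 => hq0 ?_, heig, fun n => ?_⟩
  · rw [hw, Finset.sum_range] at h0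
    ext j
    rcases lt_or_ge j m with hj | hj
    · exact Fintype.linearIndependent_iff.1 hind _ h0 ⟨j, hj⟩
    · rw [coeff_eq_zero_of_natDegree_lt (by lia), coeff_zero]
  · rw [← pow_mulVec_eq_smul heig, hw, Matrix.mulVec_sum]
    refine Finset.sum_congr rfl fun j _ => ?_
    rw [Matrix.mulVec_smul, Matrix.mulVec_mulVec, pow_add]

end CyclicVector

namespace Substitution

open Polynomial

variable {m : ℕ} {ζ : Substitution m}

/-- The substitution matrix with rational entries. -/
def rationalMatrix (ζ : Substitution m) : Matrix (Fin m) (Fin m) ℚ :=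
  ζ.matrix.map (fun k : ℕ => (k : ℚ))

/-- The substitution matrix with complex entries. -/
def complexMatrix (ζ : Substitution m) : Matrix (Fin m) (Fin m) ℂ :=
  ζ.matrix.map (fun k : ℕ => (k : ℂ))

lemma complexMatrix_eq_map (ζ : Substitution m) :
    ζ.complexMatrix = ζ.rationalMatrix.map (algebraMap ℚ ℂ) := by
  ext i j
  simp [complexMatrix, rationalMatrix]

lemma complexMatrix_pow_mulVec (ζ : Substitution m) (n : ℕ) (v : Fin m → ℕ) :
    (ζ.complexMatrix ^ n).mulVec (fun i => (v i : ℂ)) =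
      fun i => (((ζ.matrix ^ n).mulVec v i : ℕ) : ℂ) := by
  have hpow : ζ.complexMatrix ^ n = (ζ.matrix ^ n).map (Nat.castRingHom ℂ) :=
    (map_pow (Nat.castRingHom ℂ).mapMatrix ζ.matrix n).symm
  ext i
  rw [hpow]
  exact (RingHom.map_mulVec (Nat.castRingHom ℂ) _ v i).symm

lemma HasIrreducibleCharpoly.exists_eigenvector (h : ζ.HasIrreducibleCharpoly)
    {ℓ : Fin m → ℕ} (hℓ : ℓ ≠ 0) {θ : ℂ} (hθ : ζ.complexMatrix.charpoly.IsRoot θ) :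
    ∃ (w : Fin m → ℂ) (q : ℂ[X]), w ≠ 0 ∧ ζ.complexMatrix.mulVec w = θ • w ∧
      ∀ n i, θ ^ n * w i =
        ∑ j ∈ Finset.range m, q.coeff j * ((ζ.matrix ^ (n + j)).mulVec ℓ i : ℕ) := by
  have hℓ' : (fun i => (ℓ i : ℚ)) ≠ 0 := fun h0 =>
    hℓ (funext fun i => by simpa using congrFun h0 i)
  rw [complexMatrix_eq_map] at hθ
  obtain ⟨w, q, hw, heig, hpow⟩ := exists_eigenvector_of_isRoot h hℓ' hθ
  refine ⟨w, q, hw, complexMatrix_eq_map ζ ▸ heig, fun n i => ?_⟩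
  have hcast : algebraMap ℚ ℂ ∘ (fun i => (ℓ i : ℚ)) = fun i => (ℓ i : ℂ) := by
    ext i
    simp
  have hn := congrFun (hpow n) i
  change _ = (∑ j ∈ Finset.range m,
    q.coeff j • (ζ.rationalMatrix.map (algebraMap ℚ ℂ) ^ (n + j)).mulVec _) i at hn
  simpa only [hcast, ← complexMatrix_eq_map, complexMatrix_pow_mulVec, Finset.sum_apply,
    Pi.smul_apply, smul_eq_mul] using hn

lemma HasIrreducibleCharpoly.exists_two_roots (h : ζ.HasIrreducibleCharpoly)
    (h2 : 1 < ζ.secondEigenvalueModulus) :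
    ∃ (θ₁ θ₂ : ℂ) (ν : ℝ), θ₁ ≠ θ₂ ∧ 1 < ν ∧ ν ≤ ‖θ₁‖ ∧ ν ≤ ‖θ₂‖ ∧
      ζ.complexMatrix.charpoly.IsRoot θ₁ ∧ ζ.complexMatrix.charpoly.IsRoot θ₂ := by
  have hnodup : ζ.complexMatrix.charpoly.roots.Nodup := by
    rw [complexMatrix_eq_map, Matrix.charpoly_map]
    exact nodup_roots (Irreducible.separable h).map
  have hroot : ∀ {θ}, θ ∈ ζ.complexMatrix.charpoly.roots → ζ.complexMatrix.charpoly.IsRoot θ :=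
    fun hθ => isRoot_of_mem_roots hθ
  have hsorted : ζ.eigenvalueModuli.Pairwise (· ≥ ·) := Multiset.pairwise_sort _ _
  have hcoe : (ζ.eigenvalueModuli : Multiset ℝ) =
    ζ.complexMatrix.charpoly.roots.map fun z => ‖z‖ := Multiset.sort_eq _ _
  rw [secondEigenvalueModulus] at h2
  match hL : ζ.eigenvalueModuli with
  | [] | [_] =>
    rw [hL] at h2
    exact absurd h2 zero_le_one.not_gt
  | a :: b :: t =>
    rw [hL] at h2 hsorted hcoe
    rw [← Multiset.cons_coe, ← Multiset.cons_coe] at hcoe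
    have hab : b ≤ a := (List.pairwise_cons.1 hsorted).1 b List.mem_cons_self
    obtain ⟨θ₁, hθ₁, rfl, hrest⟩ := (Multiset.map_eq_cons _ _ _ _).2 hcoe.symm
    obtain ⟨θ₂, hθ₂, rfl, -⟩ := (Multiset.map_eq_cons _ _ _ _).2 hrest
    refine ⟨θ₁, θ₂, ‖θ₂‖, ?_, h2, hab, le_rfl, hroot hθ₁,
      hroot (Multiset.mem_of_mem_erase hθ₂)⟩
    rintro rfl
    exact hnodup.notMem_erase hθ₂

lemma HasIrreducibleCharpoly.two_le (h : ζ.HasIrreducibleCharpoly)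
    (h2 : 1 < ζ.secondEigenvalueModulus) : 2 ≤ m := by
  obtain ⟨θ₁, θ₂, -, hne, -, -, -, h1, h2⟩ := h.exists_two_roots h2
  have hsub : ({θ₁, θ₂} : Finset ℂ).val ⊆ ζ.complexMatrix.charpoly.roots := fun z hz => by
    rw [Finset.mem_val, Finset.mem_insert, Finset.mem_singleton] at hz
    rw [mem_roots ζ.complexMatrix.charpoly_monic.ne_zero]
    rcases hz with rfl | rfl <;> assumption
  calc 2 = ({θ₁, θ₂} : Finset ℂ).card := (Finset.card_pair hne).symm
    _ ≤ ζ.complexMatrix.charpoly.natDegree := Polynomial.card_le_degree_of_subset_roots hsub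
    _ = m := by rw [Matrix.charpoly_natDegree_eq_dim, Fintype.card_fin]

end Substitution

/-! ### Integer sequences that almost satisfy a recurrence -/

section Sparse

/-- The vectors in `[-E, E]^M ∩ ℤ^M` with at most `d` nonzero entries. -/
noncomputable def sparseVectors (E M : ℕ) (d : ℝ) : Finset (Fin M → ℤ) :=
  (Fintype.piFinset fun _ => Finset.Icc (-(E : ℤ)) E).filter fun e =>
    ((Finset.univ.filter fun n => e n ≠ 0).card : ℝ) ≤ d

lemma sum_Icc_ite_eq_zero (E : ℕ) (z : ℝ) :
    ∑ t ∈ Finset.Icc (-(E : ℤ)) E, (if t = 0 then 1 else z) = 1 + 2 * E * z := by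
  have h0 : (0 : ℤ) ∈ Finset.Icc (-(E : ℤ)) E := by simp
  have hcard : ((E : ℤ) + 1 - -(E : ℤ)).toNat - 1 = 2 * E := by lia
  rw [← Finset.add_sum_erase _ _ h0, if_pos rfl,
    Finset.sum_congr rfl (g := fun _ => z) fun t ht => if_neg (Finset.ne_of_mem_erase ht),
    Finset.sum_const, Finset.card_erase_of_mem h0, Int.card_Icc, hcard]
  simp

-- Markov's inequality for the weight `z ^ #{n | e n ≠ 0}`, whose sum over the box factorizes.
lemma card_sparseVectors_mul_rpow_le (E M : ℕ) {z : ℝ} (d : ℝ) (hz0 : 0 < z) (hz1 : z ≤ 1) :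
    ((sparseVectors E M d).card : ℝ) * z ^ d ≤ (1 + 2 * E * z) ^ M := by
  have hweight : ∀ e ∈ sparseVectors E M d, z ^ d ≤ ∏ n, if e n = 0 then 1 else z := by
    intro _ he
    rw [Finset.prod_ite, Finset.prod_const_one, one_mul, Finset.prod_const, ← Real.rpow_natCast]
    exact Real.rpow_le_rpow_of_exponent_ge hz0 hz1 (Finset.mem_filter.1 he).2
  calc _ = ∑ _e ∈ sparseVectors E M d, z ^ d := by rw [Finset.sum_const, nsmul_eq_mul]
    _ ≤ ∑ e ∈ sparseVectors E M d, ∏ n, (if e n = 0 then 1 else z) := Finset.sum_le_sum hweight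
    _ ≤ ∑ e ∈ Fintype.piFinset fun _ : Fin M => Finset.Icc (-(E : ℤ)) E,
          ∏ n, (if e n = 0 then 1 else z) :=
        Finset.sum_le_sum_of_subset_of_nonneg (Finset.filter_subset _ _) fun _ _ _ =>
          Finset.prod_nonneg fun _ _ => by split_ifs <;> positivity
    _ = ∏ _n : Fin M, ∑ t ∈ Finset.Icc (-(E : ℤ)) E, (if t = 0 then 1 else z) :=
        (Finset.prod_univ_sum (fun _ : Fin M => Finset.Icc (-(E : ℤ)) E)
          (fun _ t => if t = 0 then 1 else z)).symm
    _ = _ := by simp only [sum_Icc_ite_eq_zero, Finset.prod_const, Finset.card_univ,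
                  Fintype.card_fin]

lemma exists_card_sparseVectors_le (E : ℕ) {b : ℝ} (hb : 1 < b) :
    ∃ δ : ℝ, 0 < δ ∧ ∀ M : ℕ, ((sparseVectors E M (δ * M)).card : ℝ) ≤ b ^ M * b ^ M := by
  obtain ⟨z, hz0, hz1, hzb⟩ : ∃ z : ℝ, 0 < z ∧ z ≤ 1 ∧ 1 + 2 * E * z ≤ b := by
    refine ⟨min 1 ((b - 1) / (2 * E + 1)), lt_min one_pos (div_pos (by linarith) (by positivity)),
      min_le_left _ _, ?_⟩
    have hle := min_le_right 1 ((b - 1) / (2 * (E : ℝ) + 1))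
    have hpos : 0 ≤ min 1 ((b - 1) / (2 * (E : ℝ) + 1)) :=
      le_min zero_le_one (div_nonneg (by linarith) (by positivity))
    rw [le_div_iff₀ (by positivity)] at hle
    linarith
  have hlogz : Real.log z ≤ 0 := Real.log_nonpos hz0.le hz1
  have hlogb : 0 < Real.log b := Real.log_pos hb
  set δ := Real.log b / (1 - Real.log z) with hδ
  have hδ0 : 0 < δ := div_pos hlogb (by linarith)
  refine ⟨δ, hδ0, fun M => ?_⟩
  have hzd : (b ^ M)⁻¹ ≤ z ^ (δ * M) := by
    have hδz : -Real.log b ≤ Real.log z * δ := by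
      linarith [div_mul_cancel₀ (Real.log b) (by linarith : 1 - Real.log z ≠ 0)]
    rw [Real.rpow_def_of_pos hz0, ← Real.exp_log (show 0 < b by linarith), ← Real.exp_nat_mul,
      ← Real.exp_neg, Real.exp_le_exp, ← mul_assoc]
    linarith [mul_le_mul_of_nonneg_right hδz (Nat.cast_nonneg (α := ℝ) M)]
  rw [← div_le_iff₀ (by positivity), div_eq_mul_inv]
  calc _ ≤ ((sparseVectors E M (δ * M)).card : ℝ) * z ^ (δ * M) := by gcongr
    _ ≤ (1 + 2 * E * z) ^ M := card_sparseVectors_mul_rpow_le E M _ hz0 hz1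
    _ ≤ b ^ M := by gcongr

end Sparse

section Recurrence

/-- The initial values of an integer sequence, and its defects in the recurrence with
coefficients `p`. -/
def recurrenceCode (p : ℕ → ℤ) (m M : ℕ) (K : ℕ → ℤ) : (Fin m → ℤ) × (Fin M → ℤ) :=
  (fun i => K i, fun n => ∑ j ∈ Finset.range (m + 1), p j * K (n + j))

lemma eq_of_recurrenceCode_eq {p : ℕ → ℤ} {m M : ℕ} (hp : p m = 1) {K K' : ℕ → ℤ}
    (h : recurrenceCode p m M K = recurrenceCode p m M K') (n : ℕ) (hn : n < M + m) :
    K n = K' n := by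
  induction n using Nat.strong_induction_on with
  | _ n ih =>
    rcases lt_or_ge n m with hnm | hnm
    · exact congrFun (congrArg Prod.fst h) ⟨n, hnm⟩
    · obtain ⟨k, rfl⟩ := Nat.exists_eq_add_of_le' hnm
      have hdefect := congrFun (congrArg Prod.snd h) ⟨k, by lia⟩
      have hlower : ∑ j ∈ Finset.range m, p j * K (k + j) =
          ∑ j ∈ Finset.range m, p j * K' (k + j) := by
        refine Finset.sum_congr rfl fun j hj => ?_
        have hjm := Finset.mem_range.1 hj
        rw [ih (k + j) (by lia) (by lia)]
      simp only [recurrenceCode, Finset.sum_range_succ, hp, one_mul] at hdefect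
      linarith

/-- The times `n < N` at which `a n` has distance at least `ρ` from the integers. -/
noncomputable def farFromIntegers (a : ℕ → ℝ) (ρ : ℝ) (N : ℕ) : Finset ℕ :=
  (Finset.range N).filter fun n => ρ ≤ |a n - round (a n)|

variable {p : ℕ → ℤ} {m : ℕ} {a : ℕ → ℝ}

lemma abs_defect_le (ha : ∀ n, ∑ j ∈ Finset.range (m + 1), (p j : ℝ) * a (n + j) = 0) (n : ℕ)
    {η : ℝ} (hη : ∀ j ≤ m, |a (n + j) - round (a (n + j))| ≤ η) :
    |((∑ j ∈ Finset.range (m + 1), p j * round (a (n + j)) : ℤ) : ℝ)| ≤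
      (∑ j ∈ Finset.range (m + 1), |(p j : ℝ)|) * η := by
  have hdefect : ((∑ j ∈ Finset.range (m + 1), p j * round (a (n + j)) : ℤ) : ℝ) =
      -∑ j ∈ Finset.range (m + 1), (p j : ℝ) * (a (n + j) - round (a (n + j))) := by
    simp only [mul_sub, Finset.sum_sub_distrib, ha n]
    push_cast
    ring
  rw [hdefect, abs_neg, Finset.sum_mul]
  refine (Finset.abs_sum_le_sum_abs _ _).trans (Finset.sum_le_sum fun j hj => ?_)
  rw [abs_mul]
  exact mul_le_mul_of_nonneg_left (hη j (Nat.lt_succ_iff.1 (Finset.mem_range.1 hj)))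
    (abs_nonneg _)

variable {D : ℕ} (hD : 0 < D) (hpD : ∑ j ∈ Finset.range (m + 1), |(p j : ℝ)| ≤ D)
  (ha : ∀ n, ∑ j ∈ Finset.range (m + 1), (p j : ℝ) * a (n + j) = 0)

include hD hpD ha

lemma exists_mem_farFromIntegers {n M : ℕ} (hn : n < M)
    (hne : ∑ j ∈ Finset.range (m + 1), p j * round (a (n + j)) ≠ 0) :
    ∃ j ∈ Finset.range (m + 1), n + j ∈ farFromIntegers a (1 / (2 * D)) (M + m) := by
  by_contra! hnear
  have hη : ∀ j ≤ m, |a (n + j) - round (a (n + j))| ≤ 1 / (2 * D) := by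
    intro j hj
    have hnj := hnear j (Finset.mem_range.2 (by lia))
    rw [farFromIntegers, Finset.mem_filter, Finset.mem_range, not_and, not_le] at hnj
    exact (hnj (by lia)).le
  have hhalf : (∑ j ∈ Finset.range (m + 1), |(p j : ℝ)|) * (1 / (2 * D)) ≤ 1 / 2 := by
    calc _ ≤ (D : ℝ) * (1 / (2 * D)) := by gcongr
      _ = 1 / 2 := by field_simp
  have hlt : |((∑ j ∈ Finset.range (m + 1), p j * round (a (n + j)) : ℤ) : ℝ)| < 1 := by
    linarith [abs_defect_le ha n hη]
  exact hne (Int.abs_lt_one_iff.1 (by exact_mod_cast hlt))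

lemma card_defect_ne_zero_le (M : ℕ) :
    (Finset.univ.filter fun n : Fin M =>
      ∑ j ∈ Finset.range (m + 1), p j * round (a (n + j)) ≠ 0).card ≤
    (m + 1) * (farFromIntegers a (1 / (2 * D)) (M + m)).card := by
  set T := farFromIntegers a (1 / (2 * D)) (M + m)
  have hsub : (Finset.univ.filter fun n : Fin M =>
      ∑ j ∈ Finset.range (m + 1), p j * round (a (n + j)) ≠ 0) ⊆
      (Finset.range (m + 1)).biUnion fun j =>
        Finset.univ.filter fun n : Fin M => (n : ℕ) + j ∈ T := by
    intro n hn
    simpa only [Finset.mem_biUnion, Finset.mem_filter_univ] using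
      exists_mem_farFromIntegers hD hpD ha n.2 (Finset.mem_filter.1 hn).2
  refine (Finset.card_le_card hsub).trans ((Finset.card_biUnion_le_card_mul _ _ T.card
    fun j _ => ?_).trans (by rw [Finset.card_range]))
  refine Finset.card_le_card_of_injOn (fun n : Fin M => (n : ℕ) + j)
    (fun n hn => (Finset.mem_filter.1 hn).2) fun n _ n' _ h => Fin.ext (Nat.add_right_cancel h)

lemma recurrenceCode_round_mem {H M : ℕ} {δ : ℝ} (hH : ∀ n < m, |a n| + 1 ≤ H)
    (hfar : ((farFromIntegers a (1 / (2 * D)) (M + m)).card : ℝ) < δ / (m + 1) * M) :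
    recurrenceCode p m M (fun n => round (a n)) ∈
      (Fintype.piFinset fun _ => Finset.Icc (-(H : ℤ)) H) ×ˢ sparseVectors D M (δ * M) := by
  have hround : ∀ x : ℝ, |x - round x| ≤ 1 := fun x => (abs_sub_round x).trans (by norm_num)
  rw [Finset.mem_product, sparseVectors, Finset.mem_filter, Fintype.mem_piFinset,
    Fintype.mem_piFinset]
  simp only [Finset.mem_Icc, ← abs_le]
  refine ⟨fun i => ?_, fun n => ?_, ?_⟩
  · have habs : |(round (a i) : ℝ)| ≤ H := by
      have htri := abs_sub_abs_le_abs_sub (round (a i) : ℝ) (a i)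
      rw [abs_sub_comm] at htri
      linarith [hH i i.2, hround (a i)]
    exact_mod_cast habs
  · have hdefect := (abs_defect_le ha n (η := 1) fun j _ => hround _).trans
      ((mul_one _).trans_le hpD)
    exact_mod_cast hdefect
  · have hcard : ((Finset.univ.filter fun n : Fin M =>
        ∑ j ∈ Finset.range (m + 1), p j * round (a (n + j)) ≠ 0).card : ℝ) ≤
        (m + 1) * (farFromIntegers a (1 / (2 * D)) (M + m)).card := by
      exact_mod_cast card_defect_ne_zero_le hD hpD ha M
    calc _ ≤ ((m : ℝ) + 1) * (δ / (m + 1) * M) := hcard.trans (by gcongr)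
      _ = δ * M := by field_simp

end Recurrence

/-! ### The Erdős–Kahane argument -/

lemma exists_ne_zero_mul_add_mul_eq_zero {R : Type*} [CommRing R] [Nontrivial R] (α β : R) :
    ∃ x : Fin 2 → R, x ≠ 0 ∧ x 0 * α + x 1 * β = 0 := by
  by_cases h : α = 0 ∧ β = 0
  · exact ⟨![1, 0], fun h1 => one_ne_zero (congrFun h1 0), by simp [h]⟩
  · refine ⟨![β, -α], fun h0 => h ⟨?_, ?_⟩, ?_⟩
    · simpa using congrFun h0 1
    · simpa using congrFun h0 0
    · simp only [Matrix.cons_val_zero, Matrix.cons_val_one]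
      ring

-- A combination `x₀ w₁ + x₁ w₂` with `x₀ α + x₁ β = 0` eliminates the centre `(α, β)`.
lemma exists_slab_of_linearIndependent {m : ℕ} {w₁ w₂ : Fin m → ℂ}
    (hw : LinearIndependent ℂ ![w₁, w₂]) : ∃ C : ℝ≥0, ∀ α β : ℂ, ∃ g : Fin m → ℂ, g ≠ 0 ∧
      ∀ (s : Fin m → ℝ) (ω : ℝ), |ω| * ‖∑ i, g i * (s i : ℂ)‖ ≤
        C * (‖ω * ∑ i, w₁ i * (s i : ℂ) - α‖ + ‖ω * ∑ i, w₂ i * (s i : ℂ) - β‖) * ‖g‖ := by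
  let f : (Fin 2 → ℂ) →ₗ[ℂ] (Fin m → ℂ) := Fintype.linearCombination ℂ ![w₁, w₂]
  have hf : ∀ x, f x = x 0 • w₁ + x 1 • w₂ := fun x => by
    simp [f, Fintype.linearCombination_apply, Fin.sum_univ_two]
  have hker : LinearMap.ker f = ⊥ :=
    LinearMap.ker_eq_bot.2 (linearIndependent_iff_injective_fintypeLinearCombination.1 hw)
  obtain ⟨C, -, hanti⟩ := f.exists_antilipschitzWith hker
  refine ⟨C, fun α β => ?_⟩
  obtain ⟨x, hx0, hx⟩ := exists_ne_zero_mul_add_mul_eq_zero α β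
  refine ⟨f x, fun hfx => hx0 (LinearMap.ker_eq_bot'.1 hker x hfx), fun s ω => ?_⟩
  set e₁ := ω * ∑ i, w₁ i * (s i : ℂ) - α
  set e₂ := ω * ∑ i, w₂ i * (s i : ℂ) - β
  have hsum : ω * ∑ i, f x i * (s i : ℂ) = x 0 * e₁ + x 1 * e₂ := by
    simp only [hf, Pi.add_apply, Pi.smul_apply, smul_eq_mul, add_mul, Finset.sum_add_distrib,
      mul_assoc, ← Finset.mul_sum, e₁, e₂]
    linear_combination hx
  have hxf : ‖x‖ ≤ C * ‖f x‖ := by simpa using hanti.le_mul_dist x 0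
  calc |ω| * ‖∑ i, f x i * (s i : ℂ)‖ = ‖x 0 * e₁ + x 1 * e₂‖ := by
        rw [← hsum, norm_mul, Complex.norm_real, Real.norm_eq_abs]
    _ ≤ ‖x 0‖ * ‖e₁‖ + ‖x 1‖ * ‖e₂‖ := (norm_add_le _ _).trans (by simp only [norm_mul, le_rfl])
    _ ≤ ‖x‖ * ‖e₁‖ + ‖x‖ * ‖e₂‖ := by gcongr <;> exact norm_le_pi_norm x _
    _ ≤ C * ‖f x‖ * (‖e₁‖ + ‖e₂‖) := by rw [← mul_add]; gcongr
    _ = C * (‖e₁‖ + ‖e₂‖) * ‖f x‖ := by ring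

lemma exists_one_lt_pow_eq {x : ℝ} (hx : 1 < x) {n : ℕ} (hn : n ≠ 0) :
    ∃ y : ℝ, 1 < y ∧ y ^ n = x :=
  ⟨x ^ (n : ℝ)⁻¹, Real.one_lt_rpow hx (inv_pos.2 (Nat.cast_pos.2 (Nat.pos_of_ne_zero hn))),
    Real.rpow_inv_natCast_pow (by linarith) hn⟩

namespace Substitution

section IterLength

variable {m : ℕ} (ζ : Substitution m)

/-- The coefficients of the characteristic polynomial of the substitution matrix. -/
noncomputable def charCoeff (j : ℕ) : ℤ := (ζ.matrix.map (Nat.castRingHom ℤ)).charpoly.coeff j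

lemma charCoeff_self : ζ.charCoeff m = 1 := by
  have h := (ζ.matrix.map (Nat.castRingHom ℤ)).charpoly_monic.coeff_natDegree
  rwa [Matrix.charpoly_natDegree_eq_dim, Fintype.card_fin] at h

lemma one_le_sum_abs_charCoeff : 1 ≤ ∑ j ∈ Finset.range (m + 1), |(ζ.charCoeff j : ℝ)| := by
  have hone := Finset.single_le_sum (f := fun j => |(ζ.charCoeff j : ℝ)|)
    (fun _ _ => abs_nonneg _) (Finset.self_mem_range_succ m)
  simpa only [charCoeff_self, Int.cast_one, abs_one] using hone

lemma sum_charCoeff_mul (ℓ : Fin m → ℕ) (n : ℕ) (i : Fin m) :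
    ∑ j ∈ Finset.range (m + 1), ζ.charCoeff j *
      (((ζ.matrix ^ (n + j)).mulVec ℓ i : ℕ) : ℤ) = 0 := by
  have hcayley := aeval_mulVec_eq_sum (ζ.matrix.map (Nat.castRingHom ℤ))
    (q := (ζ.matrix.map (Nat.castRingHom ℤ)).charpoly) (N := m + 1)
    (by rw [Matrix.charpoly_natDegree_eq_dim, Fintype.card_fin]; exact m.lt_succ_self)
    (Nat.castRingHom ℤ ∘ ℓ)
  rw [Matrix.aeval_self_charpoly, Matrix.zero_mulVec] at hcayley
  have hi := congrArg (fun u => (ζ.matrix.map (Nat.castRingHom ℤ) ^ n).mulVec u i) hcayley.symm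
  simp only [Matrix.mulVec_sum, Matrix.mulVec_smul, Matrix.mulVec_mulVec, ← pow_add,
    Matrix.mulVec_zero, Finset.sum_apply, Pi.smul_apply, smul_eq_mul, Pi.zero_apply,
    map_pow_mulVec, Function.comp_apply] at hi
  exact hi

/-- The length `∑ᵢ (Sⁿ ℓ)ᵢ sᵢ` of `ζⁿ(w)`, for a word `w` with letter counts `ℓ` and letters of
lengths `s`. -/
noncomputable def iterLength (ℓ : Fin m → ℕ) (s : Fin m → ℝ) (n : ℕ) : ℝ :=
  ∑ i, (((ζ.matrix ^ n).mulVec ℓ i : ℕ) : ℝ) * s i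

lemma sum_charCoeff_mul_iterLength (ℓ : Fin m → ℕ) (s : Fin m → ℝ) (ω : ℝ) (n : ℕ) :
    ∑ j ∈ Finset.range (m + 1), (ζ.charCoeff j : ℝ) * (ω * ζ.iterLength ℓ s (n + j)) = 0 := by
  have hcoord : ∀ i, ∑ j ∈ Finset.range (m + 1),
      (ζ.charCoeff j : ℝ) * (((ζ.matrix ^ (n + j)).mulVec ℓ i : ℕ) : ℝ) = 0 := by
    intro i
    exact_mod_cast ζ.sum_charCoeff_mul ℓ n i
  calc _ = ∑ i, (∑ j ∈ Finset.range (m + 1),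
        (ζ.charCoeff j : ℝ) * (((ζ.matrix ^ (n + j)).mulVec ℓ i : ℕ) : ℝ)) * (ω * s i) := by
        simp only [iterLength, Finset.mul_sum, Finset.sum_mul]
        rw [Finset.sum_comm]
        refine Finset.sum_congr rfl fun i _ => Finset.sum_congr rfl fun j _ => ?_
        ring
    _ = 0 := by simp only [hcoord, zero_mul, Finset.sum_const_zero]

lemma exists_abs_iterLength_le (ℓ : Fin m → ℕ) : ∃ A : ℝ≥0, ∀ s ∈ positiveSimplex m, ∀ n < m,
    |ζ.iterLength ℓ s n| ≤ A := by
  refine ⟨∑ j ∈ Finset.range m, ∑ i, (((ζ.matrix ^ j).mulVec ℓ i : ℕ) : ℝ≥0),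
    fun s hs n hn => ?_⟩
  have hs1 : ∀ j, s j ≤ 1 := fun j => by
    rw [← hs.2]
    exact Finset.single_le_sum (f := s) (fun i _ => (hs.1 i).le) (Finset.mem_univ j)
  rw [iterLength, abs_of_nonneg
    (Finset.sum_nonneg fun j _ => mul_nonneg (Nat.cast_nonneg _) (hs.1 j).le)]
  push_cast
  calc _ ≤ ∑ j, (((ζ.matrix ^ n).mulVec ℓ j : ℕ) : ℝ) :=
        Finset.sum_le_sum fun j _ => mul_le_of_le_one_right (Nat.cast_nonneg _) (hs1 j)
    _ ≤ _ := Finset.single_le_sum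
        (f := fun n => ∑ j, (((ζ.matrix ^ n).mulVec ℓ j : ℕ) : ℝ))
        (fun _ _ => Finset.sum_nonneg fun _ _ => Nat.cast_nonneg _) (Finset.mem_range.2 hn)

end IterLength

section ErdosKahane

variable {m : ℕ} {ζ : Substitution m} {ℓ : Fin m → ℕ}

lemma HasIrreducibleCharpoly.exists_eigenvector_approx (h : ζ.HasIrreducibleCharpoly)
    (hℓ : ℓ ≠ 0) {θ : ℂ} (hθ : ζ.complexMatrix.charpoly.IsRoot θ) (hθ0 : θ ≠ 0) :
    ∃ (w : Fin m → ℂ) (Q : ℝ≥0), w ≠ 0 ∧ ζ.complexMatrix.mulVec w = θ • w ∧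
      ∀ (M : ℕ) (K : ℕ → ℤ), ∃ α : ℂ, ∀ (s : Fin m → ℝ) (ω : ℝ),
        (∀ n < M + m, round (ω * ζ.iterLength ℓ s n) = K n) →
        ‖ω * ∑ i, w i * (s i : ℂ) - α‖ ≤ Q * (‖θ‖ ^ M)⁻¹ := by
  obtain ⟨w, q, hw0, hw, hpow⟩ := h.exists_eigenvector hℓ hθ
  refine ⟨w, ∑ j ∈ Finset.range m, ‖q.coeff j‖₊, hw0, hw, fun M K =>
    ⟨(θ ^ M)⁻¹ * ∑ j ∈ Finset.range m, q.coeff j * (K (M + j) : ℂ), fun s ω hK => ?_⟩⟩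
  have hθM : θ ^ M ≠ 0 := pow_ne_zero _ hθ0
  have hcoord : θ ^ M * (ω * ∑ i, w i * (s i : ℂ)) =
      ∑ j ∈ Finset.range m, q.coeff j * ((ω * ζ.iterLength ℓ s (M + j) : ℝ) : ℂ) := by
    calc _ = ∑ i, (θ ^ M * w i) * (ω * s i) := by
          simp only [Finset.mul_sum]
          exact Finset.sum_congr rfl fun i _ => by ring
      _ = _ := by
          simp only [hpow, iterLength, Finset.sum_mul, Finset.mul_sum, Complex.ofReal_sum]
          rw [Finset.sum_comm]
          refine Finset.sum_congr rfl fun j _ => Finset.sum_congr rfl fun i _ => ?_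
          push_cast
          ring
  have herror : θ ^ M * (ω * ∑ i, w i * (s i : ℂ) -
      (θ ^ M)⁻¹ * ∑ j ∈ Finset.range m, q.coeff j * (K (M + j) : ℂ)) =
      ∑ j ∈ Finset.range m, q.coeff j * ((ω * ζ.iterLength ℓ s (M + j) - K (M + j) : ℝ) : ℂ) := by
    rw [mul_sub, mul_inv_cancel_left₀ hθM, hcoord, ← Finset.sum_sub_distrib]
    refine Finset.sum_congr rfl fun j _ => ?_
    push_cast
    ring
  rw [← div_eq_mul_inv, le_div_iff₀' (pow_pos (norm_pos_iff.2 hθ0) M), ← norm_pow, ← norm_mul,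
    herror, NNReal.coe_sum]
  refine (norm_sum_le _ _).trans (Finset.sum_le_sum fun j hj => ?_)
  rw [norm_mul, Complex.norm_real, Real.norm_eq_abs,
    ← hK (M + j) (Nat.add_lt_add_left (Finset.mem_range.1 hj) M)]
  exact mul_le_of_le_one_right (norm_nonneg _) ((abs_sub_round _).trans (by norm_num))

lemma linearIndependent_of_eigenvectors {w₁ w₂ : Fin m → ℂ} {θ₁ θ₂ : ℂ}
    {A : Matrix (Fin m) (Fin m) ℂ} (hne : θ₁ ≠ θ₂) (hw₁ : w₁ ≠ 0) (hw₂ : w₂ ≠ 0)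
    (h₁ : A.mulVec w₁ = θ₁ • w₁) (h₂ : A.mulVec w₂ = θ₂ • w₂) :
    LinearIndependent ℂ ![w₁, w₂] := by
  refine Module.End.eigenvectors_linearIndependent' (Matrix.toLin' A) ![θ₁, θ₂] ?_ _ ?_
  · intro i j hij
    fin_cases i <;> fin_cases j <;> simp_all
  · rw [Fin.forall_fin_two]
    exact ⟨⟨Module.End.mem_eigenspace_iff.2 (by simpa using h₁), hw₁⟩,
      ⟨Module.End.mem_eigenspace_iff.2 (by simpa using h₂), hw₂⟩⟩

-- The integers next to `ω ∑ᵢ (Sⁿ ℓ)ᵢ sᵢ` determine the coordinates of `ω s` along two expanding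
-- eigenvectors up to an error `ν⁻ᴹ`, and eliminating `ω` leaves a slab.
lemma HasIrreducibleCharpoly.exists_simplexMeasure_round_eq_le (h : ζ.HasIrreducibleCharpoly)
    (h2 : 1 < ζ.secondEigenvalueModulus) (hℓ : ℓ ≠ 0) :
    ∃ (ν : ℝ) (C : ℝ≥0), 1 < ν ∧ ∀ (M : ℕ) (K : ℕ → ℤ) (r : ℝ), 0 < r →
      simplexMeasure m {s | ∃ ω : ℝ, r ≤ |ω| ∧
        ∀ n < M + m, round (ω * ζ.iterLength ℓ s n) = K n} ≤
      C * ENNReal.ofReal ((ν ^ M)⁻¹ / r) := by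
  obtain ⟨θ₁, θ₂, ν, hne, hν, hν₁, hν₂, hr₁, hr₂⟩ := h.exists_two_roots h2
  have hν0 : 0 < ν := by linarith
  obtain ⟨w₁, Q₁, hw₁0, hw₁, happ₁⟩ :=
    h.exists_eigenvector_approx hℓ hr₁ (norm_pos_iff.1 (hν0.trans_le hν₁))
  obtain ⟨w₂, Q₂, hw₂0, hw₂, happ₂⟩ :=
    h.exists_eigenvector_approx hℓ hr₂ (norm_pos_iff.1 (hν0.trans_le hν₂))
  obtain ⟨C₁, hslab⟩ := exists_slab_of_linearIndependent
    (linearIndependent_of_eigenvectors hne hw₁0 hw₂0 hw₁ hw₂)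
  obtain ⟨C₂, hvol⟩ := exists_simplexMeasure_complex_slab_le (zero_lt_two.trans_le (h.two_le h2))
  refine ⟨ν, C₂ * (C₁ * (Q₁ + Q₂)), hν, fun M K r hr => ?_⟩
  obtain ⟨α, hα⟩ := happ₁ M K
  obtain ⟨β, hβ⟩ := happ₂ M K
  obtain ⟨g, hg, hgs⟩ := hslab α β
  calc _ ≤ simplexMeasure m {s | ‖∑ i, g i * (s i : ℂ)‖ ≤
          (C₁ * (Q₁ + Q₂)) * ((ν ^ M)⁻¹ / r) * ‖g‖} := by
        refine measure_mono ?_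
        rintro s ⟨ω, hω, hK⟩
        rw [mem_ofPred_eq, mul_div_assoc', div_mul_eq_mul_div, le_div_iff₀' hr]
        calc r * ‖∑ i, g i * (s i : ℂ)‖ ≤ |ω| * ‖∑ i, g i * (s i : ℂ)‖ := by gcongr
          _ ≤ _ := hgs s ω
          _ ≤ C₁ * (Q₁ * (ν ^ M)⁻¹ + Q₂ * (ν ^ M)⁻¹) * ‖g‖ := by
            gcongr
            · exact (hα s ω hK).trans (by gcongr)
            · exact (hβ s ω hK).trans (by gcongr)
          _ = _ := by ring
    _ ≤ C₂ * ENNReal.ofReal (C₁ * (Q₁ + Q₂) * ((ν ^ M)⁻¹ / r)) := hvol g _ hg (by positivity)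
    _ = _ := by
        rw [ENNReal.ofReal_mul (by positivity), ← NNReal.coe_add, ← NNReal.coe_mul,
          ENNReal.ofReal_coe_nnreal, ← mul_assoc, ← ENNReal.coe_mul]

/-- The points `s` of the simplex for which, at some frequency `ω` with `r⁻¹ ≤ |ω| ≤ r`, fewer
than `δ M` of the numbers `ω ∑ᵢ (Sⁿ ℓ)ᵢ sᵢ` with `n < M + m` are `ρ`-far from the integers. -/
def exceptionalSet (ζ : Substitution m) (ℓ : Fin m → ℕ) (ρ δ r : ℝ) (M : ℕ) :
    Set (Fin m → ℝ) :=
  {s | s ∈ positiveSimplex m ∧ ∃ ω : ℝ, r⁻¹ ≤ |ω| ∧ |ω| ≤ r ∧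
    ((farFromIntegers (fun n => ω * ζ.iterLength ℓ s n) ρ (M + m)).card : ℝ) < δ * M}

lemma simplexMeasure_exceptionalSet_le {D : ℕ} (hD : 0 < D)
    (hpD : ∑ j ∈ Finset.range (m + 1), |(ζ.charCoeff j : ℝ)| ≤ D) {A : ℝ}
    (hA : ∀ s ∈ positiveSimplex m, ∀ n < m, |ζ.iterLength ℓ s n| ≤ A) {M H : ℕ} {r : ℝ}
    (hr : 0 < r) (hH : r * A + 1 ≤ H) (δ : ℝ) {ε : ENNReal}
    (hε : ∀ K : ℕ → ℤ, simplexMeasure m {s | ∃ ω : ℝ, r⁻¹ ≤ |ω| ∧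
      ∀ n < M + m, round (ω * ζ.iterLength ℓ s n) = K n} ≤ ε) :
    simplexMeasure m (ζ.exceptionalSet ℓ (1 / (2 * D)) (δ / (m + 1)) r M) ≤
      ((2 * H + 1) ^ m * (sparseVectors D M (δ * M)).card : ℕ) * ε := by
  set codes := (Fintype.piFinset fun _ : Fin m => Finset.Icc (-(H : ℤ)) H) ×ˢ
    sparseVectors D M (δ * M)
  set E : (Fin m → ℤ) × (Fin M → ℤ) → Set (Fin m → ℝ) := fun x => {s | ∃ ω : ℝ, r⁻¹ ≤ |ω| ∧
    recurrenceCode ζ.charCoeff m M (fun n => round (ω * ζ.iterLength ℓ s n)) = x}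
  have hE : ∀ x, simplexMeasure m (E x) ≤ ε := by
    intro x
    rcases (E x).eq_empty_or_nonempty with hempty | ⟨s₀, ω₀, -, hx⟩
    · simp [hempty]
    · refine (measure_mono ?_).trans (hε fun n => round (ω₀ * ζ.iterLength ℓ s₀ n))
      rintro s ⟨ω, hω, hs⟩
      exact ⟨ω, hω, eq_of_recurrenceCode_eq ζ.charCoeff_self (hs.trans hx.symm)⟩
  have hcover : ζ.exceptionalSet ℓ (1 / (2 * D)) (δ / (m + 1)) r M ⊆ ⋃ x ∈ codes, E x := by
    rintro s ⟨hs, ω, hω, hωr, hfar⟩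
    refine mem_iUnion₂.2 ⟨_, recurrenceCode_round_mem hD hpD
      (ζ.sum_charCoeff_mul_iterLength ℓ s ω) (fun n hn => ?_) hfar, ω, hω, rfl⟩
    rw [abs_mul]
    linarith [mul_le_mul hωr (hA s hs n hn) (abs_nonneg _) hr.le]
  have hcard : codes.card = (2 * H + 1) ^ m * (sparseVectors D M (δ * M)).card := by
    rw [Finset.card_product, Fintype.card_piFinset_const, Int.card_Icc,
      show ((H : ℤ) + 1 - -(H : ℤ)).toNat = 2 * H + 1 by lia]
  calc _ ≤ ∑ x ∈ codes, simplexMeasure m (E x) :=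
        (measure_mono hcover).trans (measure_biUnion_finset_le _ _)
    _ ≤ codes.card • ε := Finset.sum_le_card_nsmul _ _ _ fun x _ => hE x
    _ = _ := by rw [hcard, nsmul_eq_mul]

-- The weights are balanced so that, with `b ^ 4 = ν` and `κ ^ (m + 1) = b`, the classes of measure
-- `κ ^ M * ν⁻¹ ^ M` outweigh the number `(κ ^ M) ^ m * b ^ (2 * M)` of codes.
lemma HasIrreducibleCharpoly.exists_simplexMeasure_exceptionalSet_le
    (h : ζ.HasIrreducibleCharpoly) (h2 : 1 < ζ.secondEigenvalueModulus) (hℓ : ℓ ≠ 0) :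
    ∃ ρ δ κ b : ℝ, ∃ C : ℝ≥0, 0 < ρ ∧ 0 < δ ∧ 1 < κ ∧ 1 < b ∧ ∀ M : ℕ,
      simplexMeasure m (ζ.exceptionalSet ℓ ρ δ (κ ^ M) M) ≤ C * ENNReal.ofReal (b⁻¹ ^ M) := by
  obtain ⟨ν, C, hν, hround⟩ := h.exists_simplexMeasure_round_eq_le h2 hℓ
  obtain ⟨A, hA⟩ := ζ.exists_abs_iterLength_le ℓ
  obtain ⟨D, hpD⟩ := exists_nat_ge (∑ j ∈ Finset.range (m + 1), |(ζ.charCoeff j : ℝ)|)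
  have hD : 0 < D := by exact_mod_cast one_pos.trans_le (ζ.one_le_sum_abs_charCoeff.trans hpD)
  obtain ⟨b, hb, hbν⟩ := exists_one_lt_pow_eq hν (n := 4) (by norm_num)
  obtain ⟨κ, hκ, hκb⟩ := exists_one_lt_pow_eq hb m.succ_ne_zero
  obtain ⟨δ, hδ, hcount⟩ := exists_card_sparseVectors_le D hb
  refine ⟨1 / (2 * D), δ / (m + 1), κ, b, C * (2 * A + 5) ^ m, by positivity, by positivity, hκ, hb,
    fun M => ?_⟩
  have hκM : 1 ≤ κ ^ M := one_le_pow₀ hκ.le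
  set H := ⌈κ ^ M * A⌉₊ + 1
  have hH : κ ^ M * A + 1 ≤ H := by
    push_cast [H]
    linarith [Nat.le_ceil (κ ^ M * (A : ℝ))]
  have hH' : 2 * (H : ℝ) + 1 ≤ (2 * A + 5) * κ ^ M := by
    push_cast [H]
    linarith [Nat.ceil_lt_add_one (show 0 ≤ κ ^ M * (A : ℝ) by positivity)]
  have hcodes : (((2 * H + 1) ^ m * (sparseVectors D M (δ * M)).card : ℕ) : ℝ) *
      ((ν ^ M)⁻¹ / (κ ^ M)⁻¹) ≤ (2 * A + 5) ^ m * b⁻¹ ^ M := by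
    push_cast
    calc _ ≤ ((2 * A + 5) * κ ^ M) ^ m * (b ^ M * b ^ M) * ((ν ^ M)⁻¹ / (κ ^ M)⁻¹) := by
          gcongr
          exact hcount M
      _ = (2 * A + 5) ^ m * ((κ ^ (m + 1)) ^ M * (b ^ M * b ^ M) * (ν ^ M)⁻¹) := by
          rw [div_inv_eq_mul, mul_pow]
          ring
      _ = _ := by
          rw [hκb, ← hbν, inv_pow, ← pow_mul, mul_comm 4 M, pow_mul]
          field_simp
  calc _ ≤ _ := simplexMeasure_exceptionalSet_le hD hpD hA (one_pos.trans_le hκM) hH δ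
          fun K => hround M K _ (by positivity)
    _ = C * ENNReal.ofReal (((2 * H + 1) ^ m * (sparseVectors D M (δ * M)).card : ℕ) *
          ((ν ^ M)⁻¹ / (κ ^ M)⁻¹)) := by
        rw [ENNReal.ofReal_mul (Nat.cast_nonneg _), ENNReal.ofReal_natCast, mul_left_comm]
    _ ≤ C * ENNReal.ofReal (((2 * A + 5) ^ m : ℝ≥0) * b⁻¹ ^ M) := by
        gcongr C * ENNReal.ofReal ?_
        exact_mod_cast hcodes
    _ = _ := by
        rw [ENNReal.ofReal_mul (NNReal.coe_nonneg _), ENNReal.ofReal_coe_nnreal, ENNReal.coe_mul,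
          mul_assoc]

theorem HasIrreducibleCharpoly.erdos_kahane (h : ζ.HasIrreducibleCharpoly)
    (h2 : 1 < ζ.secondEigenvalueModulus) (hℓ : ℓ ≠ 0) :
    ∃ ρ δ κ : ℝ, 0 < ρ ∧ 0 < δ ∧ 1 < κ ∧ ∀ᵐ s ∂simplexMeasure m, ∀ᶠ M : ℕ in Filter.atTop,
      ∀ ω : ℝ, (κ ^ M)⁻¹ ≤ |ω| → |ω| ≤ κ ^ M →
        δ * M ≤ (farFromIntegers (fun n => ω * ζ.iterLength ℓ s n) ρ (M + m)).card := by
  obtain ⟨ρ, δ, κ, b, C, hρ, hδ, hκ, hb, hle⟩ := h.exists_simplexMeasure_exceptionalSet_le h2 hℓ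
  refine ⟨ρ, δ, κ, hρ, hδ, hκ, ?_⟩
  have hsum : ∑' M, simplexMeasure m (ζ.exceptionalSet ℓ ρ δ (κ ^ M) M) ≠ ⊤ := by
    refine ne_top_of_le_ne_top ?_ (ENNReal.tsum_le_tsum hle)
    rw [ENNReal.tsum_mul_left]
    exact ENNReal.mul_ne_top ENNReal.coe_ne_top (summable_geometric_of_lt_one (by positivity)
      (inv_lt_one_of_one_lt₀ hb)).tsum_ofReal_ne_top
  filter_upwards [ae_mem_positiveSimplex m, ae_eventually_notMem hsum] with s hs hnot
  filter_upwards [hnot] with M hM ω hω hωκ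
  exact not_lt.1 fun hlt => hM ⟨hs, ω, hω, hωκ, hlt⟩

end ErdosKahane

end Substitution

/-! ### The suspension flow along an orbit -/

section Tower

variable {m : ℕ} {s : Fin m → ℝ}

lemma roofSum_zero (s : Fin m → ℝ) (x : ℤ → Fin m) : roofSum s x 0 = 0 := by simp [roofSum]

lemma roofSum_add_one (s : Fin m → ℝ) (x : ℤ → Fin m) (n : ℤ) :
    roofSum s x (n + 1) = roofSum s x n + s (x n) := by
  rcases le_or_gt 0 n with hn | hn
  · rw [roofSum, roofSum, Finset.Ico_eq_empty (a := n + 1) (by lia),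
      Finset.Ico_eq_empty (a := n) (by lia), ← Order.succ_eq_add_one,
      ← Finset.insert_Ico_right_eq_Ico_succ hn, Finset.sum_insert Finset.right_notMem_Ico]
    ring
  · rw [roofSum, roofSum, Finset.Ico_eq_empty (b := n + 1) (by lia),
      Finset.Ico_eq_empty (b := n) (by lia), ← Order.succ_eq_add_one,
      ← Finset.insert_Ico_succ_left_eq_Ico hn, Finset.sum_insert (by simp)]
    ring

lemma roofSum_natCast (s : Fin m → ℝ) (x : ℤ → Fin m) (J : ℕ) :
    roofSum s x J = wordSum s (initialBlock x J) := by
  rw [wordSum_initialBlock]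
  induction J with
  | zero => simp [roofSum_zero]
  | succ J ih => rw [Finset.sum_range_succ, ← ih, Nat.cast_succ, roofSum_add_one]

lemma sub_mul_le_roofSum_sub {d : ℝ} (hd : ∀ i, d ≤ s i) (x : ℤ → Fin m) {k n : ℤ} (hkn : k ≤ n) :
    (n - k) * d ≤ roofSum s x n - roofSum s x k := by
  induction n, hkn using Int.leInduction with
  | base => simp
  | succ n _ ih =>
    rw [roofSum_add_one]
    push_cast
    linarith [hd (x n)]

lemma strictMono_roofSum (hs : ∀ i, 0 < s i) (x : ℤ → Fin m) : StrictMono (roofSum s x) :=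
  strictMono_int_of_lt_succ fun n => by
    rw [roofSum_add_one]
    linarith [hs (x n)]

lemma exists_roofSum_le_lt (hs : ∀ i, 0 < s i) (x : ℤ → Fin m) (v : ℝ) :
    ∃ n, roofSum s x n ≤ v ∧ v < roofSum s x (n + 1) := by
  have : Nonempty (Fin m) := ⟨x 0⟩
  obtain ⟨a, ha⟩ := Finite.exists_min s
  obtain ⟨k, hk⟩ := exists_nat_gt (|v| / s a)
  rw [div_lt_iff₀ (hs a)] at hk
  have hv := abs_le.1 (le_refl |v|)
  have habove := sub_mul_le_roofSum_sub ha x (Int.natCast_nonneg k)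
  have hbelow := sub_mul_le_roofSum_sub ha x (neg_nonpos.2 (Int.natCast_nonneg k))
  rw [roofSum_zero] at habove hbelow
  push_cast at habove hbelow
  obtain ⟨n, hn, hmax⟩ := Int.exists_greatest_of_bdd (P := fun n => roofSum s x n ≤ v)
    ⟨k, fun n hn => le_of_lt <| (strictMono_roofSum hs x).lt_iff_lt.1 <| by linarith⟩
    ⟨-(k : ℤ), by linarith⟩
  exact ⟨n, hn, lt_of_not_ge fun hle => (hmax _ hle).not_gt (Int.lt_succ n)⟩

lemma roofIndex_eq (hs : ∀ i, 0 < s i) {x : ℤ → Fin m} {v : ℝ} {n : ℤ}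
    (hn : roofSum s x n ≤ v) (hn' : v < roofSum s x (n + 1)) : roofIndex s x v = n :=
  IsGreatest.csSup_eq ⟨hn, fun _ hk =>
    Int.lt_add_one_iff.1 ((strictMono_roofSum hs x).lt_iff_lt.1 (lt_of_le_of_lt hk hn'))⟩

lemma roofSum_roofIndex_le (hs : ∀ i, 0 < s i) (x : ℤ → Fin m) (v : ℝ) :
    roofSum s x (roofIndex s x v) ≤ v := by
  obtain ⟨n, hn, hn'⟩ := exists_roofSum_le_lt hs x v
  rwa [roofIndex_eq hs hn hn']

lemma lt_roofSum_roofIndex_add_one (hs : ∀ i, 0 < s i) (x : ℤ → Fin m) (v : ℝ) :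
    v < roofSum s x (roofIndex s x v + 1) := by
  obtain ⟨n, hn, hn'⟩ := exists_roofSum_le_lt hs x v
  rwa [roofIndex_eq hs hn hn']

lemma le_roofIndex_iff (hs : ∀ i, 0 < s i) (x : ℤ → Fin m) (v : ℝ) (n : ℤ) :
    n ≤ roofIndex s x v ↔ roofSum s x n ≤ v := by
  have hmono := strictMono_roofSum hs x
  exact ⟨fun h => (hmono.monotone h).trans (roofSum_roofIndex_le hs x v), fun h =>
    Int.lt_add_one_iff.1 (hmono.lt_iff_lt.1 (h.trans_lt (lt_roofSum_roofIndex_add_one hs x v)))⟩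

lemma measurable_roofSum (s : Fin m → ℝ) (n : ℤ) :
    Measurable fun x : ℤ → Fin m => roofSum s x n := by
  unfold roofSum
  exact (Finset.measurable_fun_sum _ fun j _ => (stronglyMeasurable_comp_apply s j).measurable).sub
    (Finset.measurable_fun_sum _ fun j _ => (stronglyMeasurable_comp_apply s j).measurable)

lemma measurable_roofIndex (hs : ∀ i, 0 < s i) :
    Measurable fun p : (ℤ → Fin m) × ℝ => roofIndex s p.1 p.2 := by
  refine measurable_of_Ici fun n => ?_
  have hpre : (fun p : (ℤ → Fin m) × ℝ => roofIndex s p.1 p.2) ⁻¹' Ici n =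
      {p | roofSum s p.1 n ≤ p.2} := by
    ext p
    exact le_roofIndex_iff hs p.1 p.2 n
  rw [hpre]
  exact measurableSet_le ((measurable_roofSum s n).comp measurable_fst) measurable_snd

/-- The value of the cylindrical function of `ψ` at the time `v` of the orbit that starts at
`(x, 0)`. -/
noncomputable def towerFun (s : Fin m → ℝ) (ψ : Fin m → ℝ → ℂ) (x : ℤ → Fin m) (v : ℝ) : ℂ :=
  ψ (x (roofIndex s x v)) (v - roofSum s x (roofIndex s x v))

lemma cylindrical_suspensionFlow (s : Fin m → ℝ) (ψ : Fin m → ℝ → ℂ) (t : ℝ)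
    (p : (ℤ → Fin m) × ℝ) :
    cylindrical ψ (suspensionFlow s t p) = towerFun s ψ p.1 (p.2 + t) := by
  simp [cylindrical, suspensionFlow, towerFun, Substitution.shift]

lemma towerFun_eq (hs : ∀ i, 0 < s i) (ψ : Fin m → ℝ → ℂ) {x : ℤ → Fin m} {v : ℝ} {n : ℤ}
    (hn : roofSum s x n ≤ v) (hn' : v < roofSum s x (n + 1)) :
    towerFun s ψ x v = ψ (x n) (v - roofSum s x n) := by
  rw [towerFun, roofIndex_eq hs hn hn']

lemma sub_roofSum_roofIndex_mem (hs : ∀ i, 0 < s i) (x : ℤ → Fin m) (v : ℝ) :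
    v - roofSum s x (roofIndex s x v) ∈ Icc 0 (s (x (roofIndex s x v))) := by
  have hle := roofSum_roofIndex_le hs x v
  have hlt := lt_roofSum_roofIndex_add_one hs x v
  rw [roofSum_add_one] at hlt
  exact ⟨by linarith, by linarith⟩

variable {ψ : Fin m → ℝ → ℂ} {B : ℝ}

lemma norm_towerFun_le (hs : ∀ i, 0 < s i) (hB : ∀ a, ∀ t ∈ Icc 0 (s a), ‖ψ a t‖ ≤ B)
    (x : ℤ → Fin m) (v : ℝ) : ‖towerFun s ψ x v‖ ≤ B :=
  hB _ _ (sub_roofSum_roofIndex_mem hs x v)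

lemma measurable_towerFun (hs : ∀ i, 0 < s i) (hψ : ∀ a, ContinuousOn (ψ a) (Icc 0 (s a))) :
    Measurable fun p : (ℤ → Fin m) × ℝ => towerFun s ψ p.1 p.2 := by
  classical
  let ψ' : Fin m → ℝ → ℂ := fun a => (Icc 0 (s a)).piecewise (ψ a) 0
  have hψ' : Measurable fun q : Fin m × ℝ => ψ' q.1 q.2 :=
    measurable_from_prod_countable_right fun a =>
      (hψ a).measurable_piecewise continuousOn_const measurableSet_Icc
  have heq : ∀ p : (ℤ → Fin m) × ℝ, towerFun s ψ p.1 p.2 = towerFun s ψ' p.1 p.2 := fun p =>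
    (piecewise_eq_of_mem _ _ _ (sub_roofSum_roofIndex_mem hs p.1 p.2)).symm
  have hindexed : Measurable fun q : ℤ × ((ℤ → Fin m) × ℝ) =>
      ψ' (q.2.1 q.1) (q.2.2 - roofSum s q.2.1 q.1) :=
    measurable_from_prod_countable_right fun n =>
      hψ'.comp (((measurable_pi_apply n).comp measurable_fst).prodMk
        (measurable_snd.sub ((measurable_roofSum s n).comp measurable_fst)))
  simp only [heq]
  exact hindexed.comp ((measurable_roofIndex hs).prodMk measurable_id)

lemma norm_phase_mul_towerFun_le (hs : ∀ i, 0 < s i) (hB : ∀ a, ∀ t ∈ Icc 0 (s a), ‖ψ a t‖ ≤ B)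
    (ω : ℝ) (x : ℤ → Fin m) (v : ℝ) : ‖phase (ω * v) * towerFun s ψ x v‖ ≤ B := by
  rw [norm_mul, norm_phase, one_mul]
  exact norm_towerFun_le hs hB x v

lemma intervalIntegrable_phase_mul_towerFun (hs : ∀ i, 0 < s i)
    (hψ : ∀ a, ContinuousOn (ψ a) (Icc 0 (s a))) (hB : ∀ a, ∀ t ∈ Icc 0 (s a), ‖ψ a t‖ ≤ B)
    (ω : ℝ) (x : ℤ → Fin m) (u v : ℝ) :
    IntervalIntegrable (fun v => phase (ω * v) * towerFun s ψ x v) volume u v := by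
  have hmeas : Measurable fun v => phase (ω * v) * towerFun s ψ x v :=
    (continuous_phase.measurable.comp (measurable_const_mul ω)).mul
      ((measurable_towerFun hs hψ).comp measurable_prodMk_left)
  exact intervalIntegrable_iff.2 <| Measure.integrableOn_of_bounded (M := B) (by simp)
    hmeas.aestronglyMeasurable (.of_forall (norm_phase_mul_towerFun_le hs hB ω x))

/-- The Fourier coefficients `∫₀^{s_a} e^{-2πiωt} ψ_a(t) dt` of a cylindrical function. -/
noncomputable def letterCoeff (s : Fin m → ℝ) (ψ : Fin m → ℝ → ℂ) (ω : ℝ) (a : Fin m) : ℂ :=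
  ∫ t in (0 : ℝ)..s a, phase (ω * t) * ψ a t

lemma norm_letterCoeff_le (hs : ∀ i, 0 < s i) (hs1 : ∀ i, s i ≤ 1)
    (hB : ∀ a, ∀ t ∈ Icc 0 (s a), ‖ψ a t‖ ≤ B) (ω : ℝ) (a : Fin m) :
    ‖letterCoeff s ψ ω a‖ ≤ B := by
  have hB0 : 0 ≤ B := (norm_nonneg _).trans (hB a 0 (left_mem_Icc.2 (hs a).le))
  calc ‖letterCoeff s ψ ω a‖ ≤ B * |s a - 0| := by
        refine intervalIntegral.norm_integral_le_of_norm_le_const fun t ht => ?_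
        rw [uIoc_of_le (hs a).le] at ht
        rw [norm_mul, norm_phase, one_mul]
        exact hB a t (Ioc_subset_Icc_self ht)
    _ ≤ B := by
        rw [sub_zero, abs_of_pos (hs a)]
        exact mul_le_of_le_one_right hB0 (hs1 a)

lemma integral_towerFun_letter (hs : ∀ i, 0 < s i) (ψ : Fin m → ℝ → ℂ) (ω : ℝ) (x : ℤ → Fin m)
    (n : ℤ) :
    ∫ v in roofSum s x n..roofSum s x (n + 1), phase (ω * v) * towerFun s ψ x v =
      phase (ω * roofSum s x n) * letterCoeff s ψ ω (x n) := by
  have hshift := intervalIntegral.integral_comp_add_left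
    (fun v => phase (ω * v) * towerFun s ψ x v) (roofSum s x n) (a := 0) (b := s (x n))
  rw [add_zero, ← roofSum_add_one] at hshift
  rw [← hshift, letterCoeff, ← intervalIntegral.integral_const_mul]
  refine intervalIntegral.integral_congr_ae ?_
  filter_upwards [Measure.ae_ne volume (s (x n))] with t ht ht'
  rw [uIoc_of_le (hs _).le] at ht'
  have hlt : t < s (x n) := lt_of_le_of_ne ht'.2 ht
  rw [towerFun_eq hs ψ (n := n) (by linarith [ht'.1]) (by rw [roofSum_add_one]; linarith),
    mul_add, phase_add, add_sub_cancel_left, mul_assoc]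

lemma integral_towerFun_roofSum (hs : ∀ i, 0 < s i) (hψ : ∀ a, ContinuousOn (ψ a) (Icc 0 (s a)))
    (hB : ∀ a, ∀ t ∈ Icc 0 (s a), ‖ψ a t‖ ≤ B) (ω : ℝ) (x : ℤ → Fin m) (J : ℕ) :
    ∫ v in (0 : ℝ)..roofSum s x J, phase (ω * v) * towerFun s ψ x v =
      twistedSum s ω (letterCoeff s ψ ω) (initialBlock x J) := by
  have hint := intervalIntegrable_phase_mul_towerFun hs hψ hB ω x
  induction J with
  | zero => simp [roofSum_zero, initialBlock, twistedSum]
  | succ J ih =>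
    rw [← intervalIntegral.integral_add_adjacent_intervals (hint 0 (roofSum s x J)) (hint _ _), ih,
      initialBlock_succ, twistedSum_append, ← roofSum_natCast, Nat.cast_succ,
      integral_towerFun_letter hs]
    simp [twistedSum]

lemma norm_integral_towerFun_zero_le (hs : ∀ i, 0 < s i) (hs1 : ∀ i, s i ≤ 1)
    (hψ : ∀ a, ContinuousOn (ψ a) (Icc 0 (s a))) (hB : ∀ a, ∀ t ∈ Icc 0 (s a), ‖ψ a t‖ ≤ B)
    {d : ℝ} (hd : 0 < d) (hds : ∀ i, d ≤ s i) {ζ : Substitution m} {x : ℤ → Fin m}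
    (hx : x ∈ ζ.space) (ω : ℝ) {v : ℝ} (hv : 0 ≤ v) (n : ℕ) :
    ‖∫ t in (0 : ℝ)..v, phase (ω * t) * towerFun s ψ x t‖ ≤
      2 * B * ζ.lengthBase ^ n + B + ζ.twistedRate s ω (letterCoeff s ψ ω) n * (v / d) := by
  have hB0 : 0 ≤ B := (norm_nonneg _).trans (norm_towerFun_le hs hB x 0)
  have hint := intervalIntegrable_phase_mul_towerFun hs hψ hB ω x
  obtain ⟨J, hJ⟩ := Int.eq_ofNat_of_zero_le ((le_roofIndex_iff hs x v 0).2 (by rwa [roofSum_zero]))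
  have hJv := roofSum_roofIndex_le hs x v
  have hvJ := lt_roofSum_roofIndex_add_one hs x v
  rw [hJ] at hJv hvJ
  rw [roofSum_add_one] at hvJ
  have hJd : (J : ℝ) ≤ v / d := by
    have hle := sub_mul_le_roofSum_sub hds x (Int.natCast_nonneg J)
    rw [roofSum_zero] at hle
    push_cast at hle
    rw [le_div_iff₀ hd]
    linarith
  have hc : ‖letterCoeff s ψ ω‖ ≤ B :=
    (pi_norm_le_iff_of_nonneg hB0).2 (norm_letterCoeff_le hs hs1 hB ω)
  have hblocks := ζ.norm_twistedSum_initialBlock_le s ω (letterCoeff s ψ ω) hx n J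
  rw [← integral_towerFun_roofSum hs hψ hB] at hblocks
  have hend : ‖∫ t in roofSum s x J..v, phase (ω * t) * towerFun s ψ x t‖ ≤ B :=
    (intervalIntegral.norm_integral_le_of_norm_le_const fun t _ =>
      norm_phase_mul_towerFun_le hs hB ω x t).trans <| mul_le_of_le_one_right hB0 <| by
        rw [abs_of_nonneg (by linarith)]
        linarith [hs1 (x J)]
  calc _ ≤ 2 * ‖letterCoeff s ψ ω‖ * ζ.lengthBase ^ n +
          ζ.twistedRate s ω (letterCoeff s ψ ω) n * J + B := by
        rw [← intervalIntegral.integral_add_adjacent_intervals (hint 0 (roofSum s x J)) (hint _ _)]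
        exact norm_add_le_of_le hblocks hend
    _ ≤ 2 * B * ζ.lengthBase ^ n + ζ.twistedRate s ω (letterCoeff s ψ ω) n * (v / d) + B := by
        gcongr
        exact ζ.twistedRate_nonneg s ω _ n
    _ = _ := by ring

lemma integral_towerFun_comp_add (hs : ∀ i, 0 < s i)
    (hψ : ∀ a, ContinuousOn (ψ a) (Icc 0 (s a))) (hB : ∀ a, ∀ t ∈ Icc 0 (s a), ‖ψ a t‖ ≤ B)
    (ω : ℝ) (x : ℤ → Fin m) (τ u : ℝ) :
    ∫ t in (0 : ℝ)..u, phase (ω * t) * towerFun s ψ x (τ + t) =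
      phase (ω * -τ) * ((∫ v in (0 : ℝ)..(τ + u), phase (ω * v) * towerFun s ψ x v) -
        ∫ v in (0 : ℝ)..τ, phase (ω * v) * towerFun s ψ x v) := by
  have hint := intervalIntegrable_phase_mul_towerFun hs hψ hB ω x
  have hshift := intervalIntegral.integral_comp_add_left
    (fun v => phase (ω * v) * towerFun s ψ x v) τ (a := 0) (b := u)
  rw [add_zero] at hshift
  rw [intervalIntegral.integral_interval_sub_left (hint _ _) (hint _ _), ← hshift,
    ← intervalIntegral.integral_const_mul]
  refine intervalIntegral.integral_congr fun t _ => ?_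
  simp only [← mul_assoc, ← phase_add]
  congr 2
  ring

lemma norm_integral_towerFun_le (hs : ∀ i, 0 < s i) (hs1 : ∀ i, s i ≤ 1)
    (hψ : ∀ a, ContinuousOn (ψ a) (Icc 0 (s a))) (hB : ∀ a, ∀ t ∈ Icc 0 (s a), ‖ψ a t‖ ≤ B)
    {d : ℝ} (hd : 0 < d) (hds : ∀ i, d ≤ s i) {ζ : Substitution m} {x : ℤ → Fin m}
    (hx : x ∈ ζ.space) (ω : ℝ) {τ u : ℝ} (hτ0 : 0 ≤ τ) (hτ1 : τ ≤ 1) (hu : 0 ≤ u) (n : ℕ) :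
    ‖∫ t in (0 : ℝ)..u, phase (ω * t) * towerFun s ψ x (τ + t)‖ ≤
      4 * B * ζ.lengthBase ^ n + ζ.twistedRate s ω (letterCoeff s ψ ω) n * ((u + 1) / d) := by
  have hB0 : 0 ≤ B := (norm_nonneg _).trans (norm_towerFun_le hs hB x 0)
  have hbase : (1 : ℝ) ≤ ζ.lengthBase ^ n :=
    one_le_pow₀ (by exact_mod_cast one_le_two.trans ζ.two_le_lengthBase)
  have hmain := norm_integral_towerFun_zero_le hs hs1 hψ hB hd hds hx ω (add_nonneg hτ0 hu) n
  have hstart : ‖∫ v in (0 : ℝ)..τ, phase (ω * v) * towerFun s ψ x v‖ ≤ B :=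
    (intervalIntegral.norm_integral_le_of_norm_le_const fun t _ =>
      norm_phase_mul_towerFun_le hs hB ω x t).trans <| mul_le_of_le_one_right hB0 <| by
        rwa [sub_zero, abs_of_nonneg hτ0]
  rw [integral_towerFun_comp_add hs hψ hB, norm_mul, norm_phase, one_mul]
  calc _ ≤ _ := norm_sub_le_of_le hmain hstart
    _ = 2 * B * ζ.lengthBase ^ n + 2 * B * 1 +
          ζ.twistedRate s ω (letterCoeff s ψ ω) n * ((u + τ) / d) := by ring
    _ ≤ 2 * B * ζ.lengthBase ^ n + 2 * B * ζ.lengthBase ^ n +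
          ζ.twistedRate s ω (letterCoeff s ψ ω) n * ((u + 1) / d) := by
        gcongr
        exact ζ.twistedRate_nonneg s ω _ n
    _ = _ := by ring

end Tower
/-! ### Spectral measures and twisted integrals -/

section Kernels

/-- The continuous analogue `∫₀ᵘ cos(bt) dt` of the Dirichlet kernel. -/
noncomputable def dirichletKernel (u b : ℝ) : ℝ := ∫ t in 0..u, Real.cos (b * t)

/-- The continuous analogue `∫₀ᴿ ∫₀ᵘ cos(bt) dt du` of the Fejér kernel; it is not normalized, so
its value at `b = 0` is `R² / 2`. -/
noncomputable def fejerKernel (R b : ℝ) : ℝ := ∫ u in 0..R, dirichletKernel u b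

lemma dirichletKernel_zero (u : ℝ) : dirichletKernel u 0 = u := by simp [dirichletKernel]

lemma dirichletKernel_eq {b : ℝ} (hb : b ≠ 0) (u : ℝ) :
    dirichletKernel u b = Real.sin (b * u) / b := by
  rw [dirichletKernel, intervalIntegral.integral_comp_mul_left _ hb, integral_cos, mul_zero,
    Real.sin_zero, sub_zero, smul_eq_mul, inv_mul_eq_div]

lemma fejerKernel_zero (R : ℝ) : fejerKernel R 0 = R ^ 2 / 2 := by
  simp [fejerKernel, dirichletKernel_zero]

lemma fejerKernel_eq {b : ℝ} (hb : b ≠ 0) (R : ℝ) :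
    fejerKernel R b = (1 - Real.cos (b * R)) / b ^ 2 := by
  simp only [fejerKernel, dirichletKernel_eq hb, intervalIntegral.integral_div]
  rw [intervalIntegral.integral_comp_mul_left _ hb, integral_sin, mul_zero, Real.cos_zero,
    smul_eq_mul, inv_mul_eq_div, div_div, sq]

lemma continuous_dirichletKernel : Continuous fun p : ℝ × ℝ => dirichletKernel p.1 p.2 :=
  intervalIntegral.continuous_parametric_intervalIntegral_of_continuous
    (f := fun (p : ℝ × ℝ) t => Real.cos (p.2 * t)) (by fun_prop) continuous_fst

lemma continuous_fejerKernel (R : ℝ) : Continuous (fejerKernel R) :=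
  intervalIntegral.continuous_parametric_intervalIntegral_of_continuous'
    (f := fun b u => dirichletKernel u b) (continuous_dirichletKernel.comp continuous_swap) _ _

lemma abs_dirichletKernel_le {u : ℝ} (hu : 0 ≤ u) (b : ℝ) : |dirichletKernel u b| ≤ u := by
  have := intervalIntegral.norm_integral_le_of_norm_le_const (a := 0) (b := u)
    (f := fun t => Real.cos (b * t)) (C := 1) fun t _ => Real.abs_cos_le_one _
  rwa [sub_zero, abs_of_nonneg hu, one_mul] at this

lemma abs_fejerKernel_le {R : ℝ} (hR : 0 ≤ R) (b : ℝ) : |fejerKernel R b| ≤ R * R := by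
  have := intervalIntegral.norm_integral_le_of_norm_le_const (a := 0) (b := R)
    (f := fun u => dirichletKernel u b) (C := R) fun u hu => by
      rw [uIoc_of_le hR] at hu
      exact (abs_dirichletKernel_le hu.1.le b).trans hu.2
  rwa [sub_zero, abs_of_nonneg hR] at this

lemma fejerKernel_nonneg (R b : ℝ) : 0 ≤ fejerKernel R b := by
  rcases eq_or_ne b 0 with rfl | hb
  · rw [fejerKernel_zero]
    positivity
  · rw [fejerKernel_eq hb]
    exact div_nonneg (sub_nonneg.2 (Real.cos_le_one _)) (sq_nonneg b)

lemma le_fejerKernel {R b : ℝ} (hb : |b * R| ≤ Real.pi) :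
    2 / Real.pi ^ 2 * R ^ 2 ≤ fejerKernel R b := by
  rcases eq_or_ne b 0 with rfl | h0
  · have hpi : 2 / Real.pi ^ 2 ≤ 1 / 2 := by
      rw [div_le_div_iff₀ (by positivity) two_pos]
      nlinarith [Real.two_le_pi]
    calc 2 / Real.pi ^ 2 * R ^ 2 ≤ 1 / 2 * R ^ 2 := by gcongr
      _ = fejerKernel R 0 := by rw [fejerKernel_zero, one_div_mul_eq_div]
  · rw [fejerKernel_eq h0, le_div_iff₀ (by positivity)]
    have := Real.cos_le_one_sub_mul_cos_sq hb
    nlinarith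

lemma half_le_sub_dirichletKernel {h x : ℝ} (hh : 0 < h) (hx : 1 / h ≤ |x|) :
    h / 2 ≤ h - dirichletKernel h (2 * Real.pi * x) := by
  have hx0 : 0 < |x| := (one_div_pos.2 hh).trans_le hx
  have hpi := Real.two_le_pi
  rw [div_le_iff₀ hh] at hx
  have hb : 2 * Real.pi * x ≠ 0 := mul_ne_zero (by positivity) (abs_pos.1 hx0)
  suffices dirichletKernel h (2 * Real.pi * x) ≤ h / 2 by linarith
  calc dirichletKernel h (2 * Real.pi * x)
      ≤ |Real.sin (2 * Real.pi * x * h)| / |2 * Real.pi * x| := by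
        rw [dirichletKernel_eq hb, ← abs_div]
        exact le_abs_self _
    _ ≤ 1 / |2 * Real.pi * x| := by
        gcongr
        exact Real.abs_sin_le_one _
    _ ≤ h / 2 := by
        rw [abs_mul, abs_of_pos (by positivity : 0 < 2 * Real.pi),
          div_le_div_iff₀ (by positivity) two_pos]
        nlinarith

end Kernels

lemma intervalIntegral_integral_swap_of_norm_le {Ω E : Type*} [MeasurableSpace Ω]
    [NormedAddCommGroup E] [NormedSpace ℝ E] {ν : Measure Ω} [IsFiniteMeasure ν] {a b C : ℝ}
    {g : ℝ → Ω → E} (hg : StronglyMeasurable (Function.uncurry g))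
    (hC : ∀ t ∈ uIoc a b, ∀ y, ‖g t y‖ ≤ C) :
    ∫ t in a..b, ∫ y, g t y ∂ν = ∫ y, (∫ t in a..b, g t y) ∂ν := by
  have : IsFiniteMeasure (volume.restrict (uIoc a b)) := ⟨by simp [uIoc]⟩
  refine intervalIntegral_integral_swap (Integrable.of_bound hg.aestronglyMeasurable C ?_)
  rw [Measure.restrict_prod_eq_prod_univ]
  exact ae_restrict_of_forall_mem (measurableSet_uIoc.prod .univ) fun p hp => hC p.1 hp.1 p.2

section FourierTransform

variable (σ : Measure ℝ) [IsFiniteMeasure σ]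

lemma re_phase_mul_charFun (ω t : ℝ) :
    (phase (ω * t) * charFun σ (2 * Real.pi * t)).re =
      ∫ x, Real.cos (2 * Real.pi * (ω - x) * t) ∂σ := by
  have hphase (x : ℝ) : phase (ω * t) * Complex.exp ((2 * Real.pi * t : ℝ) * x * Complex.I) =
      phase ((ω - x) * t) := by
    rw [phase, phase, ← Complex.exp_add]
    congr 1
    push_cast
    ring
  have hint : Integrable (fun x : ℝ => phase ((ω - x) * t)) σ :=
    .of_bound (continuous_phase.comp (by fun_prop)).aestronglyMeasurable 1
      (.of_forall fun x => (norm_phase _).le)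
  rw [charFun_apply_real, ← integral_const_mul]
  simp only [hphase]
  refine (integral_re hint).symm.trans (integral_congr_ae (.of_forall fun x => ?_))
  simp only [RCLike.re_eq_complex_re, phase_re, mul_assoc]

lemma re_integral_phase_mul_charFun (ω u : ℝ) :
    (∫ t in 0..u, phase (ω * t) * charFun σ (2 * Real.pi * t)).re =
      ∫ x, dirichletKernel u (2 * Real.pi * (ω - x)) ∂σ := by
  have hcont : Continuous fun t : ℝ => phase (ω * t) * charFun σ (2 * Real.pi * t) :=
    (continuous_phase.comp (by fun_prop)).mul (continuous_charFun.comp (by fun_prop))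
  have hre := Complex.reCLM.intervalIntegral_comp_comm
    (hcont.intervalIntegrable 0 u (μ := volume))
  simp only [Complex.reCLM_apply, re_phase_mul_charFun] at hre
  have hcos : Continuous (Function.uncurry fun t x : ℝ =>
      Real.cos (2 * Real.pi * (ω - x) * t)) := by fun_prop
  rw [← hre, intervalIntegral_integral_swap_of_norm_le (C := 1) hcos.stronglyMeasurable
    fun t _ x => Real.abs_cos_le_one _]
  rfl

lemma integral_fejerKernel {R : ℝ} (hR : 0 ≤ R) (ω : ℝ) :
    ∫ x, fejerKernel R (2 * Real.pi * (ω - x)) ∂σ =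
      ∫ u in 0..R, (∫ t in 0..u, phase (ω * t) * charFun σ (2 * Real.pi * t)).re := by
  have hcont : Continuous (Function.uncurry fun u x : ℝ =>
      dirichletKernel u (2 * Real.pi * (ω - x))) :=
    continuous_dirichletKernel.comp
      (by fun_prop : Continuous fun p : ℝ × ℝ => (p.1, 2 * Real.pi * (ω - p.2)))
  simp only [re_integral_phase_mul_charFun]
  refine (intervalIntegral_integral_swap_of_norm_le (C := R) hcont.stronglyMeasurable
    fun u hu x => ?_).symm
  rw [uIoc_of_le hR] at hu
  exact (abs_dirichletKernel_le hu.1.le _).trans hu.2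

lemma mul_measureReal_Icc_le_integral_fejerKernel {R : ℝ} (hR : 0 < R) (ω : ℝ) :
    2 / Real.pi ^ 2 * R ^ 2 * σ.real (Icc (ω - 1 / (2 * R)) (ω + 1 / (2 * R))) ≤
      ∫ x, fejerKernel R (2 * Real.pi * (ω - x)) ∂σ := by
  have hint : Integrable (fun x => fejerKernel R (2 * Real.pi * (ω - x))) σ :=
    .of_bound ((continuous_fejerKernel R).comp (by fun_prop)).aestronglyMeasurable (R * R)
      (.of_forall fun x => abs_fejerKernel_le hR.le _)
  have hsub : Icc (ω - 1 / (2 * R)) (ω + 1 / (2 * R)) ⊆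
      {x | 2 / Real.pi ^ 2 * R ^ 2 ≤ fejerKernel R (2 * Real.pi * (ω - x))} := by
    intro x hx
    have hx' : |ω - x| ≤ 1 / (2 * R) := abs_le.2 ⟨by linarith [hx.2], by linarith [hx.1]⟩
    refine le_fejerKernel ?_
    rw [abs_mul, abs_mul, abs_of_pos hR, abs_of_pos Real.two_pi_pos]
    calc 2 * Real.pi * |ω - x| * R ≤ 2 * Real.pi * (1 / (2 * R)) * R := by gcongr
      _ = Real.pi := by field_simp
  exact (mul_le_mul_of_nonneg_left (measureReal_mono hsub) (by positivity)).trans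
    (mul_meas_ge_le_integral_of_nonneg (.of_forall fun x => fejerKernel_nonneg _ _) hint _)

lemma integral_sub_dirichletKernel (h : ℝ) :
    ∫ x, (h - dirichletKernel h (2 * Real.pi * x)) ∂σ =
      ∫ t in 0..h, ∫ x, (1 - Real.cos (2 * Real.pi * x * t)) ∂σ := by
  have hcont : Continuous (Function.uncurry fun t x : ℝ =>
      1 - Real.cos (2 * Real.pi * x * t)) := by fun_prop
  rw [intervalIntegral_integral_swap_of_norm_le (C := 1 + 1) hcont.stronglyMeasurable
    fun t _ x => (norm_sub_le _ _).trans
      (add_le_add norm_one.le (Real.abs_cos_le_one _))]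
  refine integral_congr_ae (.of_forall fun x => ?_)
  simp only
  rw [intervalIntegral.integral_sub (by simp) (Continuous.intervalIntegrable (by fun_prop) _ _)]
  simp [dirichletKernel]

lemma mul_measureReal_tail_le_integral {h : ℝ} (hh : 0 < h) :
    h / 2 * σ.real {x | 1 / h ≤ |x|} ≤ ∫ x, (h - dirichletKernel h (2 * Real.pi * x)) ∂σ := by
  have hle (x : ℝ) := abs_dirichletKernel_le hh.le (2 * Real.pi * x)
  have hcont : Continuous fun x => h - dirichletKernel h (2 * Real.pi * x) :=
    continuous_const.sub (continuous_dirichletKernel.comp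
      (by fun_prop : Continuous fun x : ℝ => (h, 2 * Real.pi * x)))
  have hint : Integrable (fun x => h - dirichletKernel h (2 * Real.pi * x)) σ :=
    .of_bound hcont.aestronglyMeasurable (|h| + h)
      (.of_forall fun x => (norm_sub_le _ _).trans (add_le_add_right (hle x) _))
  refine (mul_le_mul_of_nonneg_left (measureReal_mono fun x hx => ?_) (by positivity)).trans
    (mul_meas_ge_le_integral_of_nonneg (.of_forall fun x => ?_) hint (h / 2))
  · exact half_le_sub_dirichletKernel hh hx
  · exact sub_nonneg.2 ((le_abs_self _).trans (hle x))

end FourierTransform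

section Correlation

open scoped ComplexConjugate

variable {σ : Measure ℝ} {Ω : Type*} [MeasurableSpace Ω] {ν : Measure Ω} [IsProbabilityMeasure ν]
  {F : ℝ → Ω → ℂ} {B : ℝ}

lemma norm_integral_phase_mul_charFun_le (hF : Measurable (Function.uncurry F))
    (hB : ∀ t y, ‖F t y‖ ≤ B)
    (hσ : ∀ t, charFun σ (2 * Real.pi * t) = ∫ y, F t y * conj (F 0 y) ∂ν) {S u : ℝ} (ω : ℝ)
    (hS : ∀ᵐ y ∂ν, ‖∫ t in 0..u, phase (ω * t) * F t y‖ ≤ S) :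
    ‖∫ t in 0..u, phase (ω * t) * charFun σ (2 * Real.pi * t)‖ ≤ S * B := by
  have hB0 (t : ℝ) (y : Ω) : ‖phase (ω * t) * F t y * conj (F 0 y)‖ ≤ B * B := by
    rw [norm_mul, norm_mul, norm_phase, one_mul, RCLike.norm_conj]
    exact mul_le_mul (hB t y) (hB 0 y) (norm_nonneg _) ((norm_nonneg _).trans (hB t y))
  have hmeas : Measurable (Function.uncurry fun (t : ℝ) (y : Ω) =>
      phase (ω * t) * F t y * conj (F 0 y)) :=
    (((continuous_phase.measurable.comp (measurable_const_mul ω)).comp measurable_fst).mul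
      hF).mul (Complex.continuous_conj.measurable.comp
        ((hF.comp measurable_prodMk_left).comp measurable_snd))
  have hswap : ∫ t in 0..u, phase (ω * t) * charFun σ (2 * Real.pi * t) =
      ∫ y, (∫ t in 0..u, phase (ω * t) * F t y) * conj (F 0 y) ∂ν := by
    simp only [hσ, ← integral_const_mul, ← mul_assoc, ← intervalIntegral.integral_mul_const]
    exact intervalIntegral_integral_swap_of_norm_le hmeas.stronglyMeasurable fun t _ => hB0 t
  have hle := norm_integral_le_of_norm_le_const (μ := ν) (C := S * B)
    (f := fun y => (∫ t in 0..u, phase (ω * t) * F t y) * conj (F 0 y)) (by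
      filter_upwards [hS] with y hy
      rw [norm_mul, RCLike.norm_conj]
      exact mul_le_mul hy (hB 0 y) (norm_nonneg _) ((norm_nonneg _).trans hy))
  rwa [← hswap, probReal_univ, mul_one] at hle

lemma measureReal_Icc_le_of_norm_integral_le [IsFiniteMeasure σ]
    (hF : Measurable (Function.uncurry F)) (hB : ∀ t y, ‖F t y‖ ≤ B)
    (hσ : ∀ t, charFun σ (2 * Real.pi * t) = ∫ y, F t y * conj (F 0 y) ∂ν)
    {R S : ℝ} (hR : 0 < R) (ω : ℝ)
    (hS : ∀ᵐ y ∂ν, ∀ u, 0 ≤ u → u ≤ R → ‖∫ t in 0..u, phase (ω * t) * F t y‖ ≤ S) :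
    σ.real (Icc (ω - 1 / (2 * R)) (ω + 1 / (2 * R))) ≤ Real.pi ^ 2 / 2 * (B * S / R) := by
  have hupper : ∫ x, fejerKernel R (2 * Real.pi * (ω - x)) ∂σ ≤ S * B * R := by
    have hle := intervalIntegral.norm_integral_le_of_norm_le_const (a := 0) (b := R) (C := S * B)
      (f := fun u => (∫ t in 0..u, phase (ω * t) * charFun σ (2 * Real.pi * t)).re) fun u hu => by
        rw [uIoc_of_le hR.le] at hu
        exact (Complex.abs_re_le_norm _).trans (norm_integral_phase_mul_charFun_le hF hB hσ ω
          (hS.mono fun y hy => hy u hu.1.le hu.2))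
    rw [← integral_fejerKernel σ hR.le, sub_zero, abs_of_pos hR] at hle
    exact (le_abs_self _).trans hle
  have hmain := (mul_measureReal_Icc_le_integral_fejerKernel σ hR ω).trans hupper
  rw [← le_div_iff₀' (by positivity)] at hmain
  refine hmain.trans_eq ?_
  field_simp

lemma integral_one_sub_cos_le [IsFiniteMeasure σ] (hF : Measurable (Function.uncurry F))
    (hB : ∀ t y, ‖F t y‖ ≤ B)
    (hσ : ∀ t, charFun σ (2 * Real.pi * t) = ∫ y, F t y * conj (F 0 y) ∂ν) (t : ℝ) :
    ∫ x, (1 - Real.cos (2 * Real.pi * x * t)) ∂σ ≤ B * ∫ y, ‖F 0 y - F t y‖ ∂ν := by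
  have hFi (t : ℝ) : MemLp (F t) ⊤ ν :=
    memLp_top_of_bound (hF.comp measurable_prodMk_left).aestronglyMeasurable B (.of_forall (hB t))
  have hcorr (t : ℝ) : Integrable (fun y => F t y * conj (F 0 y)) ν :=
    ((hFi 0).star.mul (hFi t) (r := ⊤)).integrable le_top
  have hcos (t : ℝ) : ∫ x, Real.cos (2 * Real.pi * x * t) ∂σ =
      (∫ y, F t y * conj (F 0 y) ∂ν).re := by
    have := re_phase_mul_charFun σ 0 t
    simp only [zero_mul, phase_zero, one_mul, zero_sub, mul_neg, neg_mul, Real.cos_neg] at this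
    rw [← this, hσ]
  have hint : Integrable (fun x => Real.cos (2 * Real.pi * x * t)) σ :=
    .of_bound (Continuous.aestronglyMeasurable (by fun_prop)) 1
      (.of_forall fun x => Real.abs_cos_le_one _)
  calc ∫ x, (1 - Real.cos (2 * Real.pi * x * t)) ∂σ
      = (∫ y, (F 0 y - F t y) * conj (F 0 y) ∂ν).re := by
        have hone := hcos 0
        simp only [mul_zero, Real.cos_zero] at hone
        simp only [sub_mul]
        rw [integral_sub (integrable_const _) hint, integral_sub (hcorr 0) (hcorr t),
          Complex.sub_re, hone, hcos]
    _ ≤ ∫ y, ‖(F 0 y - F t y) * conj (F 0 y)‖ ∂ν :=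
        (Complex.re_le_norm _).trans (norm_integral_le_integral_norm _)
    _ ≤ ∫ y, B * ‖F 0 y - F t y‖ ∂ν := by
        refine integral_mono_of_nonneg (.of_forall fun y => norm_nonneg _)
          ((((hFi 0).sub (hFi t)).integrable le_top).norm.const_mul B) (.of_forall fun y => ?_)
        simp only
        rw [norm_mul, RCLike.norm_conj, mul_comm]
        exact mul_le_mul_of_nonneg_right (hB 0 y) (norm_nonneg _)
    _ = B * ∫ y, ‖F 0 y - F t y‖ ∂ν := integral_const_mul _ _

lemma measureReal_tail_le_of_integral_norm_sub_le [IsFiniteMeasure σ]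
    (hF : Measurable (Function.uncurry F)) (hB : ∀ t y, ‖F t y‖ ≤ B)
    (hσ : ∀ t, charFun σ (2 * Real.pi * t) = ∫ y, F t y * conj (F 0 y) ∂ν)
    {h ε : ℝ} (hh : 0 < h) (hε : ∀ t ∈ Ioc 0 h, ∫ y, ‖F 0 y - F t y‖ ∂ν ≤ ε) :
    σ.real {x | 1 / h ≤ |x|} ≤ 2 * (B * ε) := by
  obtain ⟨y⟩ := nonempty_of_isProbabilityMeasure ν
  have hB0 : 0 ≤ B := (norm_nonneg _).trans (hB 0 y)
  have hupper : ∫ x, (h - dirichletKernel h (2 * Real.pi * x)) ∂σ ≤ B * ε * h := by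
    have hle := intervalIntegral.norm_integral_le_of_norm_le_const (a := 0) (b := h) (C := B * ε)
      (f := fun t => ∫ x, (1 - Real.cos (2 * Real.pi * x * t)) ∂σ) fun t ht => by
        rw [uIoc_of_le hh.le] at ht
        rw [Real.norm_of_nonneg (integral_nonneg fun x => sub_nonneg.2 (Real.cos_le_one _))]
        exact (integral_one_sub_cos_le hF hB hσ t).trans
          (mul_le_mul_of_nonneg_left (hε t ht) hB0)
    rw [← integral_sub_dirichletKernel, sub_zero, abs_of_pos hh] at hle
    exact (le_abs_self _).trans hle
  have hmain := (mul_measureReal_tail_le_integral σ hh).trans hupper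
  refine le_of_mul_le_mul_left ?_ (half_pos hh)
  linarith

end Correlation

/-! ### The suspension measure -/

section LipNorm

variable {m : ℕ} {s : Fin m → ℝ} {ψ : Fin m → ℝ → ℂ}

lemma lipNorm_le_cylLipNorm (s : Fin m → ℝ) (ψ : Fin m → ℝ → ℂ) (a : Fin m) :
    lipNorm (s a) (ψ a) ≤ cylLipNorm s ψ :=
  le_ciSup (f := fun a => lipNorm (s a) (ψ a)) (Set.finite_range _).bddAbove a

lemma cylLipNorm_nonneg (s : Fin m → ℝ) (ψ : Fin m → ℝ → ℂ) : 0 ≤ cylLipNorm s ψ :=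
  Real.iSup_nonneg fun _ =>
    add_nonneg (Real.iSup_nonneg fun _ => norm_nonneg _) (NNReal.coe_nonneg _)

namespace IsLipCylindrical

lemma continuousOn (hψ : IsLipCylindrical s ψ) (a : Fin m) : ContinuousOn (ψ a) (Icc 0 (s a)) :=
  (hψ a).choose_spec.continuousOn

lemma norm_le (hψ : IsLipCylindrical s ψ) (a : Fin m) : ∀ t ∈ Icc 0 (s a),
    ‖ψ a t‖ ≤ cylLipNorm s ψ := by
  intro t ht
  have hbdd : BddAbove (range fun t : Icc (0 : ℝ) (s a) => ‖ψ a t‖) := by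
    obtain ⟨C, hC⟩ := isCompact_Icc.exists_bound_of_continuousOn (hψ.continuousOn a)
    exact ⟨C, by rintro _ ⟨t, rfl⟩; exact hC t t.2⟩
  exact (le_ciSup hbdd ⟨t, ht⟩).trans <|
    (le_add_of_nonneg_right (NNReal.coe_nonneg _)).trans (lipNorm_le_cylLipNorm s ψ a)

lemma norm_sub_le (hψ : IsLipCylindrical s ψ) (a : Fin m) {t u : ℝ}
    (ht : t ∈ Icc 0 (s a)) (hu : u ∈ Icc 0 (s a)) :
    ‖ψ a t - ψ a u‖ ≤ cylLipNorm s ψ * |t - u| := by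
  rcases eq_or_ne t u with rfl | htu
  · simp
  have hpos : 0 < |t - u| := abs_sub_pos.2 htu
  rw [← div_le_iff₀ hpos]
  have hLip : ‖ψ a t - ψ a u‖ / |t - u| ≤
      (sInf {K : ℝ≥0 | LipschitzOnWith K (ψ a) (Icc 0 (s a))} : ℝ≥0) := by
    refine Real.toNNReal_le_iff_le_coe.1 (le_csInf (hψ a) fun K hK => ?_)
    rw [Real.toNNReal_le_iff_le_coe, div_le_iff₀ hpos, ← dist_eq_norm, ← Real.dist_eq]
    exact LipschitzOnWith.dist_le_mul hK t ht u hu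
  exact hLip.trans <| (le_add_of_nonneg_left (Real.iSup_nonneg fun _ => norm_nonneg _)).trans
    (lipNorm_le_cylLipNorm s ψ a)

end IsLipCylindrical

end LipNorm

section SuspensionMeasure

variable {m : ℕ} {s : Fin m → ℝ} {μ : Measure (ℤ → Fin m)}

lemma measurableSet_roof_le_add (s : Fin m → ℝ) (t : ℝ) :
    MeasurableSet {p : (ℤ → Fin m) × ℝ | s (p.1 0) ≤ p.2 + t} :=
  measurableSet_le ((stronglyMeasurable_comp_apply s 0).measurable.comp measurable_fst)
    (measurable_snd.add_const t)

namespace Substitution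

lemma measurableSet_space (ζ : Substitution m) : MeasurableSet ζ.space := by
  have hspace : ζ.space = ⋂ n : ℕ, (fun x (j : Fin (2 * n + 1)) => x ((j : ℤ) - (n : ℤ))) ⁻¹'
      {y | ∃ (k : ℕ) (a : Fin m), List.ofFn y <:+: ζ.iter k a} := by
    ext x
    simp [space, centralBlock]
  rw [hspace]
  exact MeasurableSet.iInter fun n =>
    measurable_pi_lambda _ (fun j => measurable_pi_apply _) (Set.toFinite _).measurableSet

lemma measurableSet_suspensionSpace (ζ : Substitution m) (s : Fin m → ℝ) :
    MeasurableSet (ζ.suspensionSpace s) :=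
  (measurable_fst ζ.measurableSet_space).inter
    ((measurableSet_le measurable_const measurable_snd).inter (measurableSet_lt measurable_snd
      ((stronglyMeasurable_comp_apply s 0).measurable.comp measurable_fst)))

variable {ζ : Substitution m}

lemma prodMk_preimage_suspensionSpace {x : ℤ → Fin m} (hx : x ∈ ζ.space) :
    Prod.mk x ⁻¹' ζ.suspensionSpace s = Ico 0 (s (x 0)) := by
  ext τ
  simp [suspensionSpace, hx]

lemma ae_mem_suspensionSpace (ζ : Substitution m) (s : Fin m → ℝ) (μ : Measure (ℤ → Fin m)) :
    ∀ᵐ p ∂(ζ.suspensionMeasure s μ), p ∈ ζ.suspensionSpace s :=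
  ProbabilityTheory.ae_cond_mem (ζ.measurableSet_suspensionSpace s)

namespace IsInvariantMeasure

lemma measure_suspensionSpace (hμ : ζ.IsInvariantMeasure μ) (hs : ∀ i, 0 ≤ s i) :
    (μ.prod volume) (ζ.suspensionSpace s) = ENNReal.ofReal (∫ x, s (x 0) ∂μ) := by
  have := hμ.isProbabilityMeasure
  rw [Measure.prod_apply (ζ.measurableSet_suspensionSpace s),
    ofReal_integral_eq_lintegral_ofReal (integrable_comp_apply μ s 0) (.of_forall fun x => hs _)]
  refine lintegral_congr_ae ?_
  filter_upwards [hμ.ae_mem_space] with x hx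
  rw [prodMk_preimage_suspensionSpace hx, Real.volume_Ico, sub_zero]

lemma le_integral_roof (hμ : ζ.IsInvariantMeasure μ) {d : ℝ} (hds : ∀ i, d ≤ s i) :
    d ≤ ∫ x, s (x 0) ∂μ := by
  have := hμ.isProbabilityMeasure
  calc d = ∫ _, d ∂μ := by rw [integral_const, probReal_univ, one_smul]
    _ ≤ ∫ x, s (x 0) ∂μ :=
      integral_mono (integrable_const d) (integrable_comp_apply μ s 0) fun x => hds _

lemma measure_suspensionSpace_ne_top (hμ : ζ.IsInvariantMeasure μ) (hs : ∀ i, 0 < s i) :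
    (μ.prod volume) (ζ.suspensionSpace s) ≠ ⊤ := by
  rw [hμ.measure_suspensionSpace fun i => (hs i).le]
  exact ENNReal.ofReal_ne_top

lemma measure_suspensionSpace_ne_zero (hμ : ζ.IsInvariantMeasure μ) (hs : ∀ i, 0 < s i) :
    (μ.prod volume) (ζ.suspensionSpace s) ≠ 0 := by
  have := hμ.isProbabilityMeasure
  obtain ⟨x⟩ := nonempty_of_isProbabilityMeasure μ
  have : Nonempty (Fin m) := ⟨x 0⟩
  obtain ⟨i, hi⟩ := Finite.exists_min s
  rw [hμ.measure_suspensionSpace fun i => (hs i).le]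
  exact (ENNReal.ofReal_pos.2 ((hs i).trans_le (hμ.le_integral_roof hi))).ne'

lemma isProbabilityMeasure_suspensionMeasure (hμ : ζ.IsInvariantMeasure μ) (hs : ∀ i, 0 < s i) :
    IsProbabilityMeasure (ζ.suspensionMeasure s μ) :=
  ProbabilityTheory.cond_isProbabilityMeasure_of_finite
    (hμ.measure_suspensionSpace_ne_zero hs) (hμ.measure_suspensionSpace_ne_top hs)

lemma setIntegral_suspensionSpace {E : Type*} [NormedAddCommGroup E] [NormedSpace ℝ E]
    (hμ : ζ.IsInvariantMeasure μ) (hs : ∀ i, 0 ≤ s i) {g : (ℤ → Fin m) × ℝ → E}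
    (hg : IntegrableOn g (ζ.suspensionSpace s) (μ.prod volume)) :
    ∫ p in ζ.suspensionSpace s, g p ∂(μ.prod volume) =
      ∫ x, (∫ t in 0..s (x 0), g (x, t)) ∂μ := by
  have := hμ.isProbabilityMeasure
  have hmeas := ζ.measurableSet_suspensionSpace s
  rw [← integral_indicator hmeas, integral_prod _ ((integrable_indicator_iff hmeas).2 hg)]
  refine integral_congr_ae ?_
  filter_upwards [hμ.ae_mem_space] with x hx
  rw [intervalIntegral.integral_of_le (hs _), ← integral_Ico_eq_integral_Ioc,
    ← integral_indicator measurableSet_Ico, ← prodMk_preimage_suspensionSpace hx]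
  rfl

lemma measureReal_top_strip_le (hμ : ζ.IsInvariantMeasure μ) {d : ℝ} (hd : 0 < d)
    (hds : ∀ i, d ≤ s i) {t : ℝ} (ht : 0 ≤ t) :
    (ζ.suspensionMeasure s μ).real {p | s (p.1 0) ≤ p.2 + t} ≤ t / d := by
  have := hμ.isProbabilityMeasure
  have hspace := ζ.measurableSet_suspensionSpace s
  have hfibre (x : ℤ → Fin m) :
      Prod.mk x ⁻¹' (ζ.suspensionSpace s ∩ {p | s (p.1 0) ≤ p.2 + t}) ⊆
        Icc (s (x 0) - t) (s (x 0)) :=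
    fun τ hτ => ⟨sub_le_iff_le_add.2 hτ.2, hτ.1.2.2.le⟩
  have hstrip : (μ.prod volume).real (ζ.suspensionSpace s ∩ {p | s (p.1 0) ≤ p.2 + t}) ≤ t := by
    refine ENNReal.toReal_le_of_le_ofReal ht ?_
    calc _ = ∫⁻ x, volume (Prod.mk x ⁻¹'
            (ζ.suspensionSpace s ∩ {p | s (p.1 0) ≤ p.2 + t})) ∂μ :=
          Measure.prod_apply (hspace.inter (measurableSet_roof_le_add s t))
      _ ≤ ∫⁻ _, ENNReal.ofReal t ∂μ := lintegral_mono fun x => by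
          simpa only [Real.volume_Icc, sub_sub_cancel] using measure_mono (μ := volume) (hfibre x)
      _ = ENNReal.ofReal t := by simp
  have hmass : d ≤ (μ.prod volume).real (ζ.suspensionSpace s) := by
    rw [measureReal_def, hμ.measure_suspensionSpace fun i => hd.le.trans (hds i),
      ENNReal.toReal_ofReal (hd.le.trans (hμ.le_integral_roof hds))]
    exact hμ.le_integral_roof hds
  calc (ζ.suspensionMeasure s μ).real {p | s (p.1 0) ≤ p.2 + t}
      = ((μ.prod volume).real (ζ.suspensionSpace s))⁻¹ *
          (μ.prod volume).real (ζ.suspensionSpace s ∩ {p | s (p.1 0) ≤ p.2 + t}) := by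
        rw [measureReal_def, measureReal_def, measureReal_def, ← ENNReal.toReal_inv,
          ← ENNReal.toReal_mul]
        exact congrArg ENNReal.toReal (ProbabilityTheory.cond_apply hspace _ _)
    _ ≤ d⁻¹ * t := by gcongr
    _ = t / d := inv_mul_eq_div _ _

end IsInvariantMeasure

end Substitution

variable {ζ : Substitution m} {ψ : Fin m → ℝ → ℂ}

lemma towerFun_eq_of_lt (hs : ∀ i, 0 < s i) (ψ : Fin m → ℝ → ℂ) {x : ℤ → Fin m} {v : ℝ}
    (hv : 0 ≤ v) (hv' : v < s (x 0)) : towerFun s ψ x v = ψ (x 0) v := by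
  have h1 : roofSum s x (0 + 1) = s (x 0) := by rw [roofSum_add_one, roofSum_zero, zero_add]
  rw [towerFun_eq hs ψ (n := 0) (by rwa [roofSum_zero]) (by rwa [h1]), roofSum_zero, sub_zero]

lemma cylindrical_eq_towerFun (hs : ∀ i, 0 < s i) (ψ : Fin m → ℝ → ℂ) {p : (ℤ → Fin m) × ℝ}
    (hp : p ∈ ζ.suspensionSpace s) : cylindrical ψ p = towerFun s ψ p.1 p.2 :=
  (towerFun_eq_of_lt hs ψ hp.2.1 hp.2.2).symm

namespace IsLipCylindrical

lemma integrableOn_cylindrical (hψ : IsLipCylindrical s ψ) (hs : ∀ i, 0 < s i)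
    (hμ : ζ.IsInvariantMeasure μ) :
    IntegrableOn (cylindrical ψ) (ζ.suspensionSpace s) (μ.prod volume) := by
  refine IntegrableOn.congr_fun (f := fun p => towerFun s ψ p.1 p.2) ?_
    (fun p hp => (cylindrical_eq_towerFun hs ψ hp).symm) (ζ.measurableSet_suspensionSpace s)
  exact Measure.integrableOn_of_bounded (hμ.measure_suspensionSpace_ne_top hs)
    (measurable_towerFun hs hψ.continuousOn).aestronglyMeasurable
    (.of_forall fun p => norm_towerFun_le hs hψ.norm_le p.1 p.2)

lemma integral_letterCoeff_eq_zero (hψ : IsLipCylindrical s ψ) (hs : ∀ i, 0 < s i)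
    (hμ : ζ.IsInvariantMeasure μ) (h0 : ∫ p, cylindrical ψ p ∂(ζ.suspensionMeasure s μ) = 0) :
    ∫ x, letterCoeff s ψ 0 (x 0) ∂μ = 0 := by
  rw [Substitution.suspensionMeasure, integral_smul_measure, smul_eq_zero, ENNReal.toReal_inv,
    inv_eq_zero, ENNReal.toReal_eq_zero_iff] at h0
  have hset := h0.resolve_left
    (not_or.2 ⟨hμ.measure_suspensionSpace_ne_zero hs, hμ.measure_suspensionSpace_ne_top hs⟩)
  rw [hμ.setIntegral_suspensionSpace (fun i => (hs i).le) (hψ.integrableOn_cylindrical hs hμ)]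
    at hset
  simpa only [letterCoeff, cylindrical, zero_mul, phase_zero, one_mul] using hset

lemma norm_towerFun_sub_le (hψ : IsLipCylindrical s ψ) (hs : ∀ i, 0 < s i) {t : ℝ} (ht : 0 ≤ t)
    {p : (ℤ → Fin m) × ℝ} (hp : p ∈ ζ.suspensionSpace s) :
    ‖towerFun s ψ p.1 p.2 - towerFun s ψ p.1 (p.2 + t)‖ ≤ cylLipNorm s ψ * t +
      {p : (ℤ → Fin m) × ℝ | s (p.1 0) ≤ p.2 + t}.indicator (fun _ => 2 * cylLipNorm s ψ) p := by
  have hL := cylLipNorm_nonneg s ψ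
  rcases le_or_gt (s (p.1 0)) (p.2 + t) with htop | hlt
  · rw [indicator_of_mem (s := {p : (ℤ → Fin m) × ℝ | s (p.1 0) ≤ p.2 + t}) htop]
    have hle := norm_sub_le_of_le (norm_towerFun_le hs hψ.norm_le p.1 p.2)
      (norm_towerFun_le hs hψ.norm_le p.1 (p.2 + t))
    have hLt : 0 ≤ cylLipNorm s ψ * t := by positivity
    linarith
  · have hp0 := hp.2.1
    rw [indicator_of_notMem (s := {p : (ℤ → Fin m) × ℝ | s (p.1 0) ≤ p.2 + t}) hlt.not_ge,
      add_zero, towerFun_eq_of_lt hs ψ hp0 hp.2.2, towerFun_eq_of_lt hs ψ (by linarith) hlt]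
    refine (hψ.norm_sub_le _ ⟨hp0, hp.2.2.le⟩ ⟨by linarith, hlt.le⟩).trans_eq ?_
    rw [sub_add_cancel_left, abs_neg, abs_of_nonneg ht]

lemma integral_norm_towerFun_sub_le (hψ : IsLipCylindrical s ψ) (hμ : ζ.IsInvariantMeasure μ)
    {d : ℝ} (hd : 0 < d) (hds : ∀ i, d ≤ s i) {t : ℝ} (ht : 0 ≤ t) :
    ∫ p, ‖towerFun s ψ p.1 p.2 - towerFun s ψ p.1 (p.2 + t)‖ ∂(ζ.suspensionMeasure s μ) ≤
      cylLipNorm s ψ * (t + 2 * (t / d)) := by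
  have hs : ∀ i, 0 < s i := fun i => hd.trans_le (hds i)
  have := hμ.isProbabilityMeasure_suspensionMeasure hs
  have hE := measurableSet_roof_le_add s t
  have hind : Integrable ({p : (ℤ → Fin m) × ℝ | s (p.1 0) ≤ p.2 + t}.indicator
      fun _ => 2 * cylLipNorm s ψ) (ζ.suspensionMeasure s μ) := (integrable_const _).indicator hE
  calc _ ≤ ∫ p, (cylLipNorm s ψ * t + {p : (ℤ → Fin m) × ℝ | s (p.1 0) ≤ p.2 + t}.indicator
          (fun _ => 2 * cylLipNorm s ψ) p) ∂(ζ.suspensionMeasure s μ) := by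
        refine integral_mono_of_nonneg (.of_forall fun p => norm_nonneg _)
          ((integrable_const _).add hind) ?_
        filter_upwards [ζ.ae_mem_suspensionSpace s μ] with p hp
        exact hψ.norm_towerFun_sub_le hs ht hp
    _ = cylLipNorm s ψ * t +
          (ζ.suspensionMeasure s μ).real {p | s (p.1 0) ≤ p.2 + t} * (2 * cylLipNorm s ψ) := by
        rw [integral_add (integrable_const _) hind, integral_indicator_const _ hE, integral_const,
          probReal_univ, one_smul, smul_eq_mul]
    _ ≤ cylLipNorm s ψ * t + t / d * (2 * cylLipNorm s ψ) := by
        gcongr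
        · exact mul_nonneg zero_le_two (cylLipNorm_nonneg s ψ)
        · exact hμ.measureReal_top_strip_le hd hds ht
    _ = _ := by ring

lemma measurable_towerFun_add (hψ : IsLipCylindrical s ψ) (hs : ∀ i, 0 < s i) :
    Measurable (Function.uncurry fun (t : ℝ) (p : (ℤ → Fin m) × ℝ) =>
      towerFun s ψ p.1 (p.2 + t)) :=
  (measurable_towerFun hs hψ.continuousOn).comp
    ((measurable_fst.comp measurable_snd).prodMk
      ((measurable_snd.comp measurable_snd).add measurable_fst))

end IsLipCylindrical

namespace IsSpectralMeasure

variable {σ : Measure ℝ}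

lemma charFun_eq (hs : ∀ i, 0 < s i)
    (hσ : IsSpectralMeasure (ζ.suspensionMeasure s μ) (suspensionFlow s) (cylindrical ψ) σ)
    (t : ℝ) :
    charFun σ (2 * Real.pi * t) = ∫ p, towerFun s ψ p.1 (p.2 + t) *
      (starRingEnd ℂ) (towerFun s ψ p.1 (p.2 + 0)) ∂(ζ.suspensionMeasure s μ) := by
  have hexp (x : ℝ) : Complex.exp ((2 * Real.pi * t : ℝ) * x * Complex.I) =
      Complex.exp (2 * Real.pi * Complex.I * x * t) := by
    congr 1
    push_cast
    ring
  rw [charFun_apply_real]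
  simp only [hexp]
  rw [hσ.fourier t]
  refine integral_congr_ae ?_
  filter_upwards [ζ.ae_mem_suspensionSpace s μ] with p hp
  rw [cylindrical_suspensionFlow, add_zero, cylindrical_eq_towerFun hs ψ hp]

lemma measureReal_Icc_le (hμ : ζ.IsInvariantMeasure μ) {d : ℝ} (hd : 0 < d)
    (hds : ∀ i, d ≤ s i) (hs1 : ∀ i, s i ≤ 1) (hψ : IsLipCylindrical s ψ)
    (hσ : IsSpectralMeasure (ζ.suspensionMeasure s μ) (suspensionFlow s) (cylindrical ψ) σ)
    (ω : ℝ) {R : ℝ} (hR : 1 ≤ R) (n : ℕ) :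
    σ.real (Icc (ω - 1 / (2 * R)) (ω + 1 / (2 * R))) ≤
      cylLipNorm s ψ * (20 * cylLipNorm s ψ * (ζ.lengthBase ^ n / R) +
        10 * ζ.twistedRate s ω (letterCoeff s ψ ω) n / d) := by
  have hs : ∀ i, 0 < s i := fun i => hd.trans_le (hds i)
  have := hσ.isFiniteMeasure
  have := hμ.isProbabilityMeasure_suspensionMeasure hs
  have hL := cylLipNorm_nonneg s ψ
  have hρ := ζ.twistedRate_nonneg s ω (letterCoeff s ψ ω) n
  have hR0 : 0 < R := by linarith
  set L := cylLipNorm s ψ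
  set ρ := ζ.twistedRate s ω (letterCoeff s ψ ω) n
  have hpi : Real.pi ^ 2 / 2 ≤ 5 := by nlinarith [Real.pi_pos, Real.pi_lt_d2]
  calc σ.real (Icc (ω - 1 / (2 * R)) (ω + 1 / (2 * R)))
      ≤ Real.pi ^ 2 / 2 * (L * (4 * L * ζ.lengthBase ^ n + ρ * ((R + 1) / d)) / R) := by
        refine measureReal_Icc_le_of_norm_integral_le (hψ.measurable_towerFun_add hs)
          (fun t p => norm_towerFun_le hs hψ.norm_le p.1 (p.2 + t)) (hσ.charFun_eq hs) hR0 ω ?_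
        filter_upwards [ζ.ae_mem_suspensionSpace s μ] with p hp u hu huR
        refine (norm_integral_towerFun_le hs hs1 hψ.continuousOn hψ.norm_le hd hds hp.1 ω hp.2.1
          (hp.2.2.le.trans (hs1 _)) hu n).trans ?_
        gcongr
    _ ≤ 5 * (L * (4 * L * ζ.lengthBase ^ n + ρ * ((R + R) / d)) / R) := by gcongr
    _ = L * (20 * L * (ζ.lengthBase ^ n / R) + 10 * ρ / d) := by
        field_simp
        ring

lemma measureReal_tail_le (hμ : ζ.IsInvariantMeasure μ) {d : ℝ} (hd : 0 < d)
    (hds : ∀ i, d ≤ s i) (hd1 : d ≤ 1) (hψ : IsLipCylindrical s ψ)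
    (hσ : IsSpectralMeasure (ζ.suspensionMeasure s μ) (suspensionFlow s) (cylindrical ψ) σ)
    {h : ℝ} (hh : 0 < h) :
    σ.real {x | 1 / h ≤ |x|} ≤ 6 / d * cylLipNorm s ψ ^ 2 * h := by
  have hs : ∀ i, 0 < s i := fun i => hd.trans_le (hds i)
  have := hσ.isFiniteMeasure
  have := hμ.isProbabilityMeasure_suspensionMeasure hs
  have hL := cylLipNorm_nonneg s ψ
  set L := cylLipNorm s ψ
  have htail : σ.real {x | 1 / h ≤ |x|} ≤ 2 * (L * (L * (3 * (h / d)))) := by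
    refine measureReal_tail_le_of_integral_norm_sub_le (hψ.measurable_towerFun_add hs)
      (fun t p => norm_towerFun_le hs hψ.norm_le p.1 (p.2 + t)) (hσ.charFun_eq hs) hh fun t ht => ?_
    simp only [add_zero]
    refine (hψ.integral_norm_towerFun_sub_le hμ hd hds ht.1.le).trans
      (mul_le_mul_of_nonneg_left ?_ hL)
    have htd : t / d ≤ h / d := div_le_div_of_nonneg_right ht.2 hd.le
    have hhd : t ≤ t / d := le_div_self ht.1.le hd hd1
    linarith
  exact htail.trans_eq (by ring)

end IsSpectralMeasure

end SuspensionMeasure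

/-! ### Hölder bounds for the spectral measures -/

section Scales

open Filter Topology

lemma pow_le_inv_mul_rpow_logb {B η r : ℝ} (hB : 1 < B) (hη0 : 0 < η) (hη1 : η < 1) (hr : 0 < r)
    {n : ℕ} (hn : r⁻¹ < B ^ (n + 1)) : η ^ n ≤ η⁻¹ * r ^ (-Real.logb B η) := by
  have hpow : η ^ (n + 1) ≤ r ^ (-Real.logb B η) := by
    calc η ^ (n + 1) = (B ^ (n + 1)) ^ Real.logb B η := by
          rw [← Real.rpow_pow_comm (by positivity), Real.rpow_logb (by positivity) hB.ne' hη0]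
      _ ≤ r⁻¹ ^ Real.logb B η :=
          Real.rpow_le_rpow_of_nonpos (by positivity) hn.le (Real.logb_neg hB hη0 hη1).le
      _ = r ^ (-Real.logb B η) := by rw [Real.inv_rpow hr.le, Real.rpow_neg hr.le]
  calc η ^ n = η⁻¹ * η ^ (n + 1) := by rw [pow_succ', inv_mul_cancel_left₀ hη0.ne']
    _ ≤ _ := by gcongr

lemma mul_le_rpow_half_of_sq_le_inv {x r : ℝ} (hr : 0 < r) (hx : x ^ 2 ≤ r⁻¹) :
    x * r ≤ r ^ (1 / 2 : ℝ) := by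
  rw [← Real.sqrt_eq_rpow]
  refine Real.le_sqrt_of_sq_le ?_
  calc (x * r) ^ 2 = x ^ 2 * r ^ 2 := mul_pow _ _ _
    _ ≤ r⁻¹ * r ^ 2 := by gcongr
    _ = r := by field_simp

lemma exists_pow_mul_le_rpow {Λ η : ℝ} (hΛ : 1 < Λ) (hη0 : 0 < η) (hη1 : η < 1) (p N : ℕ) :
    ∃ γ C : ℝ, 0 < γ ∧ 0 ≤ C ∧ ∀ (r : ℝ) (n : ℕ), 0 < r → r ≤ 1 →
      ((Λ ^ (p + 1)) ^ 2) ^ n ≤ r⁻¹ → r⁻¹ < ((Λ ^ (p + 1)) ^ 2) ^ (n + 1) →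
        Λ ^ (p * n + N) * r ≤ C * r ^ γ ∧ η ^ n ≤ C * r ^ γ := by
  have hB : 1 < (Λ ^ (p + 1)) ^ 2 := one_lt_pow₀ (one_lt_pow₀ hΛ p.succ_ne_zero) two_ne_zero
  have hγ : 0 < -Real.logb ((Λ ^ (p + 1)) ^ 2) η := neg_pos.2 (Real.logb_neg hB hη0 hη1)
  refine ⟨min (1 / 2) (-Real.logb ((Λ ^ (p + 1)) ^ 2) η), max (Λ ^ N) η⁻¹,
    lt_min one_half_pos hγ, by positivity, fun r n hr hr1 hlo hhi => ⟨?_, ?_⟩⟩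
  · have hsq : (Λ ^ (p * n)) ^ 2 ≤ r⁻¹ := by
      refine le_trans ?_ hlo
      rw [← pow_mul, ← pow_mul, ← pow_mul]
      exact pow_le_pow_right₀ hΛ.le (by nlinarith)
    calc Λ ^ (p * n + N) * r = Λ ^ N * (Λ ^ (p * n) * r) := by rw [pow_add]; ring
      _ ≤ Λ ^ N * r ^ (1 / 2 : ℝ) := by
          gcongr
          exact mul_le_rpow_half_of_sq_le_inv hr hsq
      _ ≤ _ := by
          gcongr ?_ * ?_
          · exact le_max_left _ _
          · exact Real.rpow_le_rpow_of_exponent_ge hr hr1 (min_le_left _ _)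
  · refine (pow_le_inv_mul_rpow_logb hB hη0 hη1 hr hhi).trans ?_
    gcongr ?_ * ?_
    · exact le_max_right _ _
    · exact Real.rpow_le_rpow_of_exponent_ge hr hr1 (min_le_right _ _)

lemma eventually_exists_pow_le_inv {B : ℝ} (hB : 1 < B) {P : ℕ → Prop}
    (hP : ∀ᶠ n in atTop, P n) :
    ∀ᶠ r in 𝓝[>] (0 : ℝ), ∃ n, P n ∧ B ^ n ≤ r⁻¹ ∧ r⁻¹ < B ^ (n + 1) := by
  obtain ⟨N, hN⟩ := eventually_atTop.1 hP
  filter_upwards [tendsto_inv_nhdsGT_zero.eventually_ge_atTop (B ^ N)] with r hr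
  obtain ⟨n, hlo, hhi⟩ := exists_nat_pow_near ((one_le_pow₀ hB.le).trans hr) hB
  exact ⟨n, hN n (Nat.lt_succ_iff.1 ((pow_lt_pow_iff_right₀ hB).1 (hr.trans_lt hhi))), hlo, hhi⟩

lemma eventually_mul_rpow_le_rpow (A : ℝ) {α β : ℝ} (h : β < α) :
    ∀ᶠ r in 𝓝[>] (0 : ℝ), A * r ^ α ≤ r ^ β := by
  have hlim : Tendsto (fun r : ℝ => A * r ^ (α - β)) (𝓝[>] 0) (𝓝 0) := by
    have hcont :=
      (Real.continuousAt_rpow_const 0 (α - β) (.inr (sub_pos.2 h).le)).tendsto.const_mul A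
    rw [Real.zero_rpow (sub_pos.2 h).ne', mul_zero] at hcont
    exact hcont.mono_left nhdsWithin_le_nhds
  filter_upwards [hlim.eventually_le_const one_pos, self_mem_nhdsWithin] with r hr hr0
  calc A * r ^ α = A * r ^ (α - β) * r ^ β := by
        rw [mul_assoc, ← Real.rpow_add hr0, sub_add_cancel]
    _ ≤ 1 * r ^ β := mul_le_mul_of_nonneg_right hr (Real.rpow_nonneg (le_of_lt hr0) β)
    _ = r ^ β := one_mul _

end Scales

section Main

open Filter Topology

variable {m : ℕ} {ζ : Substitution m}

namespace Substitution

lemma wordSum_iterate_onWords (ζ : Substitution m) (s : Fin m → ℝ) (w : List (Fin m)) (n : ℕ) :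
    wordSum s (ζ.onWords^[n] w) = ζ.iterLength (fun i => w.count i) s n := by
  simp only [wordSum_eq_sum_count, iterLength, count_iterate_onWords]

lemma pos_of_returnWord {q : ℕ} {a : Fin m} {v : List (Fin m)}
    (hv : ∀ b, (a :: v) ++ [a] <:+: ζ.iter q b) : 0 < q := by
  rcases q.eq_zero_or_pos with rfl | hq
  · have hlen := (hv a).length_le
    simp [iter_zero] at hlen
  · exact hq

lemma twistedRate_le_mul_pow {ρ : ℝ} (hρ : 0 ≤ ρ) {q K : ℕ} {a : Fin m} {v : List (Fin m)}
    (hv : ∀ b, (a :: v) ++ [a] <:+: ζ.iter q b)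
    (hK : ∀ n b, (ζ.iter (n + q) b).length ≤ K * (ζ.iter n a).length) {η : ℝ} (hη0 : 0 ≤ η)
    (hη : 1 - 4 * ρ ^ 2 / K ≤ η) (s : Fin m → ℝ) (ω : ℝ) (c : Fin m → ℂ) (N : ℕ) :
    ζ.twistedRate s ω c (N + q) ^ q ≤ ‖c‖ ^ q * η ^
      (farFromIntegers (fun n => ω * ζ.iterLength (fun i => (a :: v).count i) s n) ρ N).card := by
  refine (pow_le_pow_mul_pow_card
    (T := farFromIntegers (fun n => ω * ζ.iterLength (fun i => (a :: v).count i) s n) ρ N)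
    (ζ.antitone_twistedRate s ω c) (ζ.twistedRate_nonneg s ω c) hη0 (pos_of_returnWord hv)
    (fun n hn => ?_) (Finset.filter_subset _ _)).trans ?_
  · have hfar := pow_le_pow_left₀ hρ (Finset.mem_filter.1 hn).2 2
    rw [sq_abs] at hfar
    refine (ζ.twistedRate_add_le s ω c hv (hK n) rfl).trans
      (mul_le_mul_of_nonneg_right (le_trans ?_ hη) (ζ.twistedRate_nonneg s ω c n))
    rw [wordSum_iterate_onWords]
    gcongr
  · gcongr
    · exact ζ.twistedRate_nonneg s ω c 0
    · exact ζ.twistedRate_le_norm s ω c 0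

lemma exists_twistedRate_le (hprim : ζ.IsPrimitive) (hirr : ζ.HasIrreducibleCharpoly)
    (h2 : 1 < ζ.secondEigenvalueModulus) :
    ∃ (N : ℕ) (η κ : ℝ), 0 < η ∧ η < 1 ∧ 1 < κ ∧ ∀ᵐ s ∂simplexMeasure m, ∀ᶠ M : ℕ in atTop,
      ∀ ω : ℝ, (κ ^ M)⁻¹ ≤ |ω| → |ω| ≤ κ ^ M → ∀ c : Fin m → ℂ,
        ζ.twistedRate s ω c (M + N) ≤ ‖c‖ * η ^ M := by
  obtain ⟨q, a, v, hv⟩ := hprim.exists_returnWord (hirr.two_le h2)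
  obtain ⟨K, hK0, hK⟩ := hprim.exists_length_iter_add_le_mul q
  have hq : 0 < q := pos_of_returnWord hv
  have hℓ : (fun i => (a :: v).count i) ≠ 0 := fun h => by simpa using congrFun h a
  obtain ⟨ρ, δ, κ, hρ, hδ, hκ, hEK⟩ := hirr.erdos_kahane h2 hℓ
  obtain ⟨η, hη⟩ : ∃ η, η = max (1 / 2) (1 - 4 * ρ ^ 2 / K) := ⟨_, rfl⟩
  have hη0 : 0 < η := hη ▸ lt_max_of_lt_left one_half_pos
  have hη1 : η < 1 := hη ▸ max_lt one_half_lt_one (sub_lt_self 1 (by positivity))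
  have hηpow (M : ℕ) : ((η ^ (δ / q)) ^ M) ^ q = η ^ (δ * M) := by
    rw [← Real.rpow_mul_natCast hη0.le, ← Real.rpow_mul_natCast hη0.le]
    congr 1
    field_simp
  refine ⟨m + q, η ^ (δ / q), κ, by positivity,
    Real.rpow_lt_one hη0.le hη1 (by positivity), hκ, ?_⟩
  filter_upwards [hEK] with s hs
  filter_upwards [hs] with M hM ω hlo hhi c
  refine (pow_le_pow_iff_left₀ (ζ.twistedRate_nonneg s ω c _) (by positivity) hq.ne').1 ?_
  rw [mul_pow, hηpow, ← add_assoc]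
  refine (twistedRate_le_mul_pow hρ.le hv (fun n b => hK n b a) hη0.le (hη ▸ le_max_right _ _)
    s ω c (M + m)).trans ?_
  rw [← Real.rpow_natCast η]
  exact mul_le_mul_of_nonneg_left
    (Real.rpow_le_rpow_of_exponent_ge hη0 hη1.le (hM ω hlo hhi)) (by positivity)

lemma IsPrimitive.exists_scale_zero [Nonempty (Fin m)] (hprim : ζ.IsPrimitive) :
    ∃ γ C : ℝ, 0 < γ ∧ 0 ≤ C ∧ ∀ r : ℝ, 0 < r → r ≤ 1 → ∃ n, ζ.lengthBase ^ n * r ≤ C * r ^ γ ∧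
      ∀ s c μ, ζ.IsInvariantMeasure μ → ∫ x, c (x 0) ∂μ = 0 →
        ζ.twistedRate s 0 c n ≤ C * r ^ γ * ‖c‖ := by
  have hΛ : (1 : ℝ) < ζ.lengthBase := by exact_mod_cast ζ.two_le_lengthBase
  obtain ⟨p, κ, hκ0, hκ1, hrate⟩ := hprim.exists_twistedRate_zero_le
  obtain ⟨γ, C, hγ, hC, hscale⟩ := exists_pow_mul_le_rpow hΛ
    (lt_max_of_lt_left one_half_pos) (max_lt one_half_lt_one hκ1) p 0
  refine ⟨γ, 4 * C, hγ, by positivity, fun r hr hr1 => ?_⟩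
  obtain ⟨k, hlo, hhi⟩ := exists_nat_pow_near ((one_le_inv₀ hr).2 hr1)
    (one_lt_pow₀ (one_lt_pow₀ hΛ p.succ_ne_zero) two_ne_zero)
  obtain ⟨hlen, hη⟩ := hscale r k hr hr1 hlo hhi
  refine ⟨p * k, hlen.trans ?_, fun s c μ hμ h0 => (hrate s c μ hμ h0 k).trans ?_⟩
  · gcongr
    linarith
  · calc 4 * ‖c‖ * κ ^ k ≤ 4 * ‖c‖ * (C * r ^ γ) := by
          gcongr
          exact (pow_le_pow_left₀ hκ0 (le_max_right _ _) k).trans hη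
      _ = _ := by ring

lemma exists_scale_intermediate (hprim : ζ.IsPrimitive) (hirr : ζ.HasIrreducibleCharpoly)
    (h2 : 1 < ζ.secondEigenvalueModulus) :
    ∃ α γ C : ℝ, 0 < α ∧ α ≤ 1 ∧ 0 < γ ∧ 0 ≤ C ∧ ∀ᵐ s ∂simplexMeasure m, ∀ᶠ r in 𝓝[>] (0 : ℝ),
      ∃ n, ζ.lengthBase ^ n * r ≤ C * r ^ γ ∧ ∀ ω c, r ^ α ≤ |ω| → |ω| ≤ (r ^ α)⁻¹ →
        ζ.twistedRate s ω c n ≤ C * r ^ γ * ‖c‖ := by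
  have hΛ : (1 : ℝ) < ζ.lengthBase := by exact_mod_cast ζ.two_le_lengthBase
  obtain ⟨N, η, κ, hη0, hη1, hκ, hrate⟩ := exists_twistedRate_le hprim hirr h2
  obtain ⟨γ, C, hγ, hC, hscale⟩ := exists_pow_mul_le_rpow hΛ hη0 hη1 1 N
  have hB : (1 : ℝ) < (ζ.lengthBase ^ (1 + 1)) ^ 2 :=
    one_lt_pow₀ (one_lt_pow₀ hΛ two_ne_zero) two_ne_zero
  have hκ1 : κ⁻¹ < 1 := inv_lt_one_of_one_lt₀ hκ
  have hκ0 : 0 < κ⁻¹ := by positivity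
  set α := -Real.logb ((ζ.lengthBase ^ (1 + 1)) ^ 2) κ⁻¹
  have hα : 0 < α := neg_pos.2 (Real.logb_neg hB hκ0 hκ1)
  refine ⟨min (α / 2) 1, γ, C, by positivity, min_le_right _ _, hγ, hC, ?_⟩
  filter_upwards [hrate] with s hs
  filter_upwards [eventually_exists_pow_le_inv hB hs, self_mem_nhdsWithin,
    Ioo_mem_nhdsGT one_pos, eventually_mul_rpow_le_rpow κ⁻¹⁻¹ (min_lt_of_left_lt (half_lt_self hα))]
    with r ⟨M, hM, hlo, hhi⟩ hr hr1 hκr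
  obtain ⟨hlen, hη⟩ := hscale r M hr hr1.2.le hlo hhi
  have hκM : (κ ^ M)⁻¹ ≤ r ^ min (α / 2) 1 := by
    rw [← inv_pow]
    exact (pow_le_inv_mul_rpow_logb hB hκ0 hκ1 hr hhi).trans hκr
  refine ⟨M + N, by rwa [one_mul] at hlen, fun ω c hω hω' => ?_⟩
  calc ζ.twistedRate s ω c (M + N) ≤ ‖c‖ * η ^ M :=
        hM ω (hκM.trans hω) (hω'.trans (inv_le_of_inv_le₀ (by positivity) hκM)) c
    _ ≤ ‖c‖ * (C * r ^ γ) := by gcongr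
    _ = _ := mul_comm _ _

end Substitution

namespace IsSpectralMeasure

variable {s : Fin m → ℝ} {μ : Measure (ℤ → Fin m)} {ψ : Fin m → ℝ → ℂ} {σ : Measure ℝ} {d : ℝ}

lemma measureReal_Icc_le_mul_rpow (hμ : ζ.IsInvariantMeasure μ) (hd : 0 < d)
    (hds : ∀ i, d ≤ s i) (hs1 : ∀ i, s i ≤ 1) (hψ : IsLipCylindrical s ψ)
    (hσ : IsSpectralMeasure (ζ.suspensionMeasure s μ) (suspensionFlow s) (cylindrical ψ) σ)
    {ω r C γ : ℝ} {n : ℕ} (hr : 0 < r) (hr2 : r ≤ 1 / 2) (hC : 0 ≤ C)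
    (hlen : ζ.lengthBase ^ n * r ≤ C * r ^ γ)
    (hrate : ζ.twistedRate s ω (letterCoeff s ψ ω) n ≤ C * r ^ γ * ‖letterCoeff s ψ ω‖) :
    σ.real (Icc (ω - r) (ω + r)) ≤ (40 + 10 / d) * C * cylLipNorm s ψ ^ 2 * r ^ γ := by
  have hs : ∀ i, 0 < s i := fun i => hd.trans_le (hds i)
  have hL := cylLipNorm_nonneg s ψ
  have hcoeff : ‖letterCoeff s ψ ω‖ ≤ cylLipNorm s ψ :=
    (pi_norm_le_iff_of_nonneg hL).2 (norm_letterCoeff_le hs hs1 hψ.norm_le ω)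
  have hR : 1 ≤ 1 / (2 * r) := by
    rw [le_div_iff₀ (by positivity)]
    linarith
  have hradius : 1 / (2 * (1 / (2 * r))) = r := by field_simp
  calc σ.real (Icc (ω - r) (ω + r))
      ≤ cylLipNorm s ψ * (20 * cylLipNorm s ψ * (ζ.lengthBase ^ n / (1 / (2 * r))) +
          10 * ζ.twistedRate s ω (letterCoeff s ψ ω) n / d) := by
        simpa only [hradius] using hσ.measureReal_Icc_le hμ hd hds hs1 hψ ω hR n
    _ = cylLipNorm s ψ * (40 * cylLipNorm s ψ * (ζ.lengthBase ^ n * r) +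
          10 * ζ.twistedRate s ω (letterCoeff s ψ ω) n / d) := by
        field_simp
        ring
    _ ≤ cylLipNorm s ψ * (40 * cylLipNorm s ψ * (C * r ^ γ) +
          10 * (C * r ^ γ * cylLipNorm s ψ) / d) := by
        gcongr
        exact hrate.trans (by gcongr)
    _ = _ := by ring

end IsSpectralMeasure

lemma measureReal_Icc_le_of_frequency_ranges {σ : Measure ℝ} [IsFiniteMeasure σ] {r x b : ℝ}
    (hx0 : 0 < x) (hx : 4 * x ≤ 1) (hrx : r ≤ x)
    (hsmall : σ.real (Icc (0 - 2 * x) (0 + 2 * x)) ≤ b)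
    (hmid : ∀ ω, x ≤ |ω| → |ω| ≤ x⁻¹ → σ.real (Icc (ω - r) (ω + r)) ≤ b)
    (htail : σ.real {y | 1 / (2 * x) ≤ |y|} ≤ b) (ω : ℝ) :
    σ.real (Icc (ω - r) (ω + r)) ≤ b := by
  rcases lt_or_ge |ω| x with hlt | hlo
  · have hω := abs_lt.1 hlt
    exact (measureReal_mono (Icc_subset_Icc (by linarith) (by linarith))).trans hsmall
  rcases le_or_gt |ω| x⁻¹ with hhi | hgt
  · exact hmid ω hlo hhi
  · refine (measureReal_mono fun y hy => ?_).trans htail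
    have hdist : |ω - y| ≤ r := abs_le.2 ⟨by linarith [hy.2], by linarith [hy.1]⟩
    have habs := abs_sub_abs_le_abs_sub ω y
    have hinv : 1 ≤ x⁻¹ := (one_le_inv₀ hx0).2 (by linarith)
    rw [mem_ofPred_eq, one_div, mul_inv_rev]
    linarith

lemma exists_mem_Icc_of_mem_positiveSimplex [Nonempty (Fin m)] {s : Fin m → ℝ}
    (hs : s ∈ positiveSimplex m) : ∃ d, 0 < d ∧ d ≤ 1 ∧ ∀ i, s i ∈ Icc d 1 := by
  have hs1 (i : Fin m) : s i ≤ 1 :=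
    hs.2 ▸ Finset.single_le_sum (fun j _ => (hs.1 j).le) (Finset.mem_univ i)
  obtain ⟨i₀, hi₀⟩ := Finite.exists_min s
  exact ⟨s i₀, hs.1 i₀, hs1 i₀, fun i => ⟨hi₀ i, hs1 i⟩⟩

theorem Substitution.exists_measureReal_Icc_le_sq_mul_rpow (hprim : ζ.IsPrimitive)
    (hirr : ζ.HasIrreducibleCharpoly) (h2 : 1 < ζ.secondEigenvalueModulus) :
    ∃ γ : ℝ, 0 < γ ∧ ∀ᵐ s ∂simplexMeasure m, ∀ᶠ r in 𝓝[>] (0 : ℝ),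
      ∀ μ, ζ.IsInvariantMeasure μ → ∀ ψ, IsLipCylindrical s ψ →
        ∫ p, cylindrical ψ p ∂(ζ.suspensionMeasure s μ) = 0 → ∀ σ,
          IsSpectralMeasure (ζ.suspensionMeasure s μ) (suspensionFlow s) (cylindrical ψ) σ →
            ∀ ω, σ.real (Icc (ω - r) (ω + r)) ≤ cylLipNorm s ψ ^ 2 * r ^ γ := by
  have : Nonempty (Fin m) := ⟨⟨0, two_pos.trans_le (hirr.two_le h2)⟩⟩
  obtain ⟨γ₀, C₀, hγ₀, hC₀, hzero⟩ := hprim.exists_scale_zero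
  obtain ⟨α, γ₁, C₁, hα, hα1, hγ₁, hC₁, hmid⟩ :=
    Substitution.exists_scale_intermediate hprim hirr h2
  obtain ⟨γ, hγ, hγlt⟩ := exists_between (lt_min (lt_min hγ₁ hα) (mul_pos hα hγ₀))
  obtain ⟨⟨hγγ₁, hγα⟩, hγγ₀⟩ : (γ < γ₁ ∧ γ < α) ∧ γ < α * γ₀ := by simpa using hγlt
  refine ⟨γ, hγ, ?_⟩
  filter_upwards [ae_mem_positiveSimplex m, hmid] with s hsimplex hs
  obtain ⟨d, hd, hd1, hsd⟩ := exists_mem_Icc_of_mem_positiveSimplex hsimplex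
  filter_upwards [hs, Ioo_mem_nhdsGT one_half_pos,
    eventually_mul_rpow_le_rpow ((40 + 10 / d) * C₁) hγγ₁,
    eventually_mul_rpow_le_rpow (12 / d) hγα,
    eventually_mul_rpow_le_rpow ((40 + 10 / d) * C₀ * 2 ^ γ₀) hγγ₀,
    eventually_mul_rpow_le_rpow 4 hα] with r ⟨n, hlen, hrate⟩ ⟨hr, hr2⟩ hmiddle htail hsmall h4
      μ hμ ψ hψ h0 σ hσ ω
  have := hσ.isFiniteMeasure
  rw [Real.rpow_zero] at h4
  have hα0 : 0 < r ^ α := by positivity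
  have hrα : r ≤ r ^ α := by simpa using Real.rpow_le_rpow_of_exponent_ge hr (by linarith) hα1
  have hL : 0 ≤ cylLipNorm s ψ ^ 2 := sq_nonneg _
  refine measureReal_Icc_le_of_frequency_ranges hα0 h4 hrα ?_ (fun ω hlo hhi => ?_) ?_ ω
  · obtain ⟨k, hlen₀, hrate₀⟩ := hzero (2 * r ^ α) (by positivity) (by linarith)
    refine (hσ.measureReal_Icc_le_mul_rpow hμ hd (fun i => (hsd i).1) (fun i => (hsd i).2) hψ
      (by positivity) (by linarith) hC₀ hlen₀
      (hrate₀ s _ μ hμ (hψ.integral_letterCoeff_eq_zero hsimplex.1 hμ h0))).trans ?_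
    rw [Real.mul_rpow zero_le_two hα0.le, ← Real.rpow_mul hr.le]
    linarith [mul_le_mul_of_nonneg_left hsmall hL]
  · refine (hσ.measureReal_Icc_le_mul_rpow hμ hd (fun i => (hsd i).1) (fun i => (hsd i).2) hψ hr
      hr2.le hC₁ hlen (hrate ω _ hlo hhi)).trans ?_
    linarith [mul_le_mul_of_nonneg_left hmiddle hL]
  · refine (hσ.measureReal_tail_le hμ hd (fun i => (hsd i).1) hd1 hψ (by positivity)).trans ?_
    exact (mul_le_mul_of_nonneg_left htail hL).trans' (le_of_eq (by ring))

end Main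

theorem theorem2 :
    ∃ C : ℝ → ℝ, (∀ K, 0 < C K) ∧
      ∀ (m : ℕ) (ζ : Substitution m), ζ.IsPrimitive → ζ.IsAperiodic →
        ζ.HasIrreducibleCharpoly → 1 < ζ.secondEigenvalueModulus →
        ∃ γ : ℝ, 0 < γ ∧
          ∀ᵐ s ∂(simplexMeasure m), ∃ r₀ : ℝ, 0 < r₀ ∧
            ∀ μ : Measure (ℤ → Fin m), ζ.IsInvariantMeasure μ →
            ∀ ψ : Fin m → ℝ → ℂ, IsLipCylindrical s ψ →
              ∫ p, cylindrical ψ p ∂(ζ.suspensionMeasure s μ) = 0 →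
              ∀ σ : Measure ℝ,
                IsSpectralMeasure (ζ.suspensionMeasure s μ) (suspensionFlow s)
                  (cylindrical ψ) σ →
                ∀ ω r : ℝ, 0 < r → r ≤ r₀ →
                  σ.real (Icc (ω - r) (ω + r)) ≤ C (cylLipNorm s ψ) * r ^ γ := by
  refine ⟨fun K => 1 + K ^ 2, fun K => by positivity, fun m ζ hprim _ hirr h2 => ?_⟩
  obtain ⟨γ, hγ, hbound⟩ := Substitution.exists_measureReal_Icc_le_sq_mul_rpow hprim hirr h2
  refine ⟨γ, hγ, hbound.mono fun s hs => ?_⟩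
  obtain ⟨r₀, hr₀, hsub⟩ := mem_nhdsGT_iff_exists_Ioc_subset.1 hs
  refine ⟨r₀, hr₀, fun μ hμ ψ hψ h0 σ hσ ω r hr hrr₀ => ?_⟩
  refine (hsub ⟨hr, hrr₀⟩ μ hμ ψ hψ h0 σ hσ ω).trans ?_
  gcongr
  exact le_add_of_nonneg_left zero_le_one
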